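/- Let $k\ge 3$. The odd graph $O_k$ has as vertices the $k$-subsets of $\{0,\dots,2k\}$, written as $0/1$-strings of length $2k+1$ with $k$ ones (coordinates $0,\dots,2k$ from left to right); two vertices are adjacent iff the subsets are disjoint. A Dyck word has equally many $0$s and $1$s, and in each prefix at least as many $0$s as $1$s. *Uniform 2-factor.* For a Dyck word $x$ of length $2k$ let $p$ be the permutation of $1,\dots,2k$ obtained from the string $12\cdots(2k)$ by reversing the part of the string standing in each prime block $0u1$ of $x$ ($u$ a Dyck word), and then treating recursively in the same way the part standing in each inner word $u$; put $\pi=p^{-1}$. Let $L(x)$ be the closed list of vertices $v_0,v_1,\dots,v_{2k}$ of $O_k$ with $v_0=0x$, in which $v_t$ and $v_{t+1}$ are both $0$ at coordinate $\pi(2k-t)$ and complementary at all other coordinates. The cycles $v_0v_1\cdots v_{2k}v_0$, for all Dyck words $x$ of length $2k$, form the uniform 2-factor of $O_k$. For $0\le j\le 2k$, the flippable edge $FT(x,j)$ is the edge between contiguous lines of $L(x)$ (the last line being followed by the first) that are both $0$ at the $j$-th coordinate from the right (counting from $0$). *Hypergraph $H_k$.* Consider the tuples of words with one underlined entry each $$\begin{aligned}S_1(w)&=\{0w001\underline11,\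 0w\underline01101,\ 0w0101\underline1\}\quad (w\text{ any Dyck word, possibly empty}),\\ S_2&=\{0\underline0110011,\ 0010011\underline1,\ 00010\underline111\},\\ S_3&=\{00011\underline1,\ 0100\underline11,\ \underline010101\},\\ S_4&=\{00011\underline1,\ 0010\underline11,\ 01\underline0011,\ \underline010101\},\end{aligned}$$ and the tuples $\underline S_1(w),\underline S_2,\underline S_3,\underline S_4$ obtained by reversing and complementing each word, the underlined entry being carried along. The vertices of $H_k$ are the lists $L(x)$ of the Dyck words $x$ of length $2k$. A hyperedge of $H_k$ is a set of three or four such lists whose Dyck words are $u\xi v$, where $\xi$ runs over one of these tuples and $u,v$ are a fixed prefix and a fixed suffix; it marks in each of its words the position, counted from the right in the whole word, of the underlined entry. A flipping cycle of a hyperedge $g$ with $\kappa$ vertices ($\kappa\in\{3,4\}$) is a $2\kappa$-cycle of $O_k$ that contains the $\kappa$ flippable edges $FT(x,j)$, for the words $x$ of $g$ and their marked positions $j$; here the lists, as well as the positions, are pairwise different, and the edges are pairwise disjoint. *Trees.* For a set $T$ of hyperedges of $H_k$, let $\psi(T)$ be the simple graph on $V(H_k)$ obtained by replacing each hyperedge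 of $T$ by a clique. $T$ is a spanning tree of $H_k$ if $\psi(T)$ is connected and each cycle of $\psi(T)$ is contained in the clique of exactly one hyperedge of $T$. $T$ is conflict-free if any two of its hyperedges have at most one common vertex and mark different positions in a common vertex. **Theorem.** For every $k\ge 3$: 1. $H_k$ has a conflict-free spanning tree. 2. Every conflict-free spanning tree $T$ of $H_k$ yields a Hamilton cycle of $O_k$: each $g\in T$ has a flipping cycle $C_g$, and, for every choice of flipping cycles $C_g$ ($g\in T$), the symmetric difference of the edge set of the uniform 2-factor and of the edge sets of all the $C_g$ is the edge set of a Hamilton cycle of $O_k$. 3. If $k\ge 6$, then distinct conflict-free spanning trees of $H_k$ yield distinct Hamilton cycles of $O_k$ (as edge sets). -/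

import Mathlib

namespace OddHam

open DyckStep

/-! ### Dyck words and the odd graph

The step `U` plays the role of the bit `0` and `D` that of the bit `1`. -/

/-- Dyck words of length `2k`. -/
abbrev Dyck (k : ℕ) : Type := {x : DyckWord // x.semilength = k}

/-- Vertices of the odd graph: the `k`-subsets of `{0, …, 2k}`. A `0/1`-string of length `2k+1` with
`k` ones (coordinates numbered `0, …, 2k` from left to right) is identified with its support. -/
abbrev OddVertex (k : ℕ) : Type := {s : Finset (Fin (2 * k + 1)) // s.card = k}

/-- The odd graph `O_k`, that is, the Kneser graph of the `k`-subsets of a `(2k+1)`-set. -/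
def oddGraph (k : ℕ) : SimpleGraph (OddVertex k) where
  Adj s t := s ≠ t ∧ Disjoint s.1 t.1
  symm := ⟨fun _ _ h => ⟨h.1.symm, h.2.symm⟩⟩
  loopless := ⟨fun _ h => h.1 rfl⟩

/-! ### The permutation of a Dyck word and the uniform 2-factor -/

/-- The nested reversal procedure. Given a Dyck word `x` and a list `c` of `|x|` entries, cut `x` into
its prime blocks `0u1`, reverse the entries of `c` standing in each block, and then treat the entries
standing in the inner part `u` of each block (without its two end entries) in the same way. -/
def rearrange (x : DyckWord) (c : List ℕ) : List ℕ :=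
  if _h : x = 0 then []
  else
    let m := 2 * x.insidePart.semilength + 2
    let r := (c.take m).reverse
    r.take 1 ++ rearrange x.insidePart r.tail.dropLast ++ r.drop (m - 1)
      ++ rearrange x.outsidePart (c.drop m)
termination_by x.semilength
decreasing_by
  · exact DyckWord.semilength_insidePart_lt _h
  · exact DyckWord.semilength_outsidePart_lt _h

/-- The permutation `p` of `1, …, 2k` attached to a Dyck word, as the list `p(1), …, p(2k)`. -/
def permList {k : ℕ} (x : Dyck k) : List ℕ :=
  rearrange x.1 ((List.range (2 * k)).map (· + 1))

/-- The inverse permutation `π = p⁻¹`: the place of `i` in `p(1), …, p(2k)`. -/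
def perm {k : ℕ} (x : Dyck k) (i : ℕ) : ℕ := (permList x).idxOf i + 1

/-- The lines of the vertical list of `x`. Line `0` is the anchored word `0x`, and line `t+1` is the
neighbour of line `t` in the odd graph in which both lines have the bit `0` at coordinate
`π(2k - t)` and have different bits at all other coordinates (so the coordinates used are successively
the entries of the reversed permutation `π(2k), …, π(1)`). The lines of the list
are those with `0 ≤ t ≤ 2k`. -/
def line {k : ℕ} (x : Dyck k) : ℕ → Finset (Fin (2 * k + 1))
  | 0 => Finset.univ.filter fun i => (U :: x.1.toList)[i.val]? = some D
  | t + 1 => Finset.univ.filter fun i => i ∉ line x t ∧ i.val ≠ perm x (2 * k - t)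

/-- `a` and `b` are contiguous lines of the list of `x`; the last line is followed by the first. -/
def Contiguous {k : ℕ} (x : Dyck k) (a b : OddVertex k) : Prop :=
  ∃ t < 2 * k + 1, a.1 = line x t ∧ b.1 = line x ((t + 1) % (2 * k + 1))

/-- The edges of the uniform 2-factor: the edges of the closed lists of all the Dyck words. -/
def twoFactor (k : ℕ) : Set (Sym2 (OddVertex k)) :=
  {e | ∃ (x : Dyck k) (a b : OddVertex k), e = s(a, b) ∧ Contiguous x a b}

/-- `e` is the flippable edge of the list of `x` at the `j`-th coordinate counted
from the right (`0 ≤ j ≤ 2k`): it joins contiguous lines which both have the bit `0` there. -/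
def IsFlippableEdge {k : ℕ} (x : Dyck k) (j : ℕ) (e : Sym2 (OddVertex k)) : Prop :=
  ∃ a b : OddVertex k, e = s(a, b) ∧ Contiguous x a b ∧
    ∃ i : Fin (2 * k + 1), i.val + j = 2 * k ∧ i ∉ a.1 ∧ i ∉ b.1

/-! ### The basic tuples -/

/-- A word with a marked position; positions are counted from the right, starting from `0`. -/
abbrev MarkedWord : Type := List DyckStep × ℕ

/-- `0w001[1]1`, `0w[0]1101`, `0w0101[1]`; the marked entry is in brackets. -/
def S₁ (w : DyckWord) : List MarkedWord :=
  [([U] ++ w.toList ++ [U, U, D, D, D], 1),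
   ([U] ++ w.toList ++ [U, D, D, U, D], 4),
   ([U] ++ w.toList ++ [U, D, U, D, D], 0)]

/-- `0[0]110011`, `0010011[1]`, `00010[1]11`. -/
def S₂ : List MarkedWord :=
  [([U, U, D, D, U, U, D, D], 6),
   ([U, U, D, U, U, D, D, D], 0),
   ([U, U, U, D, U, D, D, D], 2)]

/-- `00011[1]`, `0100[1]1`, `[0]10101`. -/
def S₃ : List MarkedWord :=
  [([U, U, U, D, D, D], 0),
   ([U, D, U, U, D, D], 1),
   ([U, D, U, D, U, D], 5)]

/-- `00011[1]`, `0010[1]1`, `01[0]011`, `[0]10101`. -/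
def S₄ : List MarkedWord :=
  [([U, U, U, D, D, D], 0),
   ([U, U, D, U, D, D], 1),
   ([U, D, U, U, D, D], 3),
   ([U, D, U, D, U, D], 5)]

/-- The tuples `S₁(w)`, `S₂`, `S₃`, `S₄`. -/
def IsBasicTuple (τ : List MarkedWord) : Prop :=
  (∃ w : DyckWord, τ = S₁ w) ∨ τ = S₂ ∨ τ = S₃ ∨ τ = S₄

/-- Complementation of a bit. -/
def compl : DyckStep → DyckStep
  | U => D
  | D => U

/-- The complement of the reversed word, with the marked position carried along. -/
def reverseCompl (m : MarkedWord) : MarkedWord :=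
  ((m.1.reverse).map compl, m.1.length - 1 - m.2)

/-- Insert a marked word `ξ` between `u` and `v`. -/
def insertBetween (u v : List DyckStep) (m : MarkedWord) : MarkedWord :=
  (u ++ m.1 ++ v, m.2 + v.length)

/-! ### The hypergraph `H_k` -/

/-- A finite set of Dyck words of length `2k` with marked positions (counted from the right). The
word `x` stands for the vertex `L(x)`, the cycle of the uniform 2-factor that starts at `0x`. -/
abbrev MarkedTuple (k : ℕ) : Type := Finset (Dyck k × ℕ)

/-- The vertices (Dyck words) of a marked tuple, without the marks. -/
def verts {k : ℕ} (g : MarkedTuple k) : Finset (Dyck k) := g.image Prod.fst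

/-- Hyperedges of `H_k`: the words of a basic tuple, or of the tuple of its reversed complements,
placed between a common prefix `u` and a common suffix `v`. Each hyperedge carries the positions of its
marked entries. -/
def IsHyperedge (k : ℕ) (g : MarkedTuple k) : Prop :=
  ∃ (τ : List MarkedWord) (u v : List DyckStep), IsBasicTuple τ ∧
    (g.image (fun p => (p.1.1.toList, p.2)) = (τ.map (insertBetween u v)).toFinset ∨
     g.image (fun p => (p.1.1.toList, p.2)) =
       ((τ.map reverseCompl).map (insertBetween u v)).toFinset)

/-- The simple graph `ψ(T)` obtained by replacing each hyperedge of `T` by a clique. -/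
def cliqueGraph {k : ℕ} (T : Finset (MarkedTuple k)) : SimpleGraph (Dyck k) where
  Adj x y := x ≠ y ∧ ∃ g ∈ T, x ∈ verts g ∧ y ∈ verts g
  symm := ⟨fun _ _ h => ⟨h.1.symm, h.2.imp fun _ hg => ⟨hg.1, hg.2.2, hg.2.1⟩⟩⟩
  loopless := ⟨fun _ h => h.1 rfl⟩

/-- `T` is (the set of hyperedges of) a spanning tree of `H_k`: `ψ(T)` is connected on all the vertices
of `H_k`, and each cycle of `ψ(T)` lies inside the clique of exactly one hyperedge of `T`. -/
structure IsSpanningTree (k : ℕ) (T : Finset (MarkedTuple k)) : Prop where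
  hyperedge : ∀ g ∈ T, IsHyperedge k g
  connected : (cliqueGraph T).Connected
  cycle : ∀ (x : Dyck k) (c : (cliqueGraph T).Walk x x), c.IsCycle →
    ∃! g, g ∈ T ∧ ∀ y ∈ c.support, y ∈ verts g

/-- `T` is conflict-free: two hyperedges have at most one common vertex, and the
positions that they mark in a common vertex are different. -/
structure IsConflictFree {k : ℕ} (T : Finset (MarkedTuple k)) : Prop where
  card_inter_le : ∀ g ∈ T, ∀ g' ∈ T, g ≠ g' → (verts g ∩ verts g').card ≤ 1
  mark_ne : ∀ g ∈ T, ∀ g' ∈ T, g ≠ g' → ∀ (x : Dyck k) (j j' : ℕ),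
    (x, j) ∈ g → (x, j') ∈ g' → j ≠ j'

/-! ### Flipping cycles and the Hamilton cycle of a tree -/

/-- `E` is the edge set of a flipping `κ`-cycle for `g`, with `κ = |g| > 2`: a `2κ`-cycle of `O_k`
containing pairwise disjoint edges which are the flippable edges of the `κ` pairwise different lists of
`g` at the marked positions, these positions being pairwise different. -/
def IsFlippingCycle {k : ℕ} (g : MarkedTuple k) (E : Set (Sym2 (OddVertex k))) : Prop :=
  2 < g.card ∧
  (g : Set (Dyck k × ℕ)).Pairwise (fun p q => p.1 ≠ q.1 ∧ p.2 ≠ q.2) ∧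
  ∃ (a : OddVertex k) (c : (oddGraph k).Walk a a),
    c.IsCycle ∧ c.length = 2 * g.card ∧ c.edgeSet = E ∧
    ∃ f : Dyck k × ℕ → Sym2 (OddVertex k),
      (∀ p ∈ g, IsFlippableEdge p.1 p.2 (f p) ∧ f p ∈ E) ∧
      (g : Set (Dyck k × ℕ)).Pairwise (fun p q => ∀ b, b ∈ f p → b ∉ f q)

open Classical in
/-- `T` yields `H`: the edge set `H` is the symmetric difference of the uniform 2-factor and of flipping
cycles `C g`, one for each hyperedge `g` of `T`. (The symmetric difference of a finite
family of sets consists of the elements that lie in an odd number of them.) -/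
def Yields {k : ℕ} (T : Finset (MarkedTuple k)) (H : Set (Sym2 (OddVertex k))) : Prop :=
  ∃ C : MarkedTuple k → Set (Sym2 (OddVertex k)),
    (∀ g ∈ T, IsFlippingCycle g (C g)) ∧
    H = symmDiff (twoFactor k) {e | Odd (T.filter fun g => e ∈ C g).card}

/-- `H` is the edge set of a Hamilton cycle of `O_k`. -/
def IsHamiltonEdgeSet (k : ℕ) (H : Set (Sym2 (OddVertex k))) : Prop :=
  ∃ (a : OddVertex k) (c : (oddGraph k).Walk a a), c.IsHamiltonianCycle ∧ c.edgeSet = H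

end OddHam

namespace OddHam

open DyckStep

/-! ### Induction on Dyck words and the nested reversal -/

/-! The 2-factor. Passing from one line to the next complements every coordinate but one. Hence, up
to complementing the odd lines, line `t` of the list of `x` is `0x` with the `t` entries of largest
`p`-value flipped (`mem_line`). By `rearrange_parity` the `1`s of `x` are exactly the entries of odd
`p`-value, so each line has a `0` at the coordinate used next. After `2k` passages all entries are
flipped and the list closes up at coordinate `0`. A Dyck word and the number of flipped entries can
be read off from the flipped word (`flipWord_inj`), so all lines of all lists are different. There
are `(2k+1)` times the Catalan number of them, which is the number of vertices of `O_k`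
(`vtx_bijective`).

Gluing. The `κ` flippable edges of a flipping cycle have `2κ` ends, which are all its vertices. The
cycle therefore alternates between flippable edges and edges joining different lists. In a
conflict-free tree no edge lies on two of the cycles, so taking symmetric differences keeps all
degrees equal to 2. Adding the hyperedges one at a time merges components exactly as in the tree
(`FlipFamily.reachable_glue`), and a connected graph with all degrees 2 is a Hamilton cycle.

Existence of flipping cycles. The order of `p` at two places depends only on the parity of the
minimal height between them (`rearrange_order`). This gives the bits at a flippable edge in terms of
heights. Outside the inserted word the bits agree for all words of a hyperedge; inside, they depend
only on the inserted word and the parity of the height of the prefix. After removing common ends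
there are eight templates, and the required adjacencies become a finite check
(`exists_isFlippingCycle`).

Distinctness. Suppose two conflict-free families yield the same edge set. If a cycle `C g` of the
first and a cycle `C' g'` of the second share a factor edge at `v` but leave `v` differently, there
are further members `l`, `l'` with `g`, `l'` sharing an edge and `g'`, `l` sharing an edge. Such
pairs have two common words and a common mark (`FlipData.exists_mark`, `FlipData.sharing`), and a
finite check shows that then `g`, `l` or `g'`, `l'` have two common words, against conflict-freeness
(`Sharing.exists_common`). So the cycles, and with them the hyperedges, coincide.

Existence of trees. Words are sorted by their first block `0u1`. The words `01z` carry a smaller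
tree. For each `y` the words `0u1y` with `|u| ≥ 4` carry two smaller trees, hung onto the words
`01z` by one hyperedge (`GoodForest.exists_column`). The words `0011z` carry another smaller tree,
attached by one last hyperedge (`GoodTree.step`). Certain marks are kept unused throughout to avoid
conflicts. -/

theorem dyck_induction {P : DyckWord → Prop} (zero : P 0)
    (step : ∀ u y, P u → P y → P (u.nest + y)) (x : DyckWord) : P x := by
  induction h : x.semilength using Nat.strong_induction_on generalizing x with
  | _ n ih =>
    by_cases hx : x = 0
    · subst hx; exact zero
    · rw [← DyckWord.nest_insidePart_add_outsidePart hx]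
      exact step _ _ (ih _ (h ▸ DyckWord.semilength_insidePart_lt hx) _ rfl)
        (ih _ (h ▸ DyckWord.semilength_outsidePart_lt hx) _ rfl)

theorem toList_add (x y : DyckWord) : (x + y).toList = x.toList ++ y.toList := rfl

theorem toList_nest (u : DyckWord) : u.nest.toList = U :: (u.toList ++ [D]) := rfl

theorem toList_zero : (0 : DyckWord).toList = [] := rfl

theorem toList_nest_add (u y : DyckWord) :
    (u.nest + y).toList = U :: (u.toList ++ D :: y.toList) := by
  simp [toList_add, toList_nest]

theorem nest_add_ne_zero (u y : DyckWord) : u.nest + y ≠ 0 := by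
  rw [← DyckWord.toList_ne_nil, toList_nest_add]; simp

theorem insidePart_nest_add (u y : DyckWord) : (u.nest + y).insidePart = u := by
  rw [DyckWord.insidePart_add DyckWord.nest_ne_zero, DyckWord.insidePart_nest]

theorem outsidePart_nest_add (u y : DyckWord) : (u.nest + y).outsidePart = y := by
  rw [DyckWord.outsidePart_add DyckWord.nest_ne_zero, DyckWord.outsidePart_nest, zero_add]

theorem nest_add_inj {u y u' y' : DyckWord} :
    u.nest + y = u'.nest + y' ↔ u = u' ∧ y = y' := by
  refine ⟨fun h => ⟨?_, ?_⟩, fun h => by rw [h.1, h.2]⟩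
  · rw [← insidePart_nest_add u y, h, insidePart_nest_add]
  · rw [← outsidePart_nest_add u y, h, outsidePart_nest_add]

theorem length_toList (x : DyckWord) : x.toList.length = 2 * x.semilength :=
  (DyckWord.two_mul_semilength_eq_length).symm

theorem rearrange_zero (c : List ℕ) : rearrange 0 c = [] := by
  rw [rearrange]; simp

/-- The form of the recursion used in all inductions: reversing a block exchanges its end entries
and hands the reversed middle to the inner word. -/
theorem rearrange_nest_add (u y : DyckWord) (a b : ℕ) (mid rest : List ℕ)
    (h : mid.length = 2 * u.semilength) :
    rearrange (u.nest + y) (a :: (mid ++ b :: rest)) =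
      b :: (rearrange u mid.reverse ++ a :: rearrange y rest) := by
  rw [rearrange]
  have h1 : (a :: (mid ++ b :: rest)).take (2 * u.semilength + 2) = a :: (mid ++ [b]) := by
    rw [List.take_succ_cons, ← h, List.take_append]
    simp
  have h2 : (a :: (mid ++ b :: rest)).drop (2 * u.semilength + 2) = rest := by
    rw [List.drop_succ_cons, ← h, List.drop_append]
    simp
  simp only [dif_neg (nest_add_ne_zero u y), insidePart_nest_add, outsidePart_nest_add, h1, h2]
  have h3 : List.drop (2 * u.semilength + 2 - 1) (a :: (mid ++ [b])).reverse = [a] := by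
    simp only [List.reverse_cons, List.reverse_append, List.reverse_nil, List.nil_append,
      List.cons_append, Nat.add_one_sub_one, List.drop_succ_cons]
    rw [List.drop_append]
    simp [h]
  rw [h3]
  simp

theorem exists_split (u y : DyckWord) (c : List ℕ)
    (hc : c.length = 2 * (u.nest + y).semilength) :
    ∃ a mid b rest, c = a :: (mid ++ b :: rest) ∧ mid.length = 2 * u.semilength ∧
      rest.length = 2 * y.semilength := by
  simp only [DyckWord.semilength_add, DyckWord.semilength_nest] at hc
  obtain _ | ⟨a, c⟩ := c
  · simp only [List.length_nil] at hc; omega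
  rw [List.length_cons] at hc
  have h2 : (c.drop (2 * u.semilength)).length = 2 * y.semilength + 1 := by
    rw [List.length_drop]; omega
  obtain ⟨b, rest, hr⟩ := List.exists_cons_of_length_eq_add_one h2
  refine ⟨a, c.take (2 * u.semilength), b, rest, ?_, ?_, ?_⟩
  · rw [← hr, List.take_append_drop]
  · rw [List.length_take]; omega
  · rw [hr, List.length_cons] at h2; omega

theorem rearrange_perm (x : DyckWord) : ∀ c : List ℕ, c.length = 2 * x.semilength →
    (rearrange x c).Perm c := by
  induction x using dyck_induction with
  | zero => intro c hc; simp at hc; simp [rearrange_zero, hc]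
  | step u y hu hy =>
    intro c hc
    obtain ⟨a, mid, b, rest, rfl, hm, hr⟩ := exists_split u y c hc
    rw [rearrange_nest_add _ _ _ _ _ _ hm]
    have h1 := (hu mid.reverse (by simpa using hm)).trans mid.reverse_perm
    have h2 := hy rest hr
    calc b :: (rearrange u mid.reverse ++ a :: rearrange y rest)
        |>.Perm (b :: (mid ++ a :: rest)) := (h1.append (h2.cons a)).cons b
      _ |>.Perm (a :: (mid ++ b :: rest)) := by
          refine (List.perm_middle.cons b).trans ?_
          refine (List.Perm.swap a b _).trans ?_
          exact List.perm_middle.symm.cons a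

theorem length_rearrange (x : DyckWord) (c : List ℕ) (hc : c.length = 2 * x.semilength) :
    (rearrange x c).length = 2 * x.semilength := by
  rw [(rearrange_perm x c hc).length_eq, hc]

theorem rearrange_map (f : ℕ → ℕ) (x : DyckWord) : ∀ c : List ℕ, c.length = 2 * x.semilength →
    rearrange x (c.map f) = (rearrange x c).map f := by
  induction x using dyck_induction with
  | zero => intro c _; simp [rearrange_zero]
  | step u y hu hy =>
    intro c hc
    obtain ⟨a, mid, b, rest, rfl, hm, hr⟩ := exists_split u y c hc
    have : (a :: (mid ++ b :: rest)).map f = f a :: (mid.map f ++ f b :: rest.map f) := by simp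
    rw [this, rearrange_nest_add _ _ _ _ _ _ (by simpa using hm),
      rearrange_nest_add _ _ _ _ _ _ hm, ← List.map_reverse, hu _ (by simpa using hm), hy _ hr]
    simp

theorem rearrange_replicate (x : DyckWord) (a : ℕ) :
    rearrange x (List.replicate (2 * x.semilength) a) = List.replicate (2 * x.semilength) a := by
  have h := rearrange_perm x (List.replicate (2 * x.semilength) a) (by simp)
  rwa [List.perm_replicate] at h

/-- The height of a path after its first `i` steps. -/
def height (l : List DyckStep) (i : ℕ) : ℤ := (l.take i).count U - (l.take i).count D

theorem getElem?_nested {α : Type*} {p q : α} {l₁ l₂ : List α} {m : ℕ} (h : l₁.length = m)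
    (i : ℕ) : (p :: (l₁ ++ q :: l₂))[i]? =
      if i = 0 then some p else if i ≤ m then l₁[i - 1]? else
        if i = m + 1 then some q else l₂[i - (m + 2)]? := by
  obtain _ | i := i
  · simp
  rw [List.getElem?_cons_succ, List.getElem?_append]
  rcases lt_trichotomy i m with hi | hi | hi
  · rw [if_pos (by omega), if_neg (by omega), if_pos (by omega)]; rfl
  · rw [if_neg (by omega), if_neg (by omega), if_neg (by omega), if_pos (by omega)]
    simp [h, hi]
  · rw [if_neg (by omega), if_neg (by omega), if_neg (by omega), if_neg (by omega)]
    obtain ⟨d, rfl⟩ : ∃ d, i = m + 1 + d := ⟨i - (m + 1), by omega⟩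
    rw [show m + 1 + d - l₁.length = d + 1 by omega, List.getElem?_cons_succ]
    congr 1; omega

theorem height_zero (l : List DyckStep) : height l 0 = 0 := by simp [height]

theorem height_append_left (l l' : List DyckStep) (i : ℕ) (h : i ≤ l.length) :
    height (l ++ l') i = height l i := by
  simp [height, List.take_append, Nat.sub_eq_zero_of_le h]

theorem height_append_right (l l' : List DyckStep) (i : ℕ) :
    height (l ++ l') (l.length + i) = height l l.length + height l' i := by
  simp [height, List.take_append, List.take_of_length_le]; ring

theorem height_cons (s : DyckStep) (l : List DyckStep) (i : ℕ) :
    height (s :: l) (i + 1) = (if s = U then 1 else -1) + height l i := by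
  cases s <;> simp [height] <;> ring

theorem height_length (x : DyckWord) : height x.toList x.toList.length = 0 := by
  simp [height, x.count_U_eq_count_D]

theorem height_nonneg (x : DyckWord) (i : ℕ) : 0 ≤ height x.toList i := by
  have := x.count_D_le_count_U i
  simp only [height]; omega

theorem height_nest_inner (u y : DyckWord) (i : ℕ) (h : i ≤ 2 * u.semilength) :
    height (u.nest + y).toList (i + 1) = 1 + height u.toList i := by
  rw [toList_nest_add, height_cons, height_append_left _ _ _ (by rw [length_toList]; exact h)]
  simp

theorem height_nest_outer (u y : DyckWord) (i : ℕ) :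
    height (u.nest + y).toList (2 * u.semilength + 2 + i) = height y.toList i := by
  have h := length_toList u
  rw [toList_nest_add, show 2 * u.semilength + 2 + i = (u.toList.length + (i + 1)) + 1 by omega,
    height_cons, height_append_right, height_cons, height_length]
  simp

/-- Entries of the rearranged list have a parity determined by the step at their place. -/
theorem rearrange_parity (x : DyckWord) (e : ℕ) : ∀ c : List ℕ, c.length = 2 * x.semilength →
    (∀ i v : ℕ, (c)[i]? = some v → v % 2 = (i + e) % 2) →
    ∀ (i v : ℕ) (s : DyckStep), (rearrange x c)[i]? = some v → x.toList[i]? = some s →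
      v % 2 = (if s = U then e + 1 else e) % 2 := by
  induction x using dyck_induction with
  | zero => intro c _ _ i v s h; simp [rearrange_zero] at h
  | step u y hu hy =>
    intro c hc hp i v s hv hs
    obtain ⟨a, mid, b, rest, rfl, hm, hr⟩ := exists_split u y c hc
    rw [rearrange_nest_add _ _ _ _ _ _ hm,
      getElem?_nested (length_rearrange u _ (by simpa using hm))] at hv
    rw [toList_nest_add, getElem?_nested (length_toList u)] at hs
    have hp' := fun i => hp i
    simp only [getElem?_nested hm] at hp'
    split_ifs at hv hs with h1 h2 h3
    · simp only [Option.some.injEq] at hv hs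
      subst hv; subst hs
      have := hp' (2 * u.semilength + 1) b (by simp)
      simp; omega
    · refine hu mid.reverse (by simpa using hm) ?_ (i - 1) v s hv hs
      intro j w hw
      have hj : j < mid.length := by
        by_contra hj
        rw [List.getElem?_eq_none (by simpa using hj)] at hw; simp at hw
      rw [List.getElem?_reverse hj] at hw
      -- Place `j` of the reversed middle is place `|mid| - j` of the whole list. Since `|mid|` is
      -- even, the parity is the same and the hypothesis passes to the inner word with the same `e`.
      have := hp' (mid.length - 1 - j + 1) w (by
        rw [if_neg (by omega), if_pos (by omega)]; exact hw)
      omega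
    · simp only [Option.some.injEq] at hv hs
      subst hv; subst hs
      have := hp' 0 a (by simp)
      simp; omega
    · refine hy rest hr ?_ _ v s hv hs
      intro j w hw
      have := hp' (2 * u.semilength + 2 + j) w (by
        rw [if_neg (by omega), if_neg (by omega), if_neg (by omega)]
        rw [show 2 * u.semilength + 2 + j - (2 * u.semilength + 2) = j by omega]; exact hw)
      omega

/-- The order of two entries of the rearranged list is decided by the parity of the minimal height
of the path between their places. -/
theorem rearrange_order (x : DyckWord) : ∀ (R : ℕ → ℕ → Prop) (c : List ℕ),
    c.length = 2 * x.semilength → c.Pairwise R →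
    ∀ i j vi vj s, (rearrange x c)[i]? = some vi → (rearrange x c)[j]? = some vj →
      i < s → s ≤ j → (∀ s', i < s' → s' ≤ j → height x.toList s ≤ height x.toList s') →
      (Even (height x.toList s) → R vi vj) ∧ (Odd (height x.toList s) → R vj vi) := by
  induction x using dyck_induction with
  | zero => intro R c _ _ i j vi vj s h; simp [rearrange_zero] at h
  | step u y hu hy =>
    intro R c hc hp i j vi vj s hi hj his hsj hmin
    obtain ⟨a, mid, b, rest, rfl, hm, hr⟩ := exists_split u y c hc
    have hm' : mid.reverse.length = 2 * u.semilength := by simpa using hm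
    simp only [List.pairwise_cons, List.pairwise_append, List.mem_append, List.mem_cons] at hp
    obtain ⟨hpa, hpm, ⟨hpb, hpr⟩, hpmb⟩ := hp
    rw [rearrange_nest_add _ _ _ _ _ _ hm,
      getElem?_nested (length_rearrange u _ (by simpa using hm))] at hi hj
    have hmemu : ∀ {i v : ℕ}, (rearrange u mid.reverse)[i]? = some v → v ∈ mid := fun h => by
      have := (rearrange_perm u mid.reverse hm').mem_iff.1 (List.mem_of_getElem? h)
      simpa using this
    have hmemy : ∀ {i v : ℕ}, (rearrange y rest)[i]? = some v → v ∈ rest := fun h =>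
      (rearrange_perm y rest hr).mem_iff.1 (List.mem_of_getElem? h)
    set H := height (u.nest + y).toList with hH
    have hin : ∀ i, i ≤ 2 * u.semilength → H (i + 1) = 1 + height u.toList i :=
      height_nest_inner u y
    have hout : ∀ i, H (2 * u.semilength + 2 + i) = height y.toList i := height_nest_outer u y
    have hpos : ∀ s, 0 < s → s ≤ 2 * u.semilength + 1 → 1 ≤ H s := fun s h0 h1 => by
      obtain ⟨s, rfl⟩ := Nat.exists_eq_add_of_lt h0
      rw [show 0 + s + 1 = s + 1 by ring, hin _ (by omega)]
      linarith [height_nonneg u s]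
    have hnn : ∀ s, 0 ≤ H s := height_nonneg _
    have hz : H (2 * u.semilength + 2) = 0 := by rw [← height_zero y.toList, ← hout 0]
    have h1 : H 1 = 1 := by rw [hin 0 (by omega), height_zero]; rfl
    have hl : H (2 * u.semilength + 1) = 1 := by
      rw [hin _ le_rfl, ← length_toList, height_length]; rfl
    -- A path from inside the first block to a place beyond it touches height `0` at the end of the
    -- block.
    have case0 : i ≤ 2 * u.semilength + 1 → 2 * u.semilength + 2 ≤ j → H s = 0 := fun h h' =>
      le_antisymm (hz ▸ hmin (2 * u.semilength + 2) (by omega) h') (hnn s)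
    have evenR : H s = 0 → R vi vj → (Even (H s) → R vi vj) ∧ (Odd (H s) → R vj vi) :=
      fun h hR => ⟨fun _ => hR, fun ho => by rw [h] at ho; exact absurd ho (by decide)⟩
    have oddR : H s = 1 → R vj vi → (Even (H s) → R vi vj) ∧ (Odd (H s) → R vj vi) :=
      fun h hR => ⟨fun he => by rw [h] at he; exact absurd he (by decide), fun _ => hR⟩
    split_ifs at hi hj with a1 b1 b2 b3 a2 b4 b5 b6 a3 b7 b8
    all_goals try omega
    · simp only [Option.some.injEq] at hi; subst hi; subst a1
      exact oddR (le_antisymm (h1 ▸ hmin 1 (by omega) (by omega)) (hpos s his (by omega)))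
        (hpmb _ (hmemu hj) _ (Or.inl rfl))
    · simp only [Option.some.injEq] at hi hj; subst hi; subst a1; subst hj
      exact oddR (le_antisymm (h1 ▸ hmin 1 (by omega) (by omega)) (hpos s his (by omega)))
        (hpa _ (Or.inr (Or.inl rfl)))
    · simp only [Option.some.injEq] at hi; subst hi
      exact evenR (case0 (by omega) (by omega)) (hpb _ (hmemy hj))
    · obtain ⟨s, rfl⟩ : ∃ t, s = t + 1 := ⟨s - 1, by omega⟩
      -- Entering the block lowers all heights by one and reverses the entries, so the parity and
      -- the direction of the relation change together.
      have := hu (fun a b => R b a) mid.reverse hm' (List.pairwise_reverse.2 hpm) (i - 1) (j - 1)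
        vi vj s hi hj (by omega) (by omega) (fun s' h h' => by
          have := hmin (s' + 1) (by omega) (by omega)
          rw [hin _ (by omega), hin _ (by omega)] at this
          linarith)
      rw [hin _ (by omega)]
      refine ⟨fun he => this.2 ?_, fun ho => this.1 ?_⟩
      · obtain ⟨d, hd⟩ := he
        exact ⟨d - 1, by linarith⟩
      · obtain ⟨d, hd⟩ := ho
        exact ⟨d, by linarith⟩
    · simp only [Option.some.injEq] at hj; subst hj
      exact oddR (le_antisymm (hl ▸ hmin _ (by omega) (by omega)) (hpos s (by omega) (by omega)))
        (hpa _ (Or.inl (hmemu hi)))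
    · exact evenR (case0 (by omega) (by omega)) (hpmb _ (hmemu hi) _ (Or.inr (hmemy hj)))
    · simp only [Option.some.injEq] at hi; subst hi
      exact evenR (case0 (by omega) (by omega)) (hpa _ (Or.inr (Or.inr (hmemy hj))))
    · obtain ⟨s, rfl⟩ : ∃ t, s = 2 * u.semilength + 2 + t := ⟨s - (2 * u.semilength + 2), by omega⟩
      rw [hout]
      refine hy R rest hr hpr (i - (2 * u.semilength + 2)) (j - (2 * u.semilength + 2))
        vi vj s hi hj (by omega) (by omega) (fun s' h h' => ?_)
      have := hmin (2 * u.semilength + 2 + s') (by omega) (by omega)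
      rwa [hout, hout] at this

/-! ### A word with a partially traversed walk determines the Dyck word and the time -/

theorem compl_U : compl U = D := rfl

theorem compl_D : compl D = U := rfl

theorem compl_compl (s : DyckStep) : compl (compl s) = s := by cases s <;> rfl

/-- The displayed `D` is the first step of the path that goes below height `0`, so its place is
determined by the path. -/
theorem dyck_prefix_unique {x x' : DyckWord} {r r' : List DyckStep}
    (h : x.toList ++ D :: r = x'.toList ++ D :: r') : x = x' ∧ r = r' := by
  have key : ∀ {x x' : DyckWord} {r r' : List DyckStep},
      x.toList ++ D :: r = x'.toList ++ D :: r' → ¬ x.toList.length < x'.toList.length := by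
    intro x x' r r' h hlt
    have h1 := congrArg (List.take (x.toList.length + 1)) h
    rw [List.take_append, List.take_append_of_le_length (by omega),
      List.take_of_length_le (by omega), Nat.add_sub_cancel_left] at h1
    have h2 := x'.count_D_le_count_U (x.toList.length + 1)
    rw [← h1] at h2
    have := x.count_U_eq_count_D
    simp at h2
    omega
  have hl : x.toList.length = x'.toList.length :=
    le_antisymm (not_lt.1 (key h.symm)) (not_lt.1 (key h))
  obtain ⟨h1, h2⟩ := List.append_inj h hl
  exact ⟨DyckWord.ext h1, by simpa using h2⟩

theorem dyck_ne_dyck_append (x x' : DyckWord) (r : List DyckStep) :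
    x.toList ++ D :: r ≠ x'.toList := by
  intro h
  have h2 := x'.count_D_le_count_U (x.toList.length + 1)
  rw [← h, List.take_append, List.take_of_length_le (by omega), Nat.add_sub_cancel_left] at h2
  have := x.count_U_eq_count_D
  simp at h2
  omega

theorem exists_reverseCompl (x : DyckWord) :
    ∃ z : DyckWord, z.toList = (x.toList.map compl).reverse := by
  induction x using dyck_induction with
  | zero => exact ⟨0, by simp [toList_zero]⟩
  | step u y hu hy =>
    obtain ⟨u', hu⟩ := hu
    obtain ⟨y', hy⟩ := hy
    exact ⟨y' + u'.nest, by
      rw [toList_add, toList_nest, toList_nest_add, hu, hy]; simp [compl]⟩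

/-- A complemented Dyck word at the right end is the mirror image of a situation covered by
`dyck_prefix_unique`: reversed, it becomes a Dyck word, and the `D` before it is the first step
below `0`. -/
theorem append_compl_unique {W W' : List DyckStep} {y y' : DyckWord}
    (h : W ++ D :: y.toList.map compl = W' ++ D :: y'.toList.map compl) : y = y' ∧ W = W' := by
  obtain ⟨z, hz⟩ := exists_reverseCompl y
  obtain ⟨z', hz'⟩ := exists_reverseCompl y'
  have h1 : z.toList ++ D :: W.reverse = z'.toList ++ D :: W'.reverse := by
    rw [hz, hz']; simpa using congrArg List.reverse h
  obtain ⟨h2, h3⟩ := dyck_prefix_unique h1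
  rw [h2, hz', List.reverse_inj] at hz
  refine ⟨DyckWord.ext ?_, by simpa using h3⟩
  exact (List.map_injective_iff.2 (Function.LeftInverse.injective compl_compl) hz).symm

theorem append_compl_ne {W : List DyckStep} {y x : DyckWord}
    (h : W ++ D :: y.toList.map compl = x.toList.map compl) : False := by
  obtain ⟨z, hz⟩ := exists_reverseCompl y
  obtain ⟨z', hz'⟩ := exists_reverseCompl x
  refine dyck_ne_dyck_append z z' W.reverse ?_
  rw [hz, hz']; simpa using congrArg List.reverse h

/-- Flip a step if the flag is nonzero. -/
def flipStep (s : DyckStep) (n : ℕ) : DyckStep := if n = 0 then s else compl s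

/-- The word `x` with its steps flipped according to the rearranged flags. -/
def flipWord (x : DyckWord) (c : List ℕ) : List DyckStep :=
  List.zipWith flipStep x.toList (rearrange x c)

theorem flipWord_nest_add (u y : DyckWord) (a b : ℕ) (mid rest : List ℕ)
    (h : mid.length = 2 * u.semilength) :
    flipWord (u.nest + y) (a :: (mid ++ b :: rest)) =
      flipStep U b :: (flipWord u mid.reverse ++ flipStep D a :: flipWord y rest) := by
  rw [flipWord, rearrange_nest_add _ _ _ _ _ _ h, toList_nest_add, List.zipWith_cons_cons,
    List.zipWith_append (by
      rw [length_toList, length_rearrange _ _ (by simpa using h)])]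
  rfl

theorem flipWord_replicate (x : DyckWord) (n : ℕ) :
    flipWord x (List.replicate (2 * x.semilength) n) = x.toList.map (flipStep · n) := by
  rw [flipWord, rearrange_replicate, ← length_toList]
  generalize x.toList = l
  induction l with
  | nil => rfl
  | cons a l ih => simp [List.replicate_succ, ih]

theorem flipWord_of_forall_eq (x : DyckWord) (c : List ℕ) (n : ℕ)
    (hc : c.length = 2 * x.semilength) (h : ∀ v ∈ c, v = n) :
    flipWord x c = x.toList.map (flipStep · n) := by
  rw [← flipWord_replicate, List.eq_replicate_of_mem h, hc]

theorem flipStep_zero : (flipStep · 0) = id := by funext s; simp [flipStep]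

theorem flipStep_one : (flipStep · 1) = compl := by funext s; simp [flipStep]

theorem map_compl_inj {l l' : List DyckStep} (h : l.map compl = l'.map compl) : l = l' :=
  List.map_injective_iff.2 (Function.LeftInverse.injective compl_compl) h

theorem eq_of_forall_eq {c c' : List ℕ} {n : ℕ} (hl : c.length = c'.length)
    (h : ∀ v ∈ c, v = n) (h' : ∀ v ∈ c', v = n) : c = c' := by
  rw [List.eq_replicate_of_mem h, List.eq_replicate_of_mem h', hl]

theorem flipWord_zero (c : List ℕ) : flipWord 0 c = [] := rfl

/-- Increasing and decreasing flags are treated together because the reversal of the middle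
exchanges them. The first letter shows the flag `b` of the first step. By monotonicity this flag
forces one side of the block to be flipped entirely or not at all, which makes the end of the block
visible as a step below `0`, read from the left or from the right. -/
theorem flipWord_inj (x : DyckWord) :
    (∀ (x' : DyckWord) (c c' : List ℕ), c.length = 2 * x.semilength →
      c'.length = 2 * x'.semilength → (∀ v ∈ c, v ≤ 1) → (∀ v ∈ c', v ≤ 1) →
      c.Pairwise (· ≤ ·) → c'.Pairwise (· ≤ ·) → flipWord x c = flipWord x' c' →
      x = x' ∧ c = c') ∧
    (∀ (x' : DyckWord) (c c' : List ℕ), c.length = 2 * x.semilength →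
      c'.length = 2 * x'.semilength → (∀ v ∈ c, v ≤ 1) → (∀ v ∈ c', v ≤ 1) →
      c.Pairwise (· ≥ ·) → c'.Pairwise (· ≥ ·) → flipWord x c = flipWord x' c' →
      x = x' ∧ c = c') := by
  induction x using dyck_induction with
  | zero =>
    have key : ∀ (x' : DyckWord) (c c' : List ℕ), c.length = 2 * (0 : DyckWord).semilength →
      c'.length = 2 * x'.semilength → flipWord 0 c = flipWord x' c' →
      (0 : DyckWord) = x' ∧ c = c' := by
      intro x' c c' hc hc' h
      by_cases hx : x' = 0
      · subst hx; simp at hc hc'; simp [hc, hc']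
      · rw [← DyckWord.nest_insidePart_add_outsidePart hx] at h hc'
        obtain ⟨a, mid, b, rest, rfl, hm, hr⟩ := exists_split _ _ c' hc'
        rw [flipWord_nest_add _ _ _ _ _ _ hm, flipWord_zero] at h
        simp at h
    exact ⟨fun x' c c' hc hc' _ _ _ _ h => key x' c c' hc hc' h,
      fun x' c c' hc hc' _ _ _ _ h => key x' c c' hc hc' h⟩
  | step u y hu hy =>
    have key : ∀ (x' : DyckWord) (c c' : List ℕ), c.length = 2 * (u.nest + y).semilength →
      c'.length = 2 * x'.semilength → flipWord (u.nest + y) c = flipWord x' c' →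
      ∃ u' y' : DyckWord, x' = u'.nest + y' := by
      intro x' c c' hc hc' h
      by_cases hx : x' = 0
      · subst hx
        obtain ⟨a, mid, b, rest, rfl, hm, hr⟩ := exists_split _ _ c hc
        rw [flipWord_nest_add _ _ _ _ _ _ hm, flipWord_zero] at h
        simp at h
      · exact ⟨_, _, (DyckWord.nest_insidePart_add_outsidePart hx).symm⟩
    refine ⟨fun x' c c' hc hc' h1 h1' hp hp' h => ?_, fun x' c c' hc hc' h1 h1' hp hp' h => ?_⟩
    all_goals
      obtain ⟨u', y', rfl⟩ := key x' c c' hc hc' h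
      obtain ⟨a, mid, b, rest, rfl, hm, hr⟩ := exists_split _ _ c hc
      obtain ⟨a', mid', b', rest', rfl, hm', hr'⟩ := exists_split _ _ c' hc'
      rw [flipWord_nest_add _ _ _ _ _ _ hm, flipWord_nest_add _ _ _ _ _ _ hm'] at h
      simp only [List.pairwise_cons, List.pairwise_append, List.mem_append, List.mem_cons] at hp hp'
      obtain ⟨hpa, hpm, ⟨hpb, hpr⟩, hpmb⟩ := hp
      obtain ⟨hpa', hpm', ⟨hpb', hpr'⟩, hpmb'⟩ := hp'
      simp only [List.mem_cons, List.mem_append, or_imp, forall_and,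
        forall_eq] at h1 h1'
      obtain ⟨ha1, hm1, hb1, hr1⟩ := h1
      obtain ⟨ha1', hm1', hb1', hr1'⟩ := h1'
      rw [List.cons.injEq] at h
      obtain ⟨hh, ht⟩ := h
      have hbb : b = b' := by
        rcases Nat.le_one_iff_eq_zero_or_eq_one.1 hb1 with rfl | rfl <;>
        rcases Nat.le_one_iff_eq_zero_or_eq_one.1 hb1' with rfl | rfl <;>
        simp [flipStep, compl] at hh ⊢
      subst hbb
      have hmr : mid.reverse.length = 2 * u.semilength := by simpa using hm
      have hmr' : mid'.reverse.length = 2 * u'.semilength := by simpa using hm'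
      have hmi : u = u' → mid.length = mid'.length := by rintro rfl; rw [hm, hm']
      have hri : y = y' → rest.length = rest'.length := by rintro rfl; rw [hr, hr']
    · rcases Nat.le_one_iff_eq_zero_or_eq_one.1 hb1 with rfl | rfl
      -- Nothing up to the end of the block is flipped, so the block is read off from the left and
      -- only the outer part remains for the induction.
      · obtain rfl : a = 0 := by have := hpa 0 (by simp); omega
        obtain rfl : a' = 0 := by have := hpa' 0 (by simp); omega
        have e1 : ∀ v ∈ mid, v = 0 := fun v hv => by have := hpmb v hv 0 (by simp); omega
        have e2 : ∀ v ∈ mid', v = 0 := fun v hv => by have := hpmb' v hv 0 (by simp); omega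
        rw [flipWord_of_forall_eq u _ 0 hmr (by simpa using e1),
          flipWord_of_forall_eq u' _ 0 hmr' (by simpa using e2), flipStep_zero] at ht
        simp only [List.map_id] at ht
        obtain ⟨rfl, ht2⟩ := dyck_prefix_unique ht
        obtain ⟨rfl, rfl⟩ := hy.1 y' rest rest' hr hr' hr1 hr1' hpr hpr' ht2
        rw [eq_of_forall_eq (hmi rfl) e1 e2]
        exact ⟨rfl, rfl⟩
      -- Everything after the block is complemented. If `a = 0`, the closing `1` is not flipped and
      -- is found from the right; if `a = 1`, the whole word is complemented. The two possibilities
      -- exclude each other by `append_compl_ne`.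
      · have e1 : ∀ v ∈ rest, v = 1 := fun v hv => le_antisymm (hr1 v hv) (hpb v hv)
        have e2 : ∀ v ∈ rest', v = 1 := fun v hv => le_antisymm (hr1' v hv) (hpb' v hv)
        rw [flipWord_of_forall_eq y _ 1 hr e1, flipWord_of_forall_eq y' _ 1 hr' e2,
          flipStep_one] at ht
        have e3 : a = 1 → flipWord u mid.reverse = u.toList.map compl ∧ ∀ v ∈ mid, v = 1 := by
          rintro rfl
          have : ∀ v ∈ mid, v = 1 := fun v hv => le_antisymm (hm1 v hv) (hpa v (Or.inl hv))
          exact ⟨by rw [flipWord_of_forall_eq u _ 1 hmr (by simpa using this), flipStep_one], this⟩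
        have e4 : a' = 1 → flipWord u' mid'.reverse = u'.toList.map compl ∧ ∀ v ∈ mid', v = 1 := by
          rintro rfl
          have : ∀ v ∈ mid', v = 1 := fun v hv => le_antisymm (hm1' v hv) (hpa' v (Or.inl hv))
          exact ⟨by rw [flipWord_of_forall_eq u' _ 1 hmr' (by simpa using this), flipStep_one],
            this⟩
        rcases Nat.le_one_iff_eq_zero_or_eq_one.1 ha1 with rfl | rfl <;>
        rcases Nat.le_one_iff_eq_zero_or_eq_one.1 ha1' with rfl | rfl
        · obtain ⟨rfl, ht2⟩ := append_compl_unique (by simpa [flipStep] using ht)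
          obtain ⟨rfl, hmm⟩ := hu.2 u' mid.reverse mid'.reverse hmr hmr' (by simpa using hm1)
            (by simpa using hm1') (List.pairwise_reverse.2 hpm) (List.pairwise_reverse.2 hpm') ht2
          rw [List.reverse_inj.1 hmm, eq_of_forall_eq (hri rfl) e1 e2]
          exact ⟨rfl, rfl⟩
        · exfalso
          rw [(e4 rfl).1] at ht
          refine append_compl_ne (W := D :: flipWord u mid.reverse) (y := y) (x := u'.nest + y') ?_
          rw [toList_nest_add]
          simpa [flipStep, compl] using ht
        · exfalso
          rw [(e3 rfl).1] at ht
          refine append_compl_ne (W := D :: flipWord u' mid'.reverse) (y := y') (x := u.nest + y) ?_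
          rw [toList_nest_add]
          simpa [flipStep, compl] using ht.symm
        · rw [(e3 rfl).1, (e4 rfl).1] at ht
          obtain ⟨rfl, ht2⟩ := dyck_prefix_unique (x := u) (x' := u') (r := y.toList)
            (r' := y'.toList) (map_compl_inj (by simpa [flipStep, compl] using ht))
          obtain rfl := DyckWord.ext ht2
          rw [eq_of_forall_eq (hmi rfl) (e3 rfl).2 (e4 rfl).2, eq_of_forall_eq (hri rfl) e1 e2]
          exact ⟨rfl, rfl⟩
    · have cm : ∀ {l l' : List DyckStep}, l = l' → l.map compl = l'.map compl := fun h => by rw [h]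
      rcases Nat.le_one_iff_eq_zero_or_eq_one.1 hb1 with rfl | rfl
      · have e1 : ∀ v ∈ rest, v = 0 := fun v hv => by have := hpb v hv; omega
        have e2 : ∀ v ∈ rest', v = 0 := fun v hv => by have := hpb' v hv; omega
        rw [flipWord_of_forall_eq y _ 0 hr e1, flipWord_of_forall_eq y' _ 0 hr' e2,
          flipStep_zero] at ht
        simp only [List.map_id] at ht
        have e3 : a = 0 → flipWord u mid.reverse = u.toList ∧ ∀ v ∈ mid, v = 0 := by
          rintro rfl
          have : ∀ v ∈ mid, v = 0 := fun v hv => by have := hpa v (Or.inl hv); omega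
          exact ⟨by rw [flipWord_of_forall_eq u _ 0 hmr (by simpa using this), flipStep_zero,
            List.map_id], this⟩
        have e4 : a' = 0 → flipWord u' mid'.reverse = u'.toList ∧ ∀ v ∈ mid', v = 0 := by
          rintro rfl
          have : ∀ v ∈ mid', v = 0 := fun v hv => by have := hpa' v (Or.inl hv); omega
          exact ⟨by rw [flipWord_of_forall_eq u' _ 0 hmr' (by simpa using this), flipStep_zero,
            List.map_id], this⟩
        rcases Nat.le_one_iff_eq_zero_or_eq_one.1 ha1 with rfl | rfl <;>
        rcases Nat.le_one_iff_eq_zero_or_eq_one.1 ha1' with rfl | rfl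
        · rw [(e3 rfl).1, (e4 rfl).1] at ht
          obtain ⟨rfl, ht2⟩ := dyck_prefix_unique (by simpa [flipStep] using ht)
          obtain rfl := DyckWord.ext ht2
          rw [eq_of_forall_eq (hmi rfl) (e3 rfl).2 (e4 rfl).2, eq_of_forall_eq (hri rfl) e1 e2]
          exact ⟨rfl, rfl⟩
        · exfalso
          rw [(e3 rfl).1] at ht
          refine append_compl_ne (W := D :: (flipWord u' mid'.reverse).map compl) (y := y')
            (x := u.nest + y) ?_
          rw [toList_nest_add]
          simpa [flipStep, compl] using cm ht.symm
        · exfalso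
          rw [(e4 rfl).1] at ht
          refine append_compl_ne (W := D :: (flipWord u mid.reverse).map compl) (y := y)
            (x := u'.nest + y') ?_
          rw [toList_nest_add]
          simpa [flipStep, compl] using cm ht
        · obtain ⟨rfl, ht2⟩ := append_compl_unique (y := y) (y' := y')
            (W := (flipWord u mid.reverse).map compl) (W' := (flipWord u' mid'.reverse).map compl)
            (by simpa [flipStep, compl] using cm ht)
          obtain ⟨rfl, hmm⟩ := hu.1 u' mid.reverse mid'.reverse hmr hmr' (by simpa using hm1)
            (by simpa using hm1') (List.pairwise_reverse.2 hpm) (List.pairwise_reverse.2 hpm')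
            (map_compl_inj ht2)
          rw [List.reverse_inj.1 hmm, eq_of_forall_eq (hri rfl) e1 e2]
          exact ⟨rfl, rfl⟩
      · obtain rfl : a = 1 := le_antisymm ha1 (hpa 1 (by simp))
        obtain rfl : a' = 1 := le_antisymm ha1' (hpa' 1 (by simp))
        have e1 : ∀ v ∈ mid, v = 1 := fun v hv => le_antisymm (hm1 v hv) (hpmb v hv 1 (by simp))
        have e2 : ∀ v ∈ mid', v = 1 := fun v hv => le_antisymm (hm1' v hv) (hpmb' v hv 1 (by simp))
        rw [flipWord_of_forall_eq u _ 1 hmr (by simpa using e1),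
          flipWord_of_forall_eq u' _ 1 hmr' (by simpa using e2), flipStep_one] at ht
        obtain ⟨rfl, ht2⟩ := dyck_prefix_unique (x := u) (x' := u')
          (r := (flipWord y rest).map compl) (r' := (flipWord y' rest').map compl)
          (by simpa [flipStep, compl_U, compl_D, Function.comp_def, compl_compl] using cm ht)
        obtain ⟨rfl, rfl⟩ := hy.2 y' rest rest' hr hr' hr1 hr1' hpr hpr' (map_compl_inj ht2)
        rw [eq_of_forall_eq (hmi rfl) e1 e2]
        exact ⟨rfl, rfl⟩

/-! ### The lines of the lists and the uniform 2-factor -/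

section Lines

variable {k : ℕ}

theorem length_word (x : Dyck k) : x.1.toList.length = 2 * k := by rw [length_toList, x.2]

theorem permList_perm (x : Dyck k) :
    (permList x).Perm ((List.range (2 * k)).map (· + 1)) :=
  rearrange_perm x.1 _ (by simp [x.2])

theorem length_permList (x : Dyck k) : (permList x).length = 2 * k := by
  simpa using (permList_perm x).length_eq

theorem nodup_permList (x : Dyck k) : (permList x).Nodup :=
  (permList_perm x).nodup_iff.2 (List.nodup_range.map (fun a b h => by simpa using h))

theorem mem_permList (x : Dyck k) (n : ℕ) : n ∈ permList x ↔ 1 ≤ n ∧ n ≤ 2 * k := by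
  rw [(permList_perm x).mem_iff]
  simp only [List.mem_map, List.mem_range]
  exact ⟨fun ⟨a, h, e⟩ => by omega, fun h => ⟨n - 1, by omega, by omega⟩⟩

/-- The entry `p(q+1)` of the permutation `p`. -/
def pval (x : Dyck k) (q : ℕ) : ℕ := (permList x).getD q 0

theorem getElem?_permList (x : Dyck k) {q : ℕ} (h : q < 2 * k) :
    (permList x)[q]? = some (pval x q) := by
  have h' : q < (permList x).length := by rw [length_permList]; exact h
  rw [pval, List.getD_eq_getElem?_getD, List.getElem?_eq_getElem h']; rfl

theorem pval_mem (x : Dyck k) {q : ℕ} (h : q < 2 * k) : 1 ≤ pval x q ∧ pval x q ≤ 2 * k :=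
  (mem_permList x _).1 (List.mem_of_getElem? (getElem?_permList x h))

theorem pval_injOn (x : Dyck k) {q q' : ℕ} (h : q < 2 * k) (h' : q' < 2 * k)
    (e : pval x q = pval x q') : q = q' := by
  have h1 := getElem?_permList x h
  rw [e, ← getElem?_permList x h'] at h1
  exact (List.getElem?_inj (by rw [length_permList]; exact h) (nodup_permList x)).1 h1

theorem perm_bounds (x : Dyck k) {n : ℕ} (h : 1 ≤ n) (h' : n ≤ 2 * k) :
    1 ≤ perm x n ∧ perm x n ≤ 2 * k := by
  have := List.idxOf_lt_length_of_mem ((mem_permList x n).2 ⟨h, h'⟩)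
  rw [length_permList] at this
  rw [perm]; omega

theorem pval_perm (x : Dyck k) {n : ℕ} (h : 1 ≤ n) (h' : n ≤ 2 * k) :
    pval x (perm x n - 1) = n := by
  have := List.idxOf_lt_length_of_mem ((mem_permList x n).2 ⟨h, h'⟩)
  rw [pval, perm, Nat.add_sub_cancel, List.getD_eq_getElem _ _ this, List.getElem_idxOf]

theorem perm_pval (x : Dyck k) {q : ℕ} (h : q < 2 * k) : perm x (pval x q) = q + 1 := by
  have h1 := pval_mem x h
  have h2 := perm_bounds x h1.1 h1.2
  have := pval_injOn x (by omega) h (pval_perm x h1.1 h1.2)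
  omega

theorem step_eq_D_iff (x : Dyck k) {q : ℕ} (h : q < 2 * k) :
    x.1.toList[q]? = some D ↔ pval x q % 2 = 1 := by
  have hq : q < x.1.toList.length := by rw [length_word]; exact h
  have hp := rearrange_parity x.1 1 ((List.range (2 * k)).map (· + 1)) (by simp [x.2])
    (fun i v hv => by
      simp only [List.getElem?_map, Option.map_eq_some_iff] at hv
      obtain ⟨a, ha, rfl⟩ := hv
      rw [List.getElem?_eq_some_iff] at ha
      obtain ⟨_, ha⟩ := ha
      rw [List.getElem_range] at ha
      rw [ha]) q (pval x q) x.1.toList[q] (getElem?_permList x h) (List.getElem?_eq_getElem hq)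
  rw [List.getElem?_eq_getElem hq]
  rcases DyckStep.dichotomy x.1.toList[q] with h' | h' <;> rw [h'] at hp ⊢ <;> simp at hp ⊢ <;> omega

/-- The bits of the word `x` whose steps of rank more than `2k - t` are flipped, preceded
by a `0`. -/
def lineBit (x : Dyck k) (t i : ℕ) : Bool :=
  decide (i ≠ 0) && ((x.1.toList[i - 1]? == some D) ^^ decide (2 * k - t < pval x (i - 1)))

/-- The entry of `p`-value `2k - t` is not yet flipped at time `t`. By `step_eq_D_iff` it is a `1`
iff `2k - t`, equivalently `t`, is odd, so after complementing the odd lines it is always `0`. -/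
theorem lineBit_perm (x : Dyck k) {t : ℕ} (ht : t < 2 * k) :
    lineBit x t (perm x (2 * k - t)) = decide (t % 2 = 1) := by
  obtain ⟨h1, h2⟩ := perm_bounds x (n := 2 * k - t) (by omega) (by omega)
  have h3 := pval_perm x (n := 2 * k - t) (by omega) (by omega)
  have h4 := step_eq_D_iff x (q := perm x (2 * k - t) - 1) (by omega)
  rw [h3] at h4
  have h5 : (x.1.toList[perm x (2 * k - t) - 1]? == some D) = decide (t % 2 = 1) := by
    rw [Bool.eq_iff_iff]; simp only [beq_iff_eq, decide_eq_true_eq, h4]; omega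
  rw [lineBit, h3, h5]
  simp; omega

/-- Complementing all coordinates but one amounts to flipping that one and then complementing
everything. The complementations accumulate to the parity of `t`. -/
theorem mem_line (x : Dyck k) : ∀ t ≤ 2 * k, ∀ i : Fin (2 * k + 1),
    i ∈ line x t ↔ (lineBit x t i.val ^^ decide (t % 2 = 1)) = true := by
  intro t
  induction t with
  | zero =>
    intro _ i
    simp only [line, Finset.mem_filter, Finset.mem_univ, true_and]
    obtain hi | ⟨j, hj⟩ : i.val = 0 ∨ ∃ j, i.val = j + 1 := by
      rcases i.val with _ | j
      · exact Or.inl rfl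
      · exact Or.inr ⟨j, rfl⟩
    · simp [hi, lineBit]
    · have := pval_mem x (q := j) (by omega)
      have e1 : decide (2 * k - 0 < pval x j) = false := by simp; omega
      simp only [hj, lineBit, List.getElem?_cons_succ, Nat.add_sub_cancel, e1]
      simp
  | succ t ih =>
    intro ht i
    simp only [line, Finset.mem_filter, Finset.mem_univ, true_and]
    rw [ih (by omega)]
    have ht' : t < 2 * k := by omega
    obtain ⟨h1, h2⟩ := perm_bounds x (n := 2 * k - t) (by omega) (by omega)
    have h3 := pval_perm x (n := 2 * k - t) (by omega) (by omega)
    have hpar : decide ((t + 1) % 2 = 1) = !decide (t % 2 = 1) := by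
      rw [Bool.eq_iff_iff]; simp; omega
    by_cases hi : i.val = perm x (2 * k - t)
    · have h4 : lineBit x (t + 1) i.val = !lineBit x t i.val := by
        rw [hi, lineBit, lineBit, h3]
        have e1 : decide (2 * k - (t + 1) < 2 * k - t) = true := by simp; omega
        have e2 : decide (2 * k - t < 2 * k - t) = false := by simp
        have e3 : decide (perm x (2 * k - t) ≠ 0) = true := by simp; omega
        rw [e1, e2, e3]; cases (x.1.toList[perm x (2 * k - t) - 1]? == some D) <;> rfl
      rw [h4, hpar, hi, lineBit_perm x ht']
      simp
    · have h4 : lineBit x (t + 1) i.val = lineBit x t i.val := by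
        rw [lineBit, lineBit]
        by_cases h0 : i.val = 0
        · simp [h0]
        · have h5 : pval x (i.val - 1) ≠ 2 * k - t := fun h => by
            have := perm_pval x (q := i.val - 1) (by omega)
            rw [h] at this
            omega
          congr 2
          simp only [decide_eq_decide]
          omega
      rw [h4, hpar]
      cases lineBit x t i.val <;> cases decide (t % 2 = 1) <;> simp [hi]

theorem card_filter_getElem? (l : List DyckStep) (a : DyckStep) : ∀ n, l.length = n →
    (Finset.univ.filter fun i : Fin n => l[i.val]? = some a).card = l.count a := by
  induction l with
  | nil => rintro n rfl; simp
  | cons b l ih =>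
    rintro n rfl
    have := ih l.length rfl
    rw [Finset.card_filter] at this ⊢
    rw [List.length_cons, Fin.sum_univ_succ]
    simp only [Fin.val_zero, List.getElem?_cons_zero, Fin.val_succ, List.getElem?_cons_succ, this,
      List.count_cons, Option.some.injEq, beq_iff_eq]
    rw [add_comm]

theorem perm_lt (x : Dyck k) {t : ℕ} (ht : t < 2 * k) : perm x (2 * k - t) < 2 * k + 1 := by
  have := perm_bounds x (n := 2 * k - t) (by omega) (by omega)
  omega

theorem perm_notMem_line (x : Dyck k) {t : ℕ} (ht : t < 2 * k) :
    (⟨perm x (2 * k - t), perm_lt x ht⟩ : Fin (2 * k + 1)) ∉ line x t := by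
  rw [mem_line x t ht.le, lineBit_perm x ht]; simp

theorem card_line (x : Dyck k) : ∀ t ≤ 2 * k, (line x t).card = k := by
  intro t
  induction t with
  | zero =>
    intro _
    rw [line, card_filter_getElem? _ _ _ (by simp [length_word])]
    have h1 := x.2
    have h2 := x.1.count_U_eq_count_D
    rw [DyckWord.semilength] at h1
    simp; omega
  | succ t ih =>
    intro ht
    have ht' : t < 2 * k := by omega
    have : line x (t + 1) = (insert ⟨perm x (2 * k - t), perm_lt x ht'⟩ (line x t))ᶜ := by
      ext i
      simp only [line, Finset.mem_filter, Finset.mem_univ, true_and, Finset.mem_compl,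
        Finset.mem_insert, not_or, Fin.ext_iff]
      tauto
    rw [this, Finset.card_compl, Finset.card_insert_of_notMem (perm_notMem_line x ht'),
      ih (by omega), Fintype.card_fin]
    omega

/-- The lines of the list of `x` as vertices of the odd graph. -/
def vtx (x : Dyck k) (t : Fin (2 * k + 1)) : OddVertex k :=
  ⟨line x t, card_line x t (Nat.lt_succ_iff.1 t.2)⟩

/-- The coordinate at which the lines `t` and `t + 1` both have the bit `0`. -/
def star (x : Dyck k) (t : Fin (2 * k + 1)) : Fin (2 * k + 1) :=
  if h : t.val < 2 * k then ⟨perm x (2 * k - t), perm_lt x h⟩ else 0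

theorem val_add_one_of_lt' (t : Fin (2 * k + 1)) (h : t.val < 2 * k) :
    (t + 1).val = t.val + 1 := by
  rw [Fin.val_add_one_of_lt]; rw [Fin.lt_def, Fin.val_last]; exact h

theorem add_one_of_not_lt (t : Fin (2 * k + 1)) (h : ¬ t.val < 2 * k) : t + 1 = 0 := by
  have : t = Fin.last (2 * k) := by ext; rw [Fin.val_last]; omega
  rw [this, Fin.last_add_one]

/-- The case `t = 2k` says that the list closes: then every entry of `x` is flipped and `2k` is
even, so the last line is `0` followed by the complement of `x`, and its common zero with line `0`
is coordinate `0`. -/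
theorem mem_line_succ (x : Dyck k) (t i : Fin (2 * k + 1)) :
    i ∈ (vtx x (t + 1)).1 ↔ i ∉ (vtx x t).1 ∧ i ≠ star x t := by
  by_cases h : t.val < 2 * k
  · simp only [vtx, star, dif_pos h, val_add_one_of_lt' t h, line, Finset.mem_filter,
      Finset.mem_univ, true_and, Ne, Fin.ext_iff]
  · have ht : t.val = 2 * k := by omega
    simp only [vtx, star, add_one_of_not_lt t h, ht]
    rw [mem_line x _ le_rfl, mem_line x _ (by simp)]
    by_cases hi : i = 0
    · subst hi; simp [lineBit]
    · have hi' : i.val ≠ 0 := fun h => hi (Fin.ext h)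
      have := pval_mem x (q := i.val - 1) (by omega)
      have e1 : decide (0 < pval x (i.val - 1)) = true := by simp; omega
      have e2 : decide (2 * k < pval x (i.val - 1)) = false := by simp; omega
      simp [lineBit, hi, hi', e1, e2]

theorem star_notMem (x : Dyck k) (t : Fin (2 * k + 1)) : star x t ∉ (vtx x t).1 := by
  by_cases h : t.val < 2 * k
  · rw [star, dif_pos h]; exact perm_notMem_line x h
  · have ht : t.val = 2 * k := by omega
    rw [star, dif_neg h, vtx, mem_line x _ (by omega), ht]
    simp [lineBit]

theorem star_notMem_succ (x : Dyck k) (t : Fin (2 * k + 1)) : star x t ∉ (vtx x (t + 1)).1 := by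
  rw [mem_line_succ]; simp

theorem star_injective (x : Dyck k) : Function.Injective (star x) := by
  intro t t' h
  by_cases h1 : t.val < 2 * k <;> by_cases h2 : t'.val < 2 * k
  · rw [star, star, dif_pos h1, dif_pos h2, Fin.mk.injEq] at h
    have e1 := pval_perm x (n := 2 * k - t) (by omega) (by omega)
    have e2 := pval_perm x (n := 2 * k - t') (by omega) (by omega)
    rw [h, e2] at e1
    ext; omega
  · rw [star, star, dif_pos h1, dif_neg h2] at h
    have := perm_bounds x (n := 2 * k - t) (by omega) (by omega)
    rw [Fin.ext_iff] at h; simp at h; omega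
  · rw [star, star, dif_neg h1, dif_pos h2] at h
    have := perm_bounds x (n := 2 * k - t') (by omega) (by omega)
    rw [Fin.ext_iff] at h; simp at h; omega
  · ext; omega

theorem contiguous_iff (x : Dyck k) (a b : OddVertex k) :
    Contiguous x a b ↔ ∃ t, a = vtx x t ∧ b = vtx x (t + 1) := by
  have key : ∀ t : Fin (2 * k + 1), (t + 1).val = (t.val + 1) % (2 * k + 1) := fun t => by
    by_cases h : t.val < 2 * k
    · rw [val_add_one_of_lt' t h, Nat.mod_eq_of_lt (by omega)]
    · rw [add_one_of_not_lt t h, show t.val = 2 * k by omega]; simp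
  constructor
  · rintro ⟨t, ht, ha, hb⟩
    exact ⟨⟨t, ht⟩, Subtype.ext ha, Subtype.ext (by rw [hb]; simp only [vtx, key])⟩
  · rintro ⟨t, rfl, rfl⟩
    exact ⟨t.val, t.2, rfl, by simp only [vtx, key]⟩

/-- The flags of the walk on a Dyck word of length `2k` after `t` steps. -/
def walkFlags (k t : ℕ) : List ℕ := (List.range (2 * k)).map fun v => if 2 * k - t < v + 1 then 1 else 0

theorem getElem?_flipWord (x : Dyck k) (t : ℕ) {q : ℕ} (h : q < 2 * k) :
    (flipWord x.1 (walkFlags k t))[q]? = some (if lineBit x t (q + 1) then D else U) := by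
  have e : walkFlags k t = ((List.range (2 * k)).map (· + 1)).map
      (fun v => if 2 * k - t < v then 1 else 0) := by
    simp [walkFlags, Function.comp_def]
  have hq : q < x.1.toList.length := by rw [length_word]; exact h
  rw [flipWord, e, rearrange_map _ _ _ (by simp [x.2]), List.getElem?_zipWith, List.getElem?_map,
    show rearrange x.1 ((List.range (2 * k)).map (· + 1)) = permList x from rfl,
    getElem?_permList x h, List.getElem?_eq_getElem hq]
  simp only [Option.map_some, lineBit, Nat.add_sub_cancel, List.getElem?_eq_getElem hq, flipStep]
  rcases DyckStep.dichotomy x.1.toList[q] with h' | h' <;> rw [h'] <;>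
    by_cases h'' : 2 * k - t < pval x q <;> simp [h'', compl]

theorem vtx_injective : Function.Injective fun p : Dyck k × Fin (2 * k + 1) => vtx p.1 p.2 := by
  rintro ⟨x, t⟩ ⟨x', t'⟩ h
  have hm : ∀ i : Fin (2 * k + 1), (lineBit x t i.val ^^ decide (t.val % 2 = 1)) =
      (lineBit x' t' i.val ^^ decide (t'.val % 2 = 1)) := fun i => by
    rw [Bool.eq_iff_iff, ← mem_line x _ (by omega), ← mem_line x' _ (by omega)]
    simp only [vtx, Subtype.mk.injEq] at h
    rw [h]
  -- Coordinate `0` is never flipped, so its bit reveals the parity of the line. After undoing the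
  -- complementation, `flipWord_inj` applies.
  have hpar : decide (t.val % 2 = 1) = decide (t'.val % 2 = 1) := by simpa [lineBit] using hm 0
  have hb : ∀ q < 2 * k, lineBit x t (q + 1) = lineBit x' t' (q + 1) := fun q hq => by
    have := hm ⟨q + 1, by omega⟩
    rw [hpar] at this
    simpa using this
  have hl : ∀ (x : Dyck k) t, (flipWord x.1 (walkFlags k t)).length = 2 * k := fun x t => by
    rw [flipWord, List.length_zipWith, length_rearrange _ _ (by simp [walkFlags, x.2]), length_word,
      x.2, min_self]
  have hw : flipWord x.1 (walkFlags k t) = flipWord x'.1 (walkFlags k t') := by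
    refine List.ext_getElem? fun q => ?_
    by_cases hq : q < 2 * k
    · rw [getElem?_flipWord x t hq, getElem?_flipWord x' t' hq, hb q hq]
    · rw [List.getElem?_eq_none (by rw [hl]; omega), List.getElem?_eq_none (by rw [hl]; omega)]
  have hle : ∀ t, ∀ v ∈ walkFlags k t, v ≤ 1 := fun t v hv => by
    simp only [walkFlags, List.mem_map] at hv
    obtain ⟨a, _, rfl⟩ := hv
    split_ifs <;> omega
  have hs : ∀ t, (walkFlags k t).Pairwise (· ≤ ·) := fun t => by
    rw [walkFlags, List.pairwise_map]
    refine List.pairwise_lt_range.imp fun {a b} hab => ?_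
    split_ifs <;> omega
  obtain ⟨h1, h2⟩ := (flipWord_inj x.1).1 x'.1 _ _ (by simp [walkFlags, x.2])
    (by simp [walkFlags, x'.2]) (hle _) (hle _) (hs _) (hs _) hw
  have h3 : t = t' := by
    have h4 : ∀ q < 2 * k, (2 * k - t.val < q + 1 ↔ 2 * k - t'.val < q + 1) := fun q hq => by
      have := congrArg (fun l => l[q]?) h2
      simp only [walkFlags, List.getElem?_map, List.getElem?_range hq, Option.map_some,
        Option.some.injEq] at this
      split_ifs at this with a b b <;> tauto
    have h5 := t.2
    have h6 := t'.2
    ext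
    rcases lt_trichotomy t.val t'.val with hlt | heq | hlt
    · have := h4 (2 * k - t'.val) (by omega); omega
    · exact heq
    · have := h4 (2 * k - t.val) (by omega); omega
  exact Prod.ext (Subtype.ext h1) h3

/-- Injectivity suffices by counting: with `(k + 1)` times the Catalan number equal to the central
binomial coefficient, both sides have `(2k+1).choose k` elements. -/
theorem vtx_bijective : Function.Bijective fun p : Dyck k × Fin (2 * k + 1) => vtx p.1 p.2 := by
  rw [Fintype.bijective_iff_injective_and_card]
  refine ⟨vtx_injective, ?_⟩
  rw [Fintype.card_prod, DyckWord.card_dyckWord_semilength_eq_catalan, Fintype.card_fin]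
  have h1 : Fintype.card (OddVertex k) = (2 * k + 1).choose k := by
    rw [Fintype.card_finset_len, Fintype.card_fin]
  rw [h1]
  have h2 := succ_mul_catalan_eq_centralBinom k
  have h3 := Nat.add_one_mul_choose_eq (2 * k) k
  rw [Nat.centralBinom] at h2
  rw [← Nat.choose_symm_half]
  have : (k + 1) * (catalan k * (2 * k + 1)) = (k + 1) * ((2 * k + 1).choose (k + 1)) := by
    rw [← mul_assoc, h2, mul_comm _ (2 * k + 1), h3, mul_comm]
  exact Nat.eq_of_mul_eq_mul_left (by omega) this

end Lines

/-! ### Classes, flippable edges and flipping cycles -/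

section Classes

variable {k : ℕ}

/-- The Dyck word in whose list the vertex `v` occurs. -/
noncomputable def cls (v : OddVertex k) : Dyck k := ((Equiv.ofBijective _ vtx_bijective).symm v).1

/-- The line at which the vertex `v` occurs. -/
noncomputable def tm (v : OddVertex k) : Fin (2 * k + 1) :=
  ((Equiv.ofBijective _ vtx_bijective).symm v).2

theorem vtx_cls_tm (v : OddVertex k) : vtx (cls v) (tm v) = v :=
  (Equiv.ofBijective _ vtx_bijective).apply_symm_apply v

theorem vtx_inj {x x' : Dyck k} {t t' : Fin (2 * k + 1)} (h : vtx x t = vtx x' t') :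
    x = x' ∧ t = t' := by
  have := vtx_injective (a₁ := (x, t)) (a₂ := (x', t')) h
  simpa using this

theorem cls_vtx (x : Dyck k) (t : Fin (2 * k + 1)) : cls (vtx x t) = x :=
  (vtx_inj (vtx_cls_tm (vtx x t))).1

theorem disjoint_vtx_succ (x : Dyck k) (t : Fin (2 * k + 1)) :
    Disjoint (vtx x t).1 (vtx x (t + 1)).1 := by
  rw [Finset.disjoint_left]
  intro i hi h
  exact ((mem_line_succ x t i).1 h).1 hi

theorem add_one_ne_self (hk : 1 ≤ k) (t : Fin (2 * k + 1)) : t + 1 ≠ t := by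
  intro h
  by_cases h' : t.val < 2 * k
  · have := val_add_one_of_lt' t h'; rw [h] at this; omega
  · rw [add_one_of_not_lt t h'] at h; rw [← h] at h'; simp at h'; omega

theorem add_one_add_one_ne_self (hk : 1 ≤ k) (t : Fin (2 * k + 1)) : t + 1 + 1 ≠ t := by
  intro h
  by_cases h' : t.val < 2 * k
  · have h1 := val_add_one_of_lt' t h'
    by_cases h'' : (t + 1).val < 2 * k
    · have := val_add_one_of_lt' _ h''; rw [h] at this; omega
    · rw [add_one_of_not_lt _ h''] at h
      have h2 : t.val = 0 := by rw [← h]; rfl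
      omega
  · rw [add_one_of_not_lt t h'] at h
    have := val_add_one_of_lt' (0 : Fin (2 * k + 1)) (by simp; omega)
    rw [h] at this; simp at this; omega

theorem adj_vtx_succ (hk : 1 ≤ k) (x : Dyck k) (t : Fin (2 * k + 1)) :
    (oddGraph k).Adj (vtx x t) (vtx x (t + 1)) :=
  ⟨fun h => add_one_ne_self hk t (vtx_inj h).2.symm, disjoint_vtx_succ x t⟩

/-- The edge between the lines `t` and `t + 1`. -/
def lineEdge (x : Dyck k) (t : Fin (2 * k + 1)) : Sym2 (OddVertex k) := s(vtx x t, vtx x (t + 1))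

theorem mem_twoFactor (e : Sym2 (OddVertex k)) : e ∈ twoFactor k ↔ ∃ x t, e = lineEdge x t := by
  constructor
  · rintro ⟨x, a, b, rfl, h⟩
    obtain ⟨t, rfl, rfl⟩ := (contiguous_iff x a b).1 h
    exact ⟨x, t, rfl⟩
  · rintro ⟨x, t, rfl⟩
    exact ⟨x, _, _, rfl, (contiguous_iff x _ _).2 ⟨t, rfl, rfl⟩⟩

/-- Two disjoint `k`-sets leave out just one of the `2k + 1` coordinates. Hence the common zero
labels an edge, and a list has at most one flippable edge at each position. -/
theorem common_zero_unique {a b : OddVertex k} (h : Disjoint a.1 b.1) {i j : Fin (2 * k + 1)}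
    (hia : i ∉ a.1) (hib : i ∉ b.1) (hja : j ∉ a.1) (hjb : j ∉ b.1) : i = j := by
  by_contra hij
  have h1 : (a.1 ∪ b.1).card = 2 * k := by rw [Finset.card_union_of_disjoint h, a.2, b.2]; ring
  have h2 : Disjoint (a.1 ∪ b.1) {i, j} := by
    rw [Finset.disjoint_right]
    intro m hm
    simp only [Finset.mem_insert, Finset.mem_singleton] at hm
    rcases hm with rfl | rfl <;> simp [*]
  have h3 := Finset.card_le_univ ((a.1 ∪ b.1) ∪ {i, j})
  rw [Finset.card_union_of_disjoint h2, h1, Finset.card_pair hij, Fintype.card_fin] at h3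
  omega

theorem isFlippableEdge_iff (x : Dyck k) (j : ℕ) (e : Sym2 (OddVertex k)) :
    IsFlippableEdge x j e ↔ ∃ t, e = lineEdge x t ∧ (star x t).val + j = 2 * k := by
  constructor
  · rintro ⟨a, b, rfl, h, i, hi, hia, hib⟩
    obtain ⟨t, rfl, rfl⟩ := (contiguous_iff x a b).1 h
    refine ⟨t, rfl, ?_⟩
    have h2 : i = star x t := common_zero_unique (disjoint_vtx_succ x t) hia hib (star_notMem x t)
      (star_notMem_succ x t)
    omega
  · rintro ⟨t, rfl, h⟩
    exact ⟨_, _, rfl, (contiguous_iff x _ _).2 ⟨t, rfl, rfl⟩, star x t, h, star_notMem x t,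
      star_notMem_succ x t⟩

theorem isFlippableEdge_unique {x : Dyck k} {j : ℕ} {e e' : Sym2 (OddVertex k)}
    (h : IsFlippableEdge x j e) (h' : IsFlippableEdge x j e') : e = e' := by
  obtain ⟨t, rfl, ht⟩ := (isFlippableEdge_iff x j e).1 h
  obtain ⟨t', rfl, ht'⟩ := (isFlippableEdge_iff x j e').1 h'
  have h2 : star x t = star x t' := Fin.ext (by omega)
  rw [star_injective x h2]

theorem cls_of_mem_lineEdge {x : Dyck k} {t : Fin (2 * k + 1)} {v : OddVertex k}
    (h : v ∈ lineEdge x t) : cls v = x := by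
  rw [lineEdge, Sym2.mem_iff] at h
  rcases h with rfl | rfl <;> exact cls_vtx _ _

theorem cls_of_mem_flippable {x : Dyck k} {j : ℕ} {e : Sym2 (OddVertex k)}
    (h : IsFlippableEdge x j e) {v : OddVertex k} (hv : v ∈ e) : cls v = x := by
  obtain ⟨t, rfl, _⟩ := (isFlippableEdge_iff x j e).1 h
  exact cls_of_mem_lineEdge hv

theorem lineEdge_inj (hk : 1 ≤ k) {x x' : Dyck k} {t t' : Fin (2 * k + 1)}
    (h : lineEdge x t = lineEdge x' t') : x = x' ∧ t = t' := by
  rw [lineEdge, lineEdge, Sym2.eq_iff] at h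
  rcases h with ⟨h1, _⟩ | ⟨h1, h2⟩
  · exact vtx_inj h1
  · obtain ⟨rfl, rfl⟩ := vtx_inj h1
    exact absurd (vtx_inj h2).2 (add_one_add_one_ne_self hk t')

theorem flippable_eq_iff (hk : 1 ≤ k) {x x' : Dyck k} {j j' : ℕ} {e : Sym2 (OddVertex k)}
    (h : IsFlippableEdge x j e) (h' : IsFlippableEdge x' j' e) : x = x' ∧ j = j' := by
  obtain ⟨t, rfl, ht⟩ := (isFlippableEdge_iff x j _).1 h
  obtain ⟨t', h2, ht'⟩ := (isFlippableEdge_iff x' j' _).1 h'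
  obtain ⟨rfl, rfl⟩ := lineEdge_inj hk h2
  exact ⟨rfl, by omega⟩

theorem flippable_mem_twoFactor {x : Dyck k} {j : ℕ} {e : Sym2 (OddVertex k)}
    (h : IsFlippableEdge x j e) : e ∈ twoFactor k := by
  obtain ⟨t, rfl, _⟩ := (isFlippableEdge_iff x j e).1 h
  exact (mem_twoFactor _).2 ⟨_, _, rfl⟩

theorem twoFactor_adj (hk : 1 ≤ k) {a b : OddVertex k} (h : s(a, b) ∈ twoFactor k) :
    (oddGraph k).Adj a b := by
  obtain ⟨x, t, h⟩ := (mem_twoFactor _).1 h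
  rw [lineEdge, Sym2.eq_iff] at h
  rcases h with ⟨rfl, rfl⟩ | ⟨rfl, rfl⟩
  · exact adj_vtx_succ hk x t
  · exact (adj_vtx_succ hk x t).symm

theorem twoFactor_cls {a b : OddVertex k} (h : s(a, b) ∈ twoFactor k) : cls a = cls b := by
  obtain ⟨x, t, h⟩ := (mem_twoFactor _).1 h
  rw [cls_of_mem_lineEdge (h ▸ Sym2.mem_mk_left a b), cls_of_mem_lineEdge (h ▸ Sym2.mem_mk_right a b)]

theorem twoFactor_neighbors (x : Dyck k) (t : Fin (2 * k + 1)) :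
    {w | s(vtx x t, w) ∈ twoFactor k} = {vtx x (t + 1), vtx x (t - 1)} := by
  ext w
  simp only [Set.mem_ofPred_eq, mem_twoFactor, lineEdge, Sym2.eq_iff, Set.mem_insert_iff,
    Set.mem_singleton_iff]
  constructor
  · rintro ⟨x', t', ⟨h, rfl⟩ | ⟨h, rfl⟩⟩
    · obtain ⟨rfl, rfl⟩ := vtx_inj h; exact Or.inl rfl
    · obtain ⟨rfl, rfl⟩ := vtx_inj h; right; rw [add_sub_cancel_right]
  · rintro (rfl | rfl)
    · exact ⟨x, t, Or.inl ⟨rfl, rfl⟩⟩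
    · exact ⟨x, t - 1, Or.inr ⟨by rw [sub_add_cancel], rfl⟩⟩

theorem twoFactor_ncard (hk : 1 ≤ k) (v : OddVertex k) :
    {w | s(v, w) ∈ twoFactor k}.ncard = 2 := by
  rw [← vtx_cls_tm v, twoFactor_neighbors, Set.ncard_pair]
  intro h
  have := (vtx_inj h).2
  refine add_one_add_one_ne_self hk (tm v - 1) ?_
  rw [sub_add_cancel, this]

theorem twoFactor_reachable {G : SimpleGraph (OddVertex k)}
    (hG : ∀ a b, s(a, b) ∈ twoFactor k → G.Reachable a b) {a b : OddVertex k}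
    (h : cls a = cls b) : G.Reachable a b := by
  have key : ∀ x (n : ℕ), G.Reachable (vtx x 0) (vtx x (Fin.ofNat (2 * k + 1) n)) := by
    intro x n
    induction n with
    | zero => exact SimpleGraph.Reachable.refl _
    | succ n ih =>
      refine ih.trans (hG _ _ ((mem_twoFactor _).2 ⟨x, Fin.ofNat (2 * k + 1) n, ?_⟩))
      have h2 : Fin.ofNat (2 * k + 1) (n + 1) = Fin.ofNat (2 * k + 1) n + 1 := by
        ext; simp [Fin.val_add]
      rw [lineEdge, h2]
  have key' : ∀ v : OddVertex k, G.Reachable (vtx (cls v) 0) v := fun v => by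
    have := key (cls v) (tm v).val
    rwa [Fin.ofNat_val_eq_self, vtx_cls_tm] at this
  exact (key' a).symm.trans (h ▸ key' b)

/-- The structure of a flipping cycle with edge set `E`. -/
structure FlipData (g : MarkedTuple k) (E : Set (Sym2 (OddVertex k)))
    (f : Dyck k × ℕ → Sym2 (OddVertex k)) : Prop where
  flip : ∀ p ∈ g, IsFlippableEdge p.1 p.2 (f p)
  mem : ∀ p ∈ g, f p ∈ E
  adj : ∀ a b, s(a, b) ∈ E → (oddGraph k).Adj a b
  inj_fst : ∀ p ∈ g, ∀ q ∈ g, p.1 = q.1 → p = q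
  cover : ∀ e ∈ E, ∀ v ∈ e, ∃ p ∈ g, v ∈ f p
  deg : ∀ e ∈ E, ∀ v ∈ e, {w | s(v, w) ∈ E}.ncard = 2
  conn : ∀ e ∈ E, ∀ v ∈ e, ∀ e' ∈ E, ∀ w ∈ e', (SimpleGraph.fromEdgeSet E).Reachable v w
  nonempty : g.Nonempty

/-- The field `cover` is a count: the `κ` disjoint flippable edges have `2κ` ends, as many as the
cycle has vertices, so every vertex of the cycle is one of these ends. -/
theorem exists_flipData {g : MarkedTuple k} {E : Set (Sym2 (OddVertex k))}
    (h : IsFlippingCycle g E) : ∃ f, FlipData g E f := by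
  classical
  obtain ⟨hg, hpw, a, c, hc, hlen, rfl, f, hf, hd⟩ := h
  refine ⟨f, fun p hp => (hf p hp).1, fun p hp => (hf p hp).2,
    fun a b h => c.adj_of_mem_edges h, fun p hp q hq h => by_contra fun h' => (hpw hp hq h').1 h,
    ?_, ?_, ?_, Finset.card_pos.1 (by omega)⟩
  · have hdiag : ∀ p ∈ g, ¬ (f p).IsDiag := fun p hp =>
      SimpleGraph.not_isDiag_of_mem_edgeSet _ (c.edges_subset_edgeSet (hf p hp).2)
    have hsub : g.biUnion (fun p => (f p).toFinset) ⊆ c.support.tail.toFinset := by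
      intro v hv
      simp only [Finset.mem_biUnion, Sym2.mem_toFinset] at hv
      obtain ⟨p, hp, hv⟩ := hv
      rw [List.mem_toFinset]
      have := SimpleGraph.Walk.mem_support_of_mem_edges (SimpleGraph.Walk.mem_edgeSet.1 (hf p hp).2) hv
      rcases (SimpleGraph.Walk.mem_support_iff c).1 this with rfl | h
      · exact SimpleGraph.Walk.end_mem_tail_support hc.not_nil
      · exact h
    have hcard : (g.biUnion (fun p => (f p).toFinset)).card = 2 * g.card := by
      rw [Finset.card_biUnion]
      · rw [Finset.sum_congr rfl (fun p hp => Sym2.card_toFinset_of_not_isDiag _ (hdiag p hp)),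
          Finset.sum_const, smul_eq_mul, mul_comm]
      · intro p hp q hq hpq
        rw [Function.onFun, Finset.disjoint_left]
        intro v hv hv'
        exact hd hp hq hpq v (Sym2.mem_toFinset.1 hv) (Sym2.mem_toFinset.1 hv')
    have heq := Finset.eq_of_subset_of_card_le hsub (by
      rw [hcard, ← hlen]
      refine (List.toFinset_card_le _).trans ?_
      simp)
    intro e he v hv
    have hv' : v ∈ c.support.tail.toFinset := by
      rw [List.mem_toFinset]
      have := SimpleGraph.Walk.mem_support_of_mem_edges (SimpleGraph.Walk.mem_edgeSet.1 he) hv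
      rcases (SimpleGraph.Walk.mem_support_iff c).1 this with rfl | h
      · exact SimpleGraph.Walk.end_mem_tail_support hc.not_nil
      · exact h
    rw [← heq] at hv'
    simpa using hv'
  · intro e he v hv
    rw [← hc.ncard_neighborSet_toSubgraph_eq_two
      (SimpleGraph.Walk.mem_support_of_mem_edges (SimpleGraph.Walk.mem_edgeSet.1 he) hv)]
    congr 1
    ext w
    rw [SimpleGraph.Subgraph.mem_neighborSet, SimpleGraph.Walk.adj_toSubgraph_iff_mem_edges]
    rfl
  · have key : ∀ v ∈ c.support, (SimpleGraph.fromEdgeSet c.edgeSet).Reachable a v := by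
      intro v hv
      refine ⟨(c.takeUntil v hv).transfer _ fun e he => ?_⟩
      rw [SimpleGraph.edgeSet_fromEdgeSet]
      have := c.edges_takeUntil_subset_edges hv he
      exact ⟨this, SimpleGraph.not_isDiag_of_mem_edgeSet _ (c.edges_subset_edgeSet this)⟩
    intro e he v hv e' he' w hw
    exact (key v (SimpleGraph.Walk.mem_support_of_mem_edges (SimpleGraph.Walk.mem_edgeSet.1 he) hv)).symm.trans
      (key w (SimpleGraph.Walk.mem_support_of_mem_edges (SimpleGraph.Walk.mem_edgeSet.1 he') hw))

theorem FlipData.eq_of_mem {g : MarkedTuple k} {E : Set (Sym2 (OddVertex k))}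
    {f : Dyck k × ℕ → Sym2 (OddVertex k)} (h : FlipData g E f) {p q : Dyck k × ℕ} (hp : p ∈ g)
    (hq : q ∈ g) {v : OddVertex k} (hv : v ∈ f p) (hv' : v ∈ f q) : p = q :=
  h.inj_fst p hp q hq ((cls_of_mem_flippable (h.flip p hp) hv).symm.trans
    (cls_of_mem_flippable (h.flip q hq) hv'))

/-- An edge of the 2-factor stays in one list. Its ends lie on flippable edges of `g`, of which each
list has only one, so the edge is that flippable edge. -/
theorem FlipData.mem_twoFactor_iff {g : MarkedTuple k} {E : Set (Sym2 (OddVertex k))}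
    {f : Dyck k × ℕ → Sym2 (OddVertex k)} (h : FlipData g E f) {e : Sym2 (OddVertex k)}
    (he : e ∈ E) : e ∈ twoFactor k ↔ ∃ p ∈ g, e = f p := by
  constructor
  · intro hF
    induction e using Sym2.ind with
    | _ a b =>
    obtain ⟨p, hp, hpa⟩ := h.cover _ he a (Sym2.mem_mk_left a b)
    obtain ⟨q, hq, hqb⟩ := h.cover _ he b (Sym2.mem_mk_right a b)
    have h1 := cls_of_mem_flippable (h.flip p hp) hpa
    have h2 := cls_of_mem_flippable (h.flip q hq) hqb
    obtain rfl := h.inj_fst p hp q hq (h1.symm.trans ((twoFactor_cls hF).trans h2))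
    exact ⟨p, hp, ((Sym2.mem_and_mem_iff (h.adj _ _ he).ne).1 ⟨hpa, hqb⟩).symm⟩
  · rintro ⟨p, hp, rfl⟩
    exact flippable_mem_twoFactor (h.flip p hp)

/-- At each of its vertices a flipping cycle has one flippable edge, and one further edge, which
leads to another list. -/
theorem FlipData.local_structure {g : MarkedTuple k} {E : Set (Sym2 (OddVertex k))}
    {f : Dyck k × ℕ → Sym2 (OddVertex k)} (h : FlipData g E f) {e : Sym2 (OddVertex k)}
    (he : e ∈ E) {v : OddVertex k} (hv : v ∈ e) :
    ∃ p ∈ g, ∃ q ∈ g, p ≠ q ∧ ∃ a b, f p = s(v, a) ∧ b ∈ f q ∧ a ≠ b ∧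
      {w | s(v, w) ∈ E} = {a, b} ∧ s(v, b) ∉ twoFactor k := by
  obtain ⟨p, hp, hpv⟩ := h.cover e he v hv
  obtain ⟨a, ha⟩ := hpv
  have hmem : a ∈ {w | s(v, w) ∈ E} := by
    rw [Set.mem_ofPred_eq, ← ha]; exact h.mem p hp
  obtain ⟨b, hb, hab⟩ := Set.exists_ne_of_one_lt_ncard
    (show 1 < {w | s(v, w) ∈ E}.ncard by rw [h.deg e he v hv]; omega) a
  have hset : {w | s(v, w) ∈ E} = {a, b} := by
    obtain ⟨y, z, hyz, hs⟩ := Set.ncard_eq_two.1 (h.deg e he v hv)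
    rw [hs] at hmem hb ⊢
    simp only [Set.mem_insert_iff, Set.mem_singleton_iff] at hmem hb
    ext w
    simp only [Set.mem_insert_iff, Set.mem_singleton_iff]
    grind
  have hnF : s(v, b) ∉ twoFactor k := by
    intro hF
    obtain ⟨q, hq, hq'⟩ := (h.mem_twoFactor_iff hb).1 hF
    obtain rfl := h.eq_of_mem hp hq (v := v) (by rw [ha]; exact Sym2.mem_mk_left _ _)
      (by rw [← hq']; exact Sym2.mem_mk_left _ _)
    rw [ha] at hq'
    rw [Sym2.congr_right] at hq'
    exact hab hq'
  obtain ⟨q, hq, hqb⟩ := h.cover _ hb b (Sym2.mem_mk_right v b)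
  refine ⟨p, hp, q, hq, ?_, a, b, ha, hqb, hab.symm, hset, hnF⟩
  rintro rfl
  rw [ha, Sym2.mem_iff] at hqb
  rcases hqb with rfl | rfl
  · exact (h.adj _ _ hb).ne rfl
  · exact hab rfl

end Classes

/-! ### Spanning trees and gluing -/

section Gluing

variable {k : ℕ}

theorem cliqueGraph_mono {S T : Finset (MarkedTuple k)} (h : S ⊆ T) :
    cliqueGraph S ≤ cliqueGraph T :=
  fun _ _ hxy => ⟨hxy.1, hxy.2.imp fun _ hg => ⟨h hg.1, hg.2⟩⟩

theorem cliqueGraph_reachable {T : Finset (MarkedTuple k)} {g : MarkedTuple k} (hg : g ∈ T)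
    {x y : Dyck k} (hx : x ∈ verts g) (hy : y ∈ verts g) : (cliqueGraph T).Reachable x y := by
  by_cases h : x = y
  · rw [h]
  · exact SimpleGraph.Adj.reachable (show (cliqueGraph T).Adj x y from ⟨h, g, hg, hx, hy⟩)

/-- Distinct vertices of a member of `T` are not joined by the other members. -/
def IsForest (T : Finset (MarkedTuple k)) : Prop :=
  ∀ g ∈ T, ∀ x ∈ verts g, ∀ y ∈ verts g, x ≠ y → ¬ (cliqueGraph (T.erase g)).Reachable x y

theorem IsForest.card_inter_le {T : Finset (MarkedTuple k)} (h : IsForest T) {g g' : MarkedTuple k}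
    (hg : g ∈ T) (hg' : g' ∈ T) (hne : g ≠ g') : (verts g ∩ verts g').card ≤ 1 := by
  by_contra hc
  obtain ⟨x, hx, y, hy, hxy⟩ := Finset.one_lt_card.1 (not_le.1 hc)
  rw [Finset.mem_inter] at hx hy
  exact h g hg x hx.1 y hy.1 hxy
    (cliqueGraph_reachable (Finset.mem_erase.2 ⟨hne.symm, hg'⟩) hx.2 hy.2)

theorem eq_of_two_common {T : Finset (MarkedTuple k)}
    (h : ∀ g ∈ T, ∀ g' ∈ T, g ≠ g' → (verts g ∩ verts g').card ≤ 1) {g g' : MarkedTuple k}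
    (hg : g ∈ T) (hg' : g' ∈ T) {x y : Dyck k} (hxy : x ≠ y) (hx : x ∈ verts g)
    (hy : y ∈ verts g) (hx' : x ∈ verts g') (hy' : y ∈ verts g') : g = g' := by
  by_contra hne
  have h2 := h g hg g' hg' hne
  have : 1 < (verts g ∩ verts g').card :=
    Finset.one_lt_card.2 ⟨x, Finset.mem_inter.2 ⟨hx, hx'⟩, y, Finset.mem_inter.2 ⟨hy, hy'⟩, hxy⟩
  omega

/-- A path through other members between two vertices of `g`, closed by the edge inside `g`, is a
cycle and lies in a single member. Having two vertices in common with `g`, this member is `g`. But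
the first edge of the path comes from another member, which would then also have two vertices in
common with `g`. -/
theorem IsSpanningTree.isForest {T : Finset (MarkedTuple k)} (hT : IsSpanningTree k T)
    (hc : IsConflictFree T) : IsForest T := by
  classical
  intro g hg x hx y hy hxy hr
  have hle : cliqueGraph (T.erase g) ≤ cliqueGraph T := cliqueGraph_mono (Finset.erase_subset _ _)
  obtain ⟨p, hp⟩ := hr.exists_isPath
  have hadj : (cliqueGraph T).Adj y x := ⟨hxy.symm, g, hg, hy, hx⟩
  have hp' : (p.mapLe hle).IsPath := (SimpleGraph.Walk.isPath_mapLe hle).2 hp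
  have hnot : s(y, x) ∉ (p.mapLe hle).edges := by
    intro he
    rw [SimpleGraph.Walk.edges_mapLe_eq_edges] at he
    obtain ⟨_, g', hg', hy', hx'⟩ := p.adj_of_mem_edges he
    have := eq_of_two_common hc.card_inter_le hg (Finset.mem_of_mem_erase hg') hxy hx hy hx' hy'
    exact (Finset.mem_erase.1 hg').1 this.symm
  have hcyc := SimpleGraph.Path.cons_isCycle ⟨p.mapLe hle, hp'⟩ hadj hnot
  obtain ⟨g₀, ⟨hg₀, hall⟩, _⟩ := hT.cycle _ _ hcyc
  have hsup : ∀ z ∈ p.support, z ∈ verts g₀ := fun z hz => hall z (by simp [hz])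
  obtain rfl := eq_of_two_common hc.card_inter_le hg hg₀ hxy hx hy
    (hsup x p.start_mem_support) (hsup y p.end_mem_support)
  cases p with
  | nil => exact hxy rfl
  | @cons _ z _ h q =>
    have h' := h
    obtain ⟨hne, g', hg', hx', hz'⟩ := h'
    have := eq_of_two_common hc.card_inter_le hg (Finset.mem_of_mem_erase hg') hne hx
      (hsup z (by simp)) hx' hz'
    exact (Finset.mem_erase.1 hg').1 this.symm

/-- A path that leaves `g` cannot come back, since the excursion would join two vertices of `g`
without using `g`. The second clause, on starts outside `g`, records where the path enters `g` and
serves the induction. -/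
theorem IsForest.support_subset {T : Finset (MarkedTuple k)} (h : IsForest T) {g : MarkedTuple k}
    (hg : g ∈ T) {u v : Dyck k} (p : (cliqueGraph T).Walk u v) (hp : p.IsPath)
    (hv : v ∈ verts g) :
    (u ∈ verts g → ∀ z ∈ p.support, z ∈ verts g) ∧
    (u ∉ verts g → ∃ z ∈ p.support, z ∈ verts g ∧ (cliqueGraph (T.erase g)).Reachable u z) := by
  induction p with
  | nil => exact ⟨fun _ z hz => by simp at hz; exact hz ▸ hv, fun h => absurd hv h⟩
  | @cons u w v huw p ih =>
    rw [SimpleGraph.Walk.cons_isPath_iff] at hp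
    obtain ⟨ih1, ih2⟩ := ih hp.1 hv
    have hreach : (u ∉ verts g ∨ w ∉ verts g) → (cliqueGraph (T.erase g)).Reachable u w := by
      intro hn
      have h' := huw
      obtain ⟨hne, g', hg', hu', hw'⟩ := h'
      refine cliqueGraph_reachable (Finset.mem_erase.2 ⟨?_, hg'⟩) hu' hw'
      rintro rfl
      tauto
    refine ⟨fun hu => ?_, fun hu => ?_⟩
    · by_cases hw : w ∈ verts g
      · intro z hz
        rw [SimpleGraph.Walk.support_cons, List.mem_cons] at hz
        rcases hz with rfl | hz
        · exact hu
        · exact ih1 hw z hz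
      · obtain ⟨z, hz, hzg, hr⟩ := ih2 hw
        exact absurd ((hreach (Or.inr hw)).trans hr)
          (h g hg u hu z hzg (fun e => hp.2 (e ▸ hz)))
    · by_cases hw : w ∈ verts g
      · exact ⟨w, by simp, hw, hreach (Or.inl hu)⟩
      · obtain ⟨z, hz, hzg, hr⟩ := ih2 hw
        exact ⟨z, by simp [hz], hzg, (hreach (Or.inl hu)).trans hr⟩

theorem IsForest.isSpanningTree {T : Finset (MarkedTuple k)} (h : IsForest T)
    (hT : ∀ g ∈ T, IsHyperedge k g) (hconn : (cliqueGraph T).Connected) : IsSpanningTree k T := by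
  refine ⟨hT, hconn, fun x c hc => ?_⟩
  cases c with
  | nil => exact absurd rfl hc.ne_nil
  | @cons _ z _ hxz p =>
    have hp := ((SimpleGraph.Walk.cons_isCycle_iff p hxz).1 hc).1
    have h' := hxz
    obtain ⟨hne, g, hg, hx, hz⟩ := h'
    refine ⟨g, ⟨hg, fun y hy => ?_⟩, fun g' ⟨hg', hall⟩ => ?_⟩
    · rw [SimpleGraph.Walk.support_cons, List.mem_cons] at hy
      rcases hy with rfl | hy
      · exact hx
      · exact (h.support_subset hg p hp hx).1 hz y hy
    · exact eq_of_two_common (fun g hg g' hg' => h.card_inter_le hg hg') hg' hg hne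
        (hall x (by simp)) (hall z (by simp)) hx hz

/-- The symmetric difference of the 2-factor and flipping cycles without common edges. -/
def glue (C : MarkedTuple k → Set (Sym2 (OddVertex k))) (S : Finset (MarkedTuple k)) :
    Set (Sym2 (OddVertex k)) :=
  {e | (e ∈ twoFactor k ∧ ∀ g ∈ S, e ∉ C g) ∨ (e ∉ twoFactor k ∧ ∃ g ∈ S, e ∈ C g)}

theorem FlipData.cls_mem {g : MarkedTuple k} {E : Set (Sym2 (OddVertex k))}
    {f : Dyck k × ℕ → Sym2 (OddVertex k)} (h : FlipData g E f) {e : Sym2 (OddVertex k)}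
    (he : e ∈ E) {v : OddVertex k} (hv : v ∈ e) : cls v ∈ verts g := by
  obtain ⟨p, hp, hpv⟩ := h.cover e he v hv
  rw [cls_of_mem_flippable (h.flip p hp) hpv]
  exact Finset.mem_image_of_mem _ hp

theorem FlipData.cls_ne {g : MarkedTuple k} {E : Set (Sym2 (OddVertex k))}
    {f : Dyck k × ℕ → Sym2 (OddVertex k)} (h : FlipData g E f) {a b : OddVertex k}
    (he : s(a, b) ∈ E) (hF : s(a, b) ∉ twoFactor k) : cls a ≠ cls b := by
  intro hab
  obtain ⟨p, hp, hpa⟩ := h.cover _ he a (Sym2.mem_mk_left a b)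
  obtain ⟨q, hq, hqb⟩ := h.cover _ he b (Sym2.mem_mk_right a b)
  have h1 := cls_of_mem_flippable (h.flip p hp) hpa
  have h2 := cls_of_mem_flippable (h.flip q hq) hqb
  obtain rfl := h.inj_fst p hp q hq (h1.symm.trans (hab.trans h2))
  exact hF ((h.mem_twoFactor_iff he).2
    ⟨p, hp, ((Sym2.mem_and_mem_iff (h.adj _ _ he).ne).1 ⟨hpa, hqb⟩).symm⟩)

/-- A choice of flipping cycles for a conflict-free family of hyperedges. -/
structure FlipFamily (T : Finset (MarkedTuple k)) (C : MarkedTuple k → Set (Sym2 (OddVertex k)))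
    (f : MarkedTuple k → Dyck k × ℕ → Sym2 (OddVertex k)) : Prop where
  data : ∀ g ∈ T, FlipData g (C g) (f g)
  conflictFree : IsConflictFree T

theorem exists_flipFamily {T : Finset (MarkedTuple k)}
    {C : MarkedTuple k → Set (Sym2 (OddVertex k))} (hT : IsConflictFree T)
    (h : ∀ g ∈ T, IsFlippingCycle g (C g)) : ∃ f, FlipFamily T C f := by
  have : ∀ g, ∃ f, g ∈ T → FlipData g (C g) f := fun g => by
    by_cases hg : g ∈ T
    · obtain ⟨f, hf⟩ := exists_flipData (h g hg); exact ⟨f, fun _ => hf⟩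
    -- A dummy value for tuples outside `T`; the set of the first `k` coordinates is a vertex for
    -- every `k`.
    · exact ⟨fun _ => s(⟨Finset.univ.filter fun i => i.val < k, by
        rw [Fin.card_filter_val_lt]; omega⟩, ⟨Finset.univ.filter fun i => i.val < k, by
        rw [Fin.card_filter_val_lt]; omega⟩), fun h => absurd h hg⟩
  choose f hf using this
  exact ⟨f, hf, hT⟩

/-! ### Gluing a conflict-free family of flipping cycles -/

section Family

variable {T : Finset (MarkedTuple k)} {C : MarkedTuple k → Set (Sym2 (OddVertex k))}
  {f : MarkedTuple k → Dyck k × ℕ → Sym2 (OddVertex k)}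

/-- A common edge in the 2-factor would be flippable for both members, which would then carry the
same mark in the same list. A common edge outside the 2-factor joins two different lists, which
would be two common vertices of the members. -/
theorem FlipFamily.owner_unique (hk : 1 ≤ k) (h : FlipFamily T C f) {g g' : MarkedTuple k}
    (hg : g ∈ T) (hg' : g' ∈ T) {e : Sym2 (OddVertex k)} (he : e ∈ C g) (he' : e ∈ C g') :
    g = g' := by
  by_contra hne
  by_cases hF : e ∈ twoFactor k
  · obtain ⟨p, hp, rfl⟩ := ((h.data g hg).mem_twoFactor_iff he).1 hF
    obtain ⟨q, hq, hpq⟩ := ((h.data g' hg').mem_twoFactor_iff he').1 hF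
    have h1 := flippable_eq_iff hk ((h.data g hg).flip p hp) (hpq ▸ (h.data g' hg').flip q hq)
    exact h.conflictFree.mark_ne g hg g' hg' hne p.1 p.2 q.2 hp (by rw [h1.1]; exact hq) h1.2
  · induction e using Sym2.ind with
    | _ a b =>
    exact hne (eq_of_two_common h.conflictFree.card_inter_le hg hg' ((h.data g hg).cls_ne he hF)
      ((h.data g hg).cls_mem he (Sym2.mem_mk_left a b))
      ((h.data g hg).cls_mem he (Sym2.mem_mk_right a b))
      ((h.data g' hg').cls_mem he' (Sym2.mem_mk_left a b))
      ((h.data g' hg').cls_mem he' (Sym2.mem_mk_right a b)))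

-- Each edge lies on at most one of the cycles, so lying on an odd number of them just means lying
-- on one.
open Classical in
theorem FlipFamily.glue_eq (hk : 1 ≤ k) (h : FlipFamily T C f) :
    symmDiff (twoFactor k) {e | Odd (T.filter fun g => e ∈ C g).card} = glue C T := by
  have key : ∀ e, Odd (T.filter fun g => e ∈ C g).card ↔ ∃ g ∈ T, e ∈ C g := by
    intro e
    have hle : (T.filter fun g => e ∈ C g).card ≤ 1 := by
      rw [Finset.card_le_one]
      intro a ha b hb
      rw [Finset.mem_filter] at ha hb
      exact h.owner_unique hk ha.1 hb.1 ha.2 hb.2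
    constructor
    · intro ho
      obtain ⟨g, hg⟩ := Finset.card_pos.1 ho.pos
      exact ⟨g, (Finset.mem_filter.1 hg).1, (Finset.mem_filter.1 hg).2⟩
    · rintro ⟨g, hg, he⟩
      have : 0 < (T.filter fun g => e ∈ C g).card :=
        Finset.card_pos.2 ⟨g, Finset.mem_filter.2 ⟨hg, he⟩⟩
      rw [show (T.filter fun g => e ∈ C g).card = 1 by omega]
      exact odd_one
  ext e
  rw [Set.mem_symmDiff, Set.mem_ofPred_eq, key, glue, Set.mem_ofPred_eq]
  push Not
  tauto

theorem FlipFamily.glue_adj (hk : 1 ≤ k) (h : FlipFamily T C f) {S : Finset (MarkedTuple k)}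
    (hS : S ⊆ T) {a b : OddVertex k} (he : s(a, b) ∈ glue C S) : (oddGraph k).Adj a b := by
  rcases he with he | ⟨_, g, hg, he⟩
  · exact twoFactor_adj hk he.1
  · exact (h.data g (hS hg)).adj a b he

theorem FlipFamily.mem_glue_insert (hk : 1 ≤ k) (h : FlipFamily T C f)
    {S : Finset (MarkedTuple k)} {g : MarkedTuple k} (hS : insert g S ⊆ T) (hg : g ∉ S)
    (e : Sym2 (OddVertex k)) : e ∈ glue C (insert g S) ↔
      (e ∈ C g ∧ e ∉ twoFactor k) ∨ (e ∉ C g ∧ e ∈ glue C S) := by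
  have hS' : ∀ g' ∈ S, e ∈ C g' → e ∉ C g := fun g' hg' he he' => by
    have := h.owner_unique hk (hS (Finset.mem_insert_of_mem hg'))
      (hS (Finset.mem_insert_self g S)) he he'
    exact hg (this ▸ hg')
  simp only [glue, Set.mem_ofPred_eq, Finset.forall_mem_insert, Finset.exists_mem_insert]
  by_cases h1 : e ∈ twoFactor k <;> by_cases h2 : e ∈ C g <;> simp [h1, h2]

theorem FlipFamily.mem_glue_of_flippable (hk : 1 ≤ k) (h : FlipFamily T C f)
    {S : Finset (MarkedTuple k)} {g : MarkedTuple k} (hS : insert g S ⊆ T) (hg : g ∉ S)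
    {e : Sym2 (OddVertex k)} (he : e ∈ C g) : e ∈ glue C S ↔ e ∈ twoFactor k := by
  have hS' : ∀ g' ∈ S, e ∉ C g' := fun g' hg' he' => by
    have := h.owner_unique hk (hS (Finset.mem_insert_of_mem hg'))
      (hS (Finset.mem_insert_self g S)) he' he
    exact hg (this ▸ hg')
  simp only [glue, Set.mem_ofPred_eq]
  constructor
  · rintro (h1 | ⟨_, g', hg', h2⟩)
    · exact h1.1
    · exact absurd h2 (hS' g' hg')
  · exact fun h1 => Or.inl ⟨h1, hS'⟩

/-- Adding `g` exchanges two edges at each vertex of its cycle: the flippable one, still present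
because no other member owns it, is replaced by the other edge of the cycle, absent so far. Other
vertices are unaffected. -/
theorem FlipFamily.glue_ncard (hk : 1 ≤ k) (h : FlipFamily T C f) (S : Finset (MarkedTuple k))
    (hS : S ⊆ T) (v : OddVertex k) : {w | s(v, w) ∈ glue C S}.ncard = 2 := by
  classical
  induction S using Finset.induction_on with
  | empty =>
    rw [← twoFactor_ncard hk v]
    simp [glue]
  | insert g S hg ih =>
    have ih := ih ((Finset.subset_insert _ _).trans hS)
    have hgT := hS (Finset.mem_insert_self g S)
    by_cases hv : ∃ w, s(v, w) ∈ C g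
    · obtain ⟨w, hw⟩ := hv
      obtain ⟨p, hp, q, hq, hpq, a, b, ha, hb, hab, hset, hnF⟩ :=
        (h.data g hgT).local_structure hw (Sym2.mem_mk_left v w)
      have hva : s(v, a) ∈ C g := by rw [← ha]; exact (h.data g hgT).mem p hp
      have haF : s(v, a) ∈ twoFactor k := by
        rw [← ha]; exact flippable_mem_twoFactor ((h.data g hgT).flip p hp)
      have hvb : s(v, b) ∈ C g := by
        have : b ∈ {w | s(v, w) ∈ C g} := by rw [hset]; simp
        exact this
      have haS := (h.mem_glue_of_flippable hk hS hg hva).2 haF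
      have hbS := mt (h.mem_glue_of_flippable hk hS hg hvb).1 hnF
      have : {w | s(v, w) ∈ glue C (insert g S)}
          = insert b ({w | s(v, w) ∈ glue C S} \ {a}) := by
        ext w
        have hw' : s(v, w) ∈ C g ↔ w = a ∨ w = b := by
          have := congrArg (fun s => w ∈ s) hset
          simpa using this
        rw [Set.mem_ofPred_eq, h.mem_glue_insert hk hS hg, Set.mem_insert_iff, Set.mem_sdiff,
          Set.mem_ofPred_eq, Set.mem_singleton_iff, hw']
        by_cases h1 : w = a
        · subst h1; simp [haF, hab]
        · by_cases h2 : w = b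
          · subst h2; simp [hnF]
          · simp [h1, h2]
      rw [this, Set.ncard_insert_of_notMem (by simp [hbS]),
        Set.ncard_sdiff_singleton_of_mem (by exact haS), ih]
    · push Not at hv
      rw [← ih]
      congr 1
      ext w
      rw [Set.mem_ofPred_eq, h.mem_glue_insert hk hS hg, Set.mem_ofPred_eq]
      simp [hv w]

/-- The graph with the edge set `glue C S`. -/
def glueGraph (C : MarkedTuple k → Set (Sym2 (OddVertex k))) (S : Finset (MarkedTuple k)) :
    SimpleGraph (OddVertex k) := SimpleGraph.fromEdgeSet (glue C S)

theorem FlipFamily.glueGraph_adj (hk : 1 ≤ k) (h : FlipFamily T C f)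
    {S : Finset (MarkedTuple k)} (hS : S ⊆ T) (a b : OddVertex k) :
    (glueGraph C S).Adj a b ↔ s(a, b) ∈ glue C S := by
  rw [glueGraph, SimpleGraph.fromEdgeSet_adj]
  exact ⟨fun h => h.1, fun h' => ⟨h', (h.glue_adj hk hS h').ne⟩⟩

theorem FlipFamily.isCycles (hk : 1 ≤ k) (h : FlipFamily T C f) {S : Finset (MarkedTuple k)}
    (hS : S ⊆ T) : (glueGraph C S).IsCycles := by
  intro v _
  rw [← h.glue_ncard hk S hS v]
  congr 1
  ext w
  rw [SimpleGraph.mem_neighborSet, h.glueGraph_adj hk hS]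
  rfl

theorem FlipFamily.reachable_cls (hk : 1 ≤ k) (h : FlipFamily T C f)
    {S : Finset (MarkedTuple k)} (hS : S ⊆ T) {a b : OddVertex k}
    (hab : (glueGraph C S).Reachable a b) : (cliqueGraph S).Reachable (cls a) (cls b) := by
  obtain ⟨p⟩ := hab
  induction p with
  | nil => exact SimpleGraph.Reachable.refl _
  | cons hadj _ ih =>
    refine SimpleGraph.Reachable.trans ?_ ih
    rcases (h.glueGraph_adj hk hS _ _).1 hadj with he | ⟨_, g, hg, he⟩
    · rw [twoFactor_cls he.1]
    · exact cliqueGraph_reachable hg ((h.data g (hS hg)).cls_mem he (Sym2.mem_mk_left _ _))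
        ((h.data g (hS hg)).cls_mem he (Sym2.mem_mk_right _ _))

/-- When `g` is added, its lists lie in different components because `T` is a forest. Each of these
components is a cycle that loses a single edge, and remains connected as a path. The new edges of
the flipping cycle join these paths. -/
theorem FlipFamily.reachable_glue (hk : 1 ≤ k) (h : FlipFamily T C f) (hT : IsForest T)
    (S : Finset (MarkedTuple k)) (hS : S ⊆ T) (a b : OddVertex k)
    (hab : (cliqueGraph S).Reachable (cls a) (cls b)) : (glueGraph C S).Reachable a b := by
  classical
  induction S using Finset.induction_on generalizing a b with
  | empty =>
    have : cls a = cls b := by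
      obtain ⟨p⟩ := hab
      generalize cls a = x at p
      cases p with
      | nil => rfl
      | cons h => obtain ⟨_, g, hg, _⟩ := h; simp at hg
    refine twoFactor_reachable (fun a b hab => SimpleGraph.Adj.reachable ?_) this
    rw [h.glueGraph_adj hk (by simp)]
    exact Or.inl ⟨hab, by simp⟩
  | insert g S hg ih =>
    have hS' := (Finset.subset_insert g S).trans hS
    have ih := ih hS'
    have hgT := hS (Finset.mem_insert_self g S)
    have D := h.data g hgT
    have hSe : S ⊆ T.erase g := fun x hx => Finset.mem_erase.2 ⟨fun e => hg (e ▸ hx), hS' hx⟩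
    have step : ∀ {a b}, s(a, b) ∈ glue C S → s(a, b) ∉ C g →
        (glueGraph C (insert g S)).Adj a b := fun h1 h2 => by
      rw [h.glueGraph_adj hk hS, h.mem_glue_insert hk hS hg]; exact Or.inr ⟨h2, h1⟩
    have flipR : ∀ p ∈ g, ∀ a b, f g p = s(a, b) →
        (glueGraph C (insert g S)).Reachable a b := by
      intro p hp a b hpab
      have hca : cls a = p.1 :=
        cls_of_mem_flippable (D.flip p hp) (by rw [hpab]; exact Sym2.mem_mk_left _ _)
      have hmem : s(a, b) ∈ C g := hpab ▸ D.mem p hp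
      have hF : s(a, b) ∈ twoFactor k := hpab ▸ flippable_mem_twoFactor (D.flip p hp)
      have hadj : (glueGraph C S).Adj a b :=
        (h.glueGraph_adj hk hS' a b).2 ((h.mem_glue_of_flippable hk hS hg hmem).2 hF)
      -- All degrees are 2, so the flippable edge is not a bridge, and its ends are joined by the
      -- rest of its component.
      obtain ⟨w⟩ := (h.isCycles hk hS').reachable_deleteEdges hadj
      have main : ∀ {c d : OddVertex k} (w : ((glueGraph C S).deleteEdges {s(a, b)}).Walk c d),
          (cliqueGraph S).Reachable (cls a) (cls c) →
          (glueGraph C (insert g S)).Reachable c d := by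
        intro c d w
        induction w with
        | nil => exact fun _ => SimpleGraph.Reachable.refl _
        | @cons c c' d hcc' w ihw =>
          intro hc
          rw [SimpleGraph.deleteEdges_adj] at hcc'
          have hc' : (cliqueGraph S).Reachable (cls a) (cls c') :=
            hc.trans (h.reachable_cls hk hS' hcc'.1.reachable)
          refine SimpleGraph.Reachable.trans (SimpleGraph.Adj.reachable (step
            ((h.glueGraph_adj hk hS' _ _).1 hcc'.1) fun hmem' => ?_)) (ihw hc')
          have hF' := (h.mem_glue_of_flippable hk hS hg hmem').1
            ((h.glueGraph_adj hk hS' _ _).1 hcc'.1)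
          obtain ⟨q, hq, hq'⟩ := (D.mem_twoFactor_iff hmem').1 hF'
          have hcq : cls c = q.1 :=
            cls_of_mem_flippable (D.flip q hq) (by rw [← hq']; exact Sym2.mem_mk_left _ _)
          by_cases hpq : p = q
          · apply hcc'.2
            rw [hq', ← hpq, hpab]; rfl
          -- The detour cannot meet another removed edge: that edge belongs to another list of `g`,
          -- which the forest `T` puts into another component.
          · refine hT g hgT p.1 (Finset.mem_image_of_mem _ hp) q.1 (Finset.mem_image_of_mem _ hq)
              (fun e => hpq (D.inj_fst p hp q hq e)) ?_
            rw [← hca, ← hcq]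
            exact hc.mono (cliqueGraph_mono hSe)
      exact main w (SimpleGraph.Reachable.refl _)
    have stepR : ∀ a b, (glueGraph C S).Reachable a b →
        (glueGraph C (insert g S)).Reachable a b := by
      rintro a b ⟨p⟩
      induction p with
      | nil => exact SimpleGraph.Reachable.refl _
      | @cons a c b hac p ihp =>
        refine SimpleGraph.Reachable.trans ?_ ihp
        have hac' := (h.glueGraph_adj hk hS' _ _).1 hac
        by_cases hC : s(a, c) ∈ C g
        · have hF := (h.mem_glue_of_flippable hk hS hg hC).1 hac'
          obtain ⟨q, hq, hq'⟩ := (D.mem_twoFactor_iff hC).1 hF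
          exact flipR q hq a c hq'.symm
        · exact (step hac' hC).reachable
    -- Along the flipping cycle, new edges are present and each removed flippable edge is bypassed
    -- by its detour.
    have cycR : ∀ a b, (SimpleGraph.fromEdgeSet (C g)).Reachable a b →
        (glueGraph C (insert g S)).Reachable a b := by
      rintro a b ⟨p⟩
      induction p with
      | nil => exact SimpleGraph.Reachable.refl _
      | @cons a c b hac p ihp =>
        refine SimpleGraph.Reachable.trans ?_ ihp
        rw [SimpleGraph.fromEdgeSet_adj] at hac
        by_cases hF : s(a, c) ∈ twoFactor k
        · obtain ⟨q, hq, hq'⟩ := (D.mem_twoFactor_iff hac.1).1 hF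
          exact flipR q hq a c hq'.symm
        · refine SimpleGraph.Adj.reachable ?_
          rw [h.glueGraph_adj hk hS, h.mem_glue_insert hk hS hg]
          exact Or.inl ⟨hac.1, hF⟩
    have key : ∀ x y, (cliqueGraph (insert g S)).Reachable x y → ∀ a b, cls a = x → cls b = y →
        (glueGraph C (insert g S)).Reachable a b := by
      rintro x y ⟨p⟩
      induction p with
      | nil =>
        intro a b ha hb
        exact stepR a b (ih a b (by rw [ha, hb]))
      | @cons x z y hxz p ihp =>
        intro a b ha hb
        refine SimpleGraph.Reachable.trans ?_ (ihp (vtx z 0) b (cls_vtx _ _) hb)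
        obtain ⟨hne, g', hg', hx, hz⟩ := hxz
        rcases Finset.mem_insert.1 hg' with rfl | hg'
        · obtain ⟨r, hr, rfl⟩ := Finset.mem_image.1 hx
          obtain ⟨q, hq, rfl⟩ := Finset.mem_image.1 hz
          obtain ⟨u, hu⟩ : ∃ u, u ∈ f g' r := ⟨_, Sym2.out_fst_mem _⟩
          obtain ⟨v, hv⟩ : ∃ v, v ∈ f g' q := ⟨_, Sym2.out_fst_mem _⟩
          have hu' := cls_of_mem_flippable (D.flip r hr) hu
          have hv' := cls_of_mem_flippable (D.flip q hq) hv
          refine (stepR _ _ (ih a u (by rw [ha, hu']))).trans ((cycR u v (D.conn _ (D.mem r hr)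
            u hu _ (D.mem q hq) v hv)).trans (stepR _ _ (ih v _ (by rw [hv', cls_vtx]))))
        · exact stepR _ _ (ih _ _ (by
            rw [ha, cls_vtx]; exact cliqueGraph_reachable hg' hx hz))
    exact key _ _ hab a b rfl rfl

theorem FlipFamily.isHamiltonEdgeSet (hk : 1 ≤ k) (h : FlipFamily T C f) (hT : IsForest T)
    (hconn : (cliqueGraph T).Connected) : IsHamiltonEdgeSet k (glue C T) := by
  classical
  have hreach : ∀ a b, (glueGraph C T).Reachable a b := fun a b =>
    h.reachable_glue hk hT T subset_rfl a b (hconn.preconnected _ _)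
  have hadj := fun a b => h.glueGraph_adj hk subset_rfl a b
  have hle : glueGraph C T ≤ oddGraph k := fun a b hab => h.glue_adj hk subset_rfl ((hadj a b).1 hab)
  obtain ⟨x⟩ := hconn.nonempty
  let v₀ := vtx x 0
  have hne : ((glueGraph C T).neighborSet v₀).Nonempty := by
    have := h.glue_ncard hk T subset_rfl v₀
    obtain ⟨w, hw⟩ := Set.nonempty_of_ncard_ne_zero (s := {w | s(v₀, w) ∈ glue C T}) (by omega)
    exact ⟨w, (hadj _ _).2 hw⟩
  obtain ⟨p, hp, hsupp⟩ :=
    (h.isCycles hk (subset_refl T)).exists_cycle_toSubgraph_verts_eq_connectedComponentSupp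
      (c := (glueGraph C T).connectedComponentMk v₀) rfl hne
  have hall : ∀ v, v ∈ p.support := fun v => by
    rw [← SimpleGraph.Walk.mem_verts_toSubgraph, hsupp,
      SimpleGraph.ConnectedComponent.mem_supp_iff, SimpleGraph.ConnectedComponent.eq]
    exact hreach _ _
  refine ⟨v₀, p.mapLe hle, ?_, ?_⟩
  · rw [SimpleGraph.Walk.isHamiltonianCycle_iff_isCycle_and_support_count_tail_eq_one]
    refine ⟨(SimpleGraph.Walk.isCycle_mapLe hle).2 hp, fun v => ?_⟩
    rw [SimpleGraph.Walk.support_mapLe_eq_support]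
    refine @List.count_eq_one_of_mem _ (_) (by infer_instance) _ _ hp.support_nodup ?_
    rcases (SimpleGraph.Walk.mem_support_iff p).1 (hall v) with rfl | h
    · exact SimpleGraph.Walk.end_mem_tail_support hp.not_nil
    · exact h
  · ext e
    rw [SimpleGraph.Walk.mem_edgeSet, SimpleGraph.Walk.edges_mapLe_eq_edges]
    induction e using Sym2.ind with
    | _ a b =>
    have heq : p.toSubgraph.neighborSet a = {w | s(a, w) ∈ glue C T} := by
      refine Set.eq_of_subset_of_ncard_le (fun w hw => ?_) ?_
      · exact (hadj _ _).1 (SimpleGraph.Subgraph.Adj.adj_sub hw)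
      · rw [h.glue_ncard hk T subset_rfl, hp.ncard_neighborSet_toSubgraph_eq_two (hall a)]
    rw [← SimpleGraph.Walk.adj_toSubgraph_iff_mem_edges, ← SimpleGraph.Subgraph.mem_neighborSet,
      heq, Set.mem_ofPred_eq]

end Family

theorem yields_isHamilton (hk : 1 ≤ k) {T : Finset (MarkedTuple k)} (hT : IsSpanningTree k T)
    (hc : IsConflictFree T) {H : Set (Sym2 (OddVertex k))} (hH : Yields T H) :
    IsHamiltonEdgeSet k H := by
  obtain ⟨C, hC, rfl⟩ := hH
  obtain ⟨f, hf⟩ := exists_flipFamily hc hC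
  rw [hf.glue_eq hk]
  exact hf.isHamiltonEdgeSet hk (hT.isForest hc) hT.connected

end Gluing

/-! ### Normal form of hyperedges -/

section NormalForm

/-- The basic tuples and their reversed complements without the entries that all their words have
in common at the ends; here the marked positions are counted from the left. -/
def templates : List (List MarkedWord) :=
  [[([U, U, D, D, D], 3), ([U, D, D, U, D], 0), ([U, D, U, D, D], 4)],
   [([U, U, U, D, D], 1), ([U, D, U, U, D], 4), ([U, U, D, U, D], 0)],
   [([U, U, D, D, U, U, D, D], 1), ([U, U, D, U, U, D, D, D], 7), ([U, U, U, D, U, D, D, D], 5)],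
   [([U, U, D, D, U, U, D, D], 6), ([U, U, U, D, D, U, D, D], 0), ([U, U, U, D, U, D, D, D], 2)],
   [([U, U, U, D, D, D], 5), ([U, D, U, U, D, D], 4), ([U, D, U, D, U, D], 0)],
   [([U, U, U, D, D, D], 0), ([U, U, D, D, U, D], 1), ([U, D, U, D, U, D], 5)],
   [([U, U, U, D, D, D], 5), ([U, U, D, U, D, D], 4), ([U, D, U, U, D, D], 2),
    ([U, D, U, D, U, D], 0)],
   [([U, U, U, D, D, D], 0), ([U, U, D, U, D, D], 1), ([U, U, D, D, U, D], 3),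
    ([U, D, U, D, U, D], 5)]]

variable {k : ℕ}

/-- `p` is the word `u ξ v` with the position of the marked entry of `m = ξ`. -/
def PlacedAt (u v : List DyckStep) (p : Dyck k × ℕ) (m : MarkedWord) : Prop :=
  p.1.1.toList = u ++ m.1 ++ v ∧ p.2 + u.length + m.2 + 1 = 2 * k

/-- `g` consists of the words of the template `τ` placed between `u` and `v`. -/
structure Placed (g : MarkedTuple k) (τ : List MarkedWord) (u v : List DyckStep) : Prop where
  of_mem : ∀ p ∈ g, ∃ m ∈ τ, PlacedAt u v p m
  exists_mem : ∀ m ∈ τ, ∃ p ∈ g, PlacedAt u v p m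

theorem placed_of_image {g : MarkedTuple k} {L τ : List MarkedWord} {u v : List DyckStep}
    (h : g.image (fun p => (p.1.1.toList, p.2)) = L.toFinset)
    (hL : L = τ.map fun m => (u ++ m.1 ++ v, m.1.length - 1 - m.2 + v.length))
    (hτ : ∀ m ∈ τ, m.2 < m.1.length) : Placed g τ u v := by
  have key : ∀ p : Dyck k × ℕ, ∀ m ∈ τ,
      (u ++ m.1 ++ v, m.1.length - 1 - m.2 + v.length) = (p.1.1.toList, p.2) → PlacedAt u v p m := by
    intro p m hm he
    rw [Prod.mk.injEq] at he
    have h1 := hτ m hm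
    have h2 := length_word p.1
    rw [← he.1] at h2
    simp only [List.length_append] at h2
    exact ⟨he.1.symm, by omega⟩
  constructor
  · intro p hp
    have : (p.1.1.toList, p.2) ∈ L.toFinset :=
      h ▸ Finset.mem_image_of_mem (fun p : Dyck k × ℕ => (p.1.1.toList, p.2)) hp
    rw [List.mem_toFinset, hL, List.mem_map] at this
    obtain ⟨m, hm, he⟩ := this
    exact ⟨m, hm, key p m hm he⟩
  · intro m hm
    have : (u ++ m.1 ++ v, m.1.length - 1 - m.2 + v.length) ∈ L.toFinset := by
      rw [List.mem_toFinset, hL]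
      exact List.mem_map_of_mem (f := fun m : MarkedWord =>
        (u ++ m.1 ++ v, m.1.length - 1 - m.2 + v.length)) hm
    rw [← h, Finset.mem_image] at this
    obtain ⟨p, hp, he⟩ := this
    exact ⟨p, hp, key p m hm he.symm⟩

theorem templates_mark_lt : ∀ τ ∈ templates, ∀ m ∈ τ, m.2 < m.1.length := by decide

/-- The common beginning `0w` in the first tuple is absorbed by the prefix, and its mirror image by
the suffix. So the infinitely many tuples reduce to eight fixed templates, about which statements
can be decided. -/
theorem exists_placed {g : MarkedTuple k} (h : IsHyperedge k g) :
    ∃ τ ∈ templates, ∃ u v, Placed g τ u v := by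
  obtain ⟨τ, u, v, hτ, h | h⟩ := h
  · rcases hτ with ⟨w, rfl⟩ | rfl | rfl | rfl
    · exact ⟨templates[0], by simp [templates], u ++ ([U] ++ w.toList), v,
        placed_of_image h (by simp [S₁, templates, insertBetween])
          (templates_mark_lt _ (by simp [templates]))⟩
    · exact ⟨templates[2], by simp [templates], u, v,
        placed_of_image h (by simp [S₂, templates, insertBetween])
          (templates_mark_lt _ (by simp [templates]))⟩
    · exact ⟨templates[4], by simp [templates], u, v,
        placed_of_image h (by simp [S₃, templates, insertBetween])
          (templates_mark_lt _ (by simp [templates]))⟩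
    · exact ⟨templates[6], by simp [templates], u, v,
        placed_of_image h (by simp [S₄, templates, insertBetween])
          (templates_mark_lt _ (by simp [templates]))⟩
  · rcases hτ with ⟨w, rfl⟩ | rfl | rfl | rfl
    · refine ⟨templates[1], by simp [templates], u, (w.toList.reverse.map compl ++ [D]) ++ v,
        placed_of_image h ?_ (templates_mark_lt _ (by simp [templates]))⟩
      simp [S₁, templates, insertBetween, reverseCompl, compl]
      omega
    · exact ⟨templates[3], by simp [templates], u, v,
        placed_of_image h (by simp [S₂, templates, insertBetween, reverseCompl, compl])
          (templates_mark_lt _ (by simp [templates]))⟩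
    · exact ⟨templates[5], by simp [templates], u, v,
        placed_of_image h (by simp [S₃, templates, insertBetween, reverseCompl, compl])
          (templates_mark_lt _ (by simp [templates]))⟩
    · exact ⟨templates[7], by simp [templates], u, v,
        placed_of_image h (by simp [S₄, templates, insertBetween, reverseCompl, compl])
          (templates_mark_lt _ (by simp [templates]))⟩

theorem PlacedAt.eq {u v : List DyckStep} {p q : Dyck k × ℕ} {m : MarkedWord}
    (h : PlacedAt u v p m) (h' : PlacedAt u v q m) : p = q := by
  have h1 : p.1 = q.1 := Subtype.ext (DyckWord.ext (h.1.trans h'.1.symm))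
  have h2 := h.2
  have h3 := h'.2
  exact Prod.ext h1 (by omega)

theorem PlacedAt.fst_ne {u v : List DyckStep} {p q : Dyck k × ℕ} {m n : MarkedWord}
    (h : PlacedAt u v p m) (h' : PlacedAt u v q n) (hne : m.1 ≠ n.1) : p.1 ≠ q.1 := by
  intro he
  have := h.1
  rw [he, h'.1, List.append_assoc, List.append_assoc, List.append_cancel_left_eq,
    List.append_cancel_right_eq] at this
  exact hne this.symm

theorem PlacedAt.snd_ne {u v : List DyckStep} {p q : Dyck k × ℕ} {m n : MarkedWord}
    (h : PlacedAt u v p m) (h' : PlacedAt u v q n) (hne : m.2 ≠ n.2) : p.2 ≠ q.2 := by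
  have h2 := h.2
  have h3 := h'.2
  omega

end NormalForm

/-! ### Flipping cycles of hyperedges -/

section Lowest

/-- The minimum of `h` over the interval `[a + 1, a + 1 + n]`. -/
def lowest (h : ℕ → ℤ) (a : ℕ) : ℕ → ℤ
  | 0 => h (a + 1)
  | n + 1 => min (lowest h a n) (h (a + 1 + (n + 1)))

theorem lowest_le (h : ℕ → ℤ) (a n i : ℕ) (hi : i ≤ n) : lowest h a n ≤ h (a + 1 + i) := by
  induction n with
  | zero => obtain rfl : i = 0 := by omega
            exact le_rfl
  | succ n ih =>
    rw [lowest]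
    rcases Nat.lt_or_ge n i with h1 | h1
    · obtain rfl : i = n + 1 := by omega
      exact min_le_right _ _
    · exact (min_le_left _ _).trans (ih h1)

theorem exists_eq_lowest (h : ℕ → ℤ) (a n : ℕ) : ∃ i ≤ n, lowest h a n = h (a + 1 + i) := by
  induction n with
  | zero => exact ⟨0, le_rfl, rfl⟩
  | succ n ih =>
    obtain ⟨i, hi, he⟩ := ih
    rw [lowest]
    rcases min_choice (lowest h a n) (h (a + 1 + (n + 1))) with h1 | h1
    · exact ⟨i, by omega, by rw [h1, he]⟩
    · exact ⟨n + 1, le_rfl, h1⟩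

theorem lowest_eq_of {h h' : ℕ → ℤ} {a a' n n' : ℕ} (c : ℤ)
    (h1 : ∀ i ≤ n, ∃ i' ≤ n', c + h' (a' + 1 + i') ≤ h (a + 1 + i))
    (h2 : ∀ i' ≤ n', ∃ i ≤ n, h (a + 1 + i) ≤ c + h' (a' + 1 + i')) :
    lowest h a n = c + lowest h' a' n' := by
  apply le_antisymm
  · obtain ⟨i', hi', he⟩ := exists_eq_lowest h' a' n'
    obtain ⟨i, hi, hle⟩ := h2 i' hi'
    rw [he]
    exact (lowest_le h a n i hi).trans hle
  · obtain ⟨i, hi, he⟩ := exists_eq_lowest h a n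
    obtain ⟨i', hi', hle⟩ := h1 i hi
    rw [he]
    have := lowest_le h' a' n' i' hi'
    omega

/-- Whether the entry `q` of `L` is flipped when the entry `m` is about to be, with the heights
shifted by `b`. -/
def isFlipped (L : List DyckStep) (b : ℤ) (m q : ℕ) : Bool :=
  if q < m then decide ((b + lowest (height L) q (m - q - 1)) % 2 = 1)
  else if m < q then decide ((b + lowest (height L) m (q - m - 1)) % 2 = 0)
  else false

/-- The entry `q` on the lines at which the entry `m` is flipped, up to complementation. -/
def flipBit (L : List DyckStep) (b : ℤ) (m q : ℕ) : Bool :=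
  (L[q]? == some D) ^^ isFlipped L b m q

theorem isFlipped_emod (L : List DyckStep) (b : ℤ) (m q : ℕ) :
    isFlipped L (b % 2) m q = isFlipped L b m q := by
  rw [isFlipped, isFlipped, Int.emod_add_emod, Int.emod_add_emod]

theorem flipBit_emod (L : List DyckStep) (b : ℤ) (m q : ℕ) :
    flipBit L (b % 2) m q = flipBit L b m q := by
  rw [flipBit, flipBit, isFlipped_emod]

theorem height_middle (u ξ v : List DyckStep) (i : ℕ) (hi : i ≤ ξ.length) :
    height (u ++ ξ ++ v) (u.length + i) = height u u.length + height ξ i := by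
  rw [List.append_assoc, height_append_right, height_append_left _ _ _ hi]

theorem height_left (u ξ v : List DyckStep) (i : ℕ) (hi : i ≤ u.length) :
    height (u ++ ξ ++ v) i = height u i := by
  rw [List.append_assoc, height_append_left _ _ _ hi]

theorem height_right (u ξ v : List DyckStep) (i : ℕ) :
    height (u ++ ξ ++ v) (u.length + ξ.length + i)
      = height u u.length + height ξ ξ.length + height v i := by
  rw [← List.length_append, height_append_right, List.length_append, height_append_right]

theorem flipBit_middle (u ξ v : List DyckStep) {m q : ℕ} (hm : m < ξ.length) (hq : q < ξ.length) :
    flipBit (u ++ ξ ++ v) 0 (u.length + m) (u.length + q)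
      = flipBit ξ (height u u.length) m q := by
  have hget : (u ++ ξ ++ v)[u.length + q]? = ξ[q]? := by
    rw [List.append_assoc, List.getElem?_append_right (by omega), Nat.add_sub_cancel_left,
      List.getElem?_append_left hq]
  have key : ∀ a n, a + 1 + n ≤ ξ.length →
      lowest (height (u ++ ξ ++ v)) (u.length + a) n = height u u.length + lowest (height ξ) a n := by
    intro a n han
    have := fun i (hi : i ≤ n) => height_middle u ξ v (a + 1 + i) (by omega)
    exact lowest_eq_of _
      (fun i hi => ⟨i, hi, by rw [← this i hi]; exact (congrArg _ (by omega)).le⟩)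
      (fun i hi => ⟨i, hi, by rw [← this i hi]; exact (congrArg _ (by omega)).le⟩)
  rw [flipBit, flipBit, hget, isFlipped, isFlipped]
  congr 1
  by_cases h1 : q < m
  · rw [if_pos h1, if_pos (by omega), Nat.add_sub_add_left, key _ _ (by omega), zero_add]
  · rw [if_neg h1, if_neg (by omega)]
    by_cases h2 : m < q
    · rw [if_pos h2, if_pos (by omega), Nat.add_sub_add_left, key _ _ (by omega), zero_add]
    · rw [if_neg h2, if_neg (by omega)]

/-- The heights of `ξ` up to the entry `m` are nonnegative, and after it at least the final one. -/
def WellShaped (m : MarkedWord) : Prop :=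
  m.2 < m.1.length ∧ (∀ i ≤ m.2, 0 ≤ height m.1 i) ∧
    ∀ i ≤ m.1.length, m.2 < i → height m.1 m.1.length ≤ height m.1 i

/-- Between its start and its mark the inserted word does not go below its starting level, so the
minimum from `q` to the mark is attained in `u`. The result does not depend on `m`. -/
theorem flipBit_left (u v : List DyckStep) {m : MarkedWord} (h : WellShaped m) {q : ℕ}
    (hq : q < u.length) :
    flipBit (u ++ m.1 ++ v) 0 (u.length + m.2) q =
      ((u[q]? == some D) ^^ decide (lowest (height u) q (u.length - q - 1) % 2 = 1)) := by
  obtain ⟨h0, h1, h2⟩ := h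
  rw [flipBit, isFlipped, if_pos (by omega), List.append_assoc, List.getElem?_append_left hq,
    ← List.append_assoc]
  congr 3
  rw [lowest_eq_of (h' := height u) (a' := q) (n' := u.length - q - 1) 0]
  · omega
  · intro i hi
    by_cases hi' : i ≤ u.length - q - 1
    · exact ⟨i, hi', by rw [height_left _ _ _ _ (by omega)]; omega⟩
    · refine ⟨u.length - q - 1, le_rfl, ?_⟩
      have := height_middle u m.1 v (q + 1 + i - u.length) (by omega)
      rw [show u.length + (q + 1 + i - u.length) = q + 1 + i by omega] at this
      rw [this, show q + 1 + (u.length - q - 1) = u.length by omega]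
      have := h1 (q + 1 + i - u.length) (by omega)
      omega
  · exact fun i hi => ⟨i, by omega, by rw [height_left _ _ _ _ (by omega)]; omega⟩

/-- After its mark the inserted word stays at or above its final level, so the minimum is attained
at its end or later. Only the final height of `m` enters, and the words of a template have it in
common. -/
theorem flipBit_right (u v : List DyckStep) {m : MarkedWord} (h : WellShaped m) (r : ℕ) :
    flipBit (u ++ m.1 ++ v) 0 (u.length + m.2) (u.length + m.1.length + r) =
      ((v[r]? == some D) ^^ decide (lowest (fun i => height u u.length + height m.1 m.1.length +
        height v (i - 1)) 0 r % 2 = 0)) := by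
  obtain ⟨h0, h1, h2⟩ := h
  have hget : (u ++ m.1 ++ v)[u.length + m.1.length + r]? = v[r]? := by
    rw [← List.length_append, List.getElem?_append_right (by omega), Nat.add_sub_cancel_left]
  rw [flipBit, isFlipped, if_neg (by omega), if_pos (by omega), hget]
  congr 3
  have hr := height_right u m.1 v
  -- `lowest` starts one place after its argument; the shift `i - 1` makes the interval `1, …, r +
  -- 1` run through the heights `0, …, r` of `v`.
  rw [lowest_eq_of (h' := fun i => height u u.length + height m.1 m.1.length +
        height v (i - 1)) (a' := 0) (n' := r) 0]
  · omega
  · intro i hi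
    by_cases hi' : m.2 + 1 + i < m.1.length
    · refine ⟨0, by omega, ?_⟩
      have := height_middle u m.1 v (m.2 + 1 + i) (by omega)
      rw [show u.length + (m.2 + 1 + i) = u.length + m.2 + 1 + i by omega] at this
      rw [this]
      have := h2 (m.2 + 1 + i) (by omega) (by omega)
      simp only [zero_add, add_zero, Nat.sub_self, height_zero]
      omega
    · refine ⟨m.2 + 1 + i - m.1.length, by omega, ?_⟩
      have := hr (m.2 + 1 + i - m.1.length)
      rw [show u.length + m.1.length + (m.2 + 1 + i - m.1.length) = u.length + m.2 + 1 + i by omega]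
        at this
      rw [this]
      simp
  · intro i hi
    refine ⟨m.1.length + i - m.2 - 1, by omega, ?_⟩
    have := hr i
    rw [show u.length + m.1.length + i = u.length + m.2 + 1 + (m.1.length + i - m.2 - 1) by omega]
      at this
    rw [this]
    simp

/-- Off the two marks, the entries flagged for `n` are flagged for `m`. -/
def Precedes (b : ℤ) (m n : MarkedWord) : Prop :=
  ∀ q < m.1.length, q ≠ m.2 → q ≠ n.2 → flipBit n.1 b n.2 q = true → flipBit m.1 b m.2 q = true

/-- Disjointness of an end for `m` and an end for `n` means one implication between bits at each
place. To the left and right of the window the bits coincide, so only the window has to be compared,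
with the prefix entering through the parity of its height. -/
theorem Precedes.extend {m n : MarkedWord} (hm : WellShaped m) (hn : WellShaped n)
    (hlen : m.1.length = n.1.length) (hend : height m.1 m.1.length = height n.1 n.1.length)
    {u v : List DyckStep} (h : Precedes (height u u.length % 2) m n) {q : ℕ}
    (hqm : q ≠ u.length + m.2) (hqn : q ≠ u.length + n.2)
    (hq : flipBit (u ++ n.1 ++ v) 0 (u.length + n.2) q = true) :
    flipBit (u ++ m.1 ++ v) 0 (u.length + m.2) q = true := by
  rcases Nat.lt_or_ge q u.length with h1 | h1
  · rw [flipBit_left u v hm h1]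
    rwa [flipBit_left u v hn h1] at hq
  · obtain ⟨q, rfl⟩ := Nat.exists_eq_add_of_le h1
    rcases Nat.lt_or_ge q m.1.length with h2 | h2
    · rw [flipBit_middle u m.1 v hm.1 h2, ← flipBit_emod]
      rw [flipBit_middle u n.1 v hn.1 (by omega), ← flipBit_emod] at hq
      exact h q h2 (by omega) (by omega) hq
    · obtain ⟨q, rfl⟩ := Nat.exists_eq_add_of_le h2
      rw [← add_assoc, flipBit_right u v hm q, hend]
      rw [hlen, ← add_assoc, flipBit_right u v hn q] at hq
      exact hq

variable {k : ℕ}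

theorem pval_lt_pval_iff (x : Dyck k) {a b : ℕ} (hab : a < b) (hb : b < 2 * k) :
    (lowest (height x.1.toList) a (b - a - 1) % 2 = 1 → pval x b < pval x a) ∧
    (lowest (height x.1.toList) a (b - a - 1) % 2 = 0 → pval x a < pval x b) := by
  obtain ⟨i, hi, he⟩ := exists_eq_lowest (height x.1.toList) a (b - a - 1)
  have := rearrange_order x.1 (· < ·) ((List.range (2 * k)).map (· + 1)) (by simp [x.2])
    (by rw [List.pairwise_map]; exact List.pairwise_lt_range.imp (by omega)) a b _ _ (a + 1 + i)
    (getElem?_permList x (by omega)) (getElem?_permList x hb) (by omega) (by omega)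
    (fun s' h1 h2 => by
      rw [← he]
      have := lowest_le (height x.1.toList) a (b - a - 1) (s' - a - 1) (by omega)
      rwa [show a + 1 + (s' - a - 1) = s' by omega] at this)
  rw [he]
  exact ⟨fun h => this.2 (Int.odd_iff.2 h), fun h => this.1 (Int.even_iff.2 h)⟩

theorem isFlipped_eq (x : Dyck k) {m q : ℕ} (hm : m < 2 * k) (hq : q < 2 * k) :
    isFlipped x.1.toList 0 m q = decide (pval x m < pval x q) := by
  rw [isFlipped, zero_add, zero_add, Bool.eq_iff_iff]
  rcases Nat.lt_trichotomy q m with h | rfl | h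
  · rw [if_pos h]
    have := pval_lt_pval_iff x h hm
    rcases Int.emod_two_eq_zero_or_one (lowest (height x.1.toList) q (m - q - 1)) with h1 | h1
    · have := this.2 h1; simp [h1]; omega
    · have := this.1 h1; simp [h1]; omega
  · simp
  · rw [if_neg (by omega), if_pos h]
    have := pval_lt_pval_iff x h hq
    rcases Int.emod_two_eq_zero_or_one (lowest (height x.1.toList) m (q - m - 1)) with h1 | h1
    · have := this.2 h1; simp [h1]; omega
    · have := this.1 h1; simp [h1]; omega

/-- The ends of the flippable edge at the entry `m`: one has the bit `0` at the first
coordinate, and the bits given by `flipBit`; the other is complementary off the entry `m`. -/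
theorem exists_flippableEdge (x : Dyck k) {m j : ℕ} (hm : m + 1 + j = 2 * k) :
    ∃ A B : OddVertex k, IsFlippableEdge x j s(A, B) ∧ 0 ∉ A.1 ∧ 0 ∈ B.1 ∧
      ∀ (q : ℕ) (hq : q < 2 * k),
        ((⟨q + 1, by omega⟩ : Fin (2 * k + 1)) ∈ A.1 ↔
          q ≠ m ∧ flipBit x.1.toList 0 m q = true) ∧
        ((⟨q + 1, by omega⟩ : Fin (2 * k + 1)) ∈ B.1 ↔
          q ≠ m ∧ flipBit x.1.toList 0 m q = false) := by
  have hp := pval_mem x (q := m) (by omega)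
  -- Line `t` keeps the entry of `p`-value `2k - t`; this is the line that keeps the entry `m`.
  let t : Fin (2 * k + 1) := ⟨2 * k - pval x m, by omega⟩
  have ht : t.val < 2 * k := by simp only [t]; omega
  have hs : (star x t).val = m + 1 := by
    rw [star, dif_pos ht]
    simp only [t]
    rw [show 2 * k - (2 * k - pval x m) = pval x m by omega, perm_pval x (by omega)]
  have hflip : IsFlippableEdge x j (lineEdge x t) := (isFlippableEdge_iff x j _).2 ⟨t, rfl, by omega⟩
  have h0 : ((0 : Fin (2 * k + 1)) ∈ (vtx x t).1 ↔ t.val % 2 = 1) := by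
    rw [vtx, mem_line x _ (by omega)]; simp [lineBit]
  have h0' : ((0 : Fin (2 * k + 1)) ∈ (vtx x (t + 1)).1 ↔ t.val % 2 = 0) := by
    rw [mem_line_succ, h0, Ne, Fin.ext_iff, hs]; simp
  have hb : ∀ (q : ℕ) (hq : q < 2 * k), (⟨q + 1, by omega⟩ : Fin (2 * k + 1)) ∈ (vtx x t).1 ↔
      (flipBit x.1.toList 0 m q ^^ decide (t.val % 2 = 1)) = true := by
    intro q hq
    rw [vtx, mem_line x _ (by omega), flipBit, isFlipped_eq x (by omega) hq, lineBit]
    simp only [t, show 2 * k - (2 * k - pval x m) = pval x m by omega]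
    simp
  have hm' : (⟨m + 1, by omega⟩ : Fin (2 * k + 1)) ∉ (vtx x t).1 := by
    have := star_notMem x t
    rwa [show star x t = ⟨m + 1, by omega⟩ from Fin.ext hs] at this
  have hbs : ∀ (q : ℕ) (hq : q < 2 * k), (⟨q + 1, by omega⟩ : Fin (2 * k + 1)) ∈ (vtx x (t + 1)).1 ↔
      (flipBit x.1.toList 0 m q ^^ decide (t.val % 2 = 1)) = false ∧ q ≠ m := by
    intro q hq
    rw [mem_line_succ, hb q hq, Ne, Fin.ext_iff, hs]
    simp
  -- The even one of the lines `t`, `t + 1` has the bit `0` at coordinate `0` and is taken as `A`.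
  -- Here `t < 2k`, so the edge is not the closing one.
  rcases Nat.mod_two_eq_zero_or_one t.val with h | h
  · refine ⟨vtx x t, vtx x (t + 1), hflip, by rw [h0]; omega, h0'.2 h, fun q hq => ⟨?_, ?_⟩⟩
    · by_cases hqm : q = m
      · subst hqm; simpa using hm'
      · rw [hb q hq, h]; simp [hqm]
    · rw [hbs q hq, h]; simp; tauto
  · refine ⟨vtx x (t + 1), vtx x t, by rw [Sym2.eq_swap]; exact hflip, by rw [h0']; omega, h0.2 h,
      fun q hq => ⟨?_, ?_⟩⟩
    · rw [hbs q hq, h]; simp; tauto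
    · by_cases hqm : q = m
      · subst hqm; simpa using hm'
      · rw [hb q hq, h]; simp [hqm]

end Lowest

/-! ### Joining flippable edges to flipping cycles -/

section FlippingCycle

variable {k : ℕ}

/-- The ends `A`, `B` of the flippable edge of the marked word `p`; the bit `0` of `A` is zero. -/
structure IsFlipEdge (p : Dyck k × ℕ) (A B : OddVertex k) : Prop where
  flip : IsFlippableEdge p.1 p.2 s(A, B)
  zero_left : 0 ∉ A.1
  zero_right : 0 ∈ B.1

theorem IsFlipEdge.cls_left {p : Dyck k × ℕ} {A B : OddVertex k} (h : IsFlipEdge p A B) :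
    cls A = p.1 := cls_of_mem_flippable h.flip (Sym2.mem_mk_left _ _)

theorem IsFlipEdge.cls_right {p : Dyck k × ℕ} {A B : OddVertex k} (h : IsFlipEdge p A B) :
    cls B = p.1 := cls_of_mem_flippable h.flip (Sym2.mem_mk_right _ _)

theorem isFlippingCycle_of {g : MarkedTuple k}
    (hg : (g : Set (Dyck k × ℕ)).Pairwise fun p q => p.1 ≠ q.1 ∧ p.2 ≠ q.2) (hcard : 2 < g.card)
    {A B : Dyck k × ℕ → OddVertex k} (h : ∀ p ∈ g, IsFlipEdge p (A p) (B p)) {a : OddVertex k}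
    {c : (oddGraph k).Walk a a} (hc : c.IsCycle) (hlen : c.length = 2 * g.card)
    (hmem : ∀ p ∈ g, s(A p, B p) ∈ c.edges) : ∃ E, IsFlippingCycle g E := by
  refine ⟨c.edgeSet, hcard, hg, a, c, hc, hlen, rfl, fun p => s(A p, B p),
    fun p hp => ⟨(h p hp).flip, hmem p hp⟩, fun p hp q hq hpq b hb hb' => ?_⟩
  exact (hg hp hq hpq).1 ((cls_of_mem_flippable (h p hp).flip hb).symm.trans
    (cls_of_mem_flippable (h q hq).flip hb'))

theorem isFlippingCycle_three (hk : 1 ≤ k) {p q r : Dyck k × ℕ} (hcard : ({p, q,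
    r} : MarkedTuple k).card = 3)
    (hg : (({p, q, r} : MarkedTuple k) : Set (Dyck k × ℕ)).Pairwise fun x y => x.1 ≠ y.1 ∧ x.2 ≠ y.2)
    {A B : Dyck k × ℕ → OddVertex k}
    (h : ∀ t ∈ ({p, q, r} : MarkedTuple k), IsFlipEdge t (A t) (B t))
    (h1 : (oddGraph k).Adj (B p) (A q))
    (h2 : (oddGraph k).Adj (B q) (A r))
    (h3 : (oddGraph k).Adj (B r) (A p)) :
    ∃ E, IsFlippingCycle {p, q, r} E := by
  have hp := h p (by simp)
  have ap := twoFactor_adj hk (flippable_mem_twoFactor hp.flip)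
  have hq := h q (by simp)
  have aq := twoFactor_adj hk (flippable_mem_twoFactor hq.flip)
  have hr := h r (by simp)
  have ar := twoFactor_adj hk (flippable_mem_twoFactor hr.flip)
  have hne : p ≠ q ∧ p ≠ r ∧ q ≠ r := by
    refine ⟨?_, ?_, ?_⟩ <;> rintro rfl <;> simp at hcard <;>
      exact absurd hcard (Finset.card_le_two.trans_lt (by omega)).ne
  obtain ⟨epq, epr, eqr⟩ := hne
  have dpq := (hg (by simp) (by simp) epq).1
  have dpr := (hg (by simp) (by simp) epr).1
  have dqr := (hg (by simp) (by simp) eqr).1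
  -- The list containing a vertex, together with its bit at coordinate `0`, tells the six vertices
  -- apart.
  have hnd : [B p, A q, B q, A r, B r, A p].Nodup := by
    apply List.Nodup.of_map (fun v => (cls v, decide (0 ∈ v.1)))
    simp [hp.cls_left, hp.cls_right, hp.zero_left, hp.zero_right, hq.cls_left, hq.cls_right,
      hq.zero_left, hq.zero_right, hr.cls_left, hr.cls_right, hr.zero_left, hr.zero_right, dpq,
      dpq.symm, dpr, dpr.symm, dqr]
  refine isFlippingCycle_of (A := A) (B := B) hg (by omega) h
    (c := (.cons ap (.cons h1 (.cons aq (.cons h2 (.cons ar (.cons h3 .nil))))))) ?_ ?_ ?_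
  · rw [SimpleGraph.Walk.cons_isCycle_iff, SimpleGraph.Walk.isPath_def]
    refine ⟨hnd, ?_⟩
    simp only [List.nodup_cons, List.mem_cons, List.not_mem_nil, or_false, not_or] at hnd
    simp only [SimpleGraph.Walk.edges_cons, SimpleGraph.Walk.edges_nil, List.mem_cons,
      List.not_mem_nil, or_false, Sym2.eq_iff, not_or]
    grind
  · rw [hcard]; rfl
  · simp

theorem isFlippingCycle_four (hk : 1 ≤ k) {p q r s : Dyck k × ℕ} (hcard : ({p, q, r,
    s} : MarkedTuple k).card = 4)
    (hg : (({p, q, r, s} : MarkedTuple k) : Set (Dyck k × ℕ)).Pairwise fun x y => x.1 ≠ y.1 ∧ x.2 ≠ y.2)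
    {A B : Dyck k × ℕ → OddVertex k}
    (h : ∀ t ∈ ({p, q, r, s} : MarkedTuple k), IsFlipEdge t (A t) (B t))
    (h1 : (oddGraph k).Adj (B p) (A q))
    (h2 : (oddGraph k).Adj (B q) (A r))
    (h3 : (oddGraph k).Adj (B r) (A s))
    (h4 : (oddGraph k).Adj (B s) (A p)) :
    ∃ E, IsFlippingCycle {p, q, r, s} E := by
  have hp := h p (by simp)
  have ap := twoFactor_adj hk (flippable_mem_twoFactor hp.flip)
  have hq := h q (by simp)
  have aq := twoFactor_adj hk (flippable_mem_twoFactor hq.flip)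
  have hr := h r (by simp)
  have ar := twoFactor_adj hk (flippable_mem_twoFactor hr.flip)
  have hs := h s (by simp)
  have as := twoFactor_adj hk (flippable_mem_twoFactor hs.flip)
  have hne : p ≠ q ∧ p ≠ r ∧ p ≠ s ∧ q ≠ r ∧ q ≠ s ∧ r ≠ s := by
    refine ⟨?_, ?_, ?_, ?_, ?_, ?_⟩ <;> rintro rfl <;> simp at hcard <;>
      exact absurd hcard (Finset.card_le_three.trans_lt (by omega)).ne
  obtain ⟨epq, epr, eps, eqr, eqs, ers⟩ := hne
  have dpq := (hg (by simp) (by simp) epq).1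
  have dpr := (hg (by simp) (by simp) epr).1
  have dps := (hg (by simp) (by simp) eps).1
  have dqr := (hg (by simp) (by simp) eqr).1
  have dqs := (hg (by simp) (by simp) eqs).1
  have drs := (hg (by simp) (by simp) ers).1
  have hnd : [B p, A q, B q, A r, B r, A s, B s, A p].Nodup := by
    apply List.Nodup.of_map (fun v => (cls v, decide (0 ∈ v.1)))
    simp [hp.cls_left, hp.cls_right, hp.zero_left, hp.zero_right, hq.cls_left, hq.cls_right,
      hq.zero_left, hq.zero_right, hr.cls_left, hr.cls_right, hr.zero_left, hr.zero_right,
      hs.cls_left, hs.cls_right, hs.zero_left, hs.zero_right, dpq, dpq.symm, dpr, dpr.symm, dps,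
      dps.symm, dqr, dqs, drs]
  refine isFlippingCycle_of (A := A) (B := B) hg (by omega) h
    (c := (.cons ap (.cons h1 (.cons aq (.cons h2 (.cons ar (.cons h3 (.cons as (.cons h4 .nil))))))))) ?_ ?_ ?_
  · rw [SimpleGraph.Walk.cons_isCycle_iff, SimpleGraph.Walk.isPath_def]
    refine ⟨hnd, ?_⟩
    simp only [List.nodup_cons, List.mem_cons, List.not_mem_nil, or_false, not_or] at hnd
    simp only [SimpleGraph.Walk.edges_cons, SimpleGraph.Walk.edges_nil, List.mem_cons,
      List.not_mem_nil, or_false, Sym2.eq_iff, not_or]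
    grind
  · rw [hcard]; rfl
  · simp

instance (m : MarkedWord) : Decidable (WellShaped m) :=
  inferInstanceAs (Decidable (_ ∧ _ ∧ _))

instance (b : ℤ) (m n : MarkedWord) : Decidable (Precedes b m n) :=
  inferInstanceAs (Decidable (∀ _ < _, _))

/-- The words of `τ` agree in length and in final height, are well-shaped, and have
different entries and marks. -/
def IsTemplate (τ : List MarkedWord) : Prop :=
  (∀ m ∈ τ, WellShaped m) ∧
  (∀ m ∈ τ, ∀ n ∈ τ, m.1.length = n.1.length ∧ height m.1 m.1.length = height n.1 n.1.length) ∧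
  ∀ m ∈ τ, ∀ n ∈ τ, m ≠ n → m.1 ≠ n.1 ∧ m.2 ≠ n.2

instance (τ : List MarkedWord) : Decidable (IsTemplate τ) :=
  inferInstanceAs (Decidable (_ ∧ _ ∧ _))

theorem isTemplate_of_mem : ∀ τ ∈ templates, IsTemplate τ := by decide

theorem Placed.pairwise {g : MarkedTuple k} {τ : List MarkedWord} {u v : List DyckStep}
    (h : Placed g τ u v) (hτ : IsTemplate τ) :
    (g : Set (Dyck k × ℕ)).Pairwise fun p q => p.1 ≠ q.1 ∧ p.2 ≠ q.2 := by
  intro p hp q hq hpq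
  obtain ⟨m, hm, hpm⟩ := h.of_mem p hp
  obtain ⟨n, hn, hqn⟩ := h.of_mem q hq
  have hmn : m ≠ n := by rintro rfl; exact hpq (hpm.eq hqn)
  have := hτ.2.2 m hm n hn hmn
  exact ⟨hpm.fst_ne hqn this.1, hpm.snd_ne hqn this.2⟩

theorem exists_flipEdges {g : MarkedTuple k} {τ : List MarkedWord} {u v : List DyckStep}
    (h : Placed g τ u v) (hτ : IsTemplate τ) : ∃ A B : Dyck k × ℕ → OddVertex k,
      (∀ p ∈ g, IsFlipEdge p (A p) (B p)) ∧ ∀ p ∈ g, ∀ q ∈ g, ∀ m ∈ τ, ∀ n ∈ τ,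
        PlacedAt u v p m → PlacedAt u v q n → Precedes (height u u.length % 2) m n →
          (oddGraph k).Adj (B p) (A q) := by
  have key : ∀ p : Dyck k × ℕ, ∃ A B : OddVertex k, p ∈ g → IsFlipEdge p A B ∧
      ∀ (q : ℕ) (hq : q < 2 * k),
        ((⟨q + 1, by omega⟩ : Fin (2 * k + 1)) ∈ A.1 ↔
          q ≠ 2 * k - 1 - p.2 ∧ flipBit p.1.1.toList 0 (2 * k - 1 - p.2) q = true) ∧
        ((⟨q + 1, by omega⟩ : Fin (2 * k + 1)) ∈ B.1 ↔
          q ≠ 2 * k - 1 - p.2 ∧ flipBit p.1.1.toList 0 (2 * k - 1 - p.2) q = false) := by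
    intro p
    by_cases hp : p ∈ g
    · obtain ⟨m, hm, hpm⟩ := h.of_mem p hp
      have := hpm.2
      obtain ⟨A, B, h1, h2, h3, h4⟩ :=
        exists_flippableEdge p.1 (m := 2 * k - 1 - p.2) (j := p.2) (by omega)
      exact ⟨A, B, fun _ => ⟨⟨h1, h2, h3⟩, h4⟩⟩
    · exact ⟨vtx p.1 0, vtx p.1 0, fun h => absurd h hp⟩
  choose A B hAB using key
  refine ⟨A, B, fun p hp => (hAB p hp).1, fun p hp q hq m hm n hn hpm hqn hprec => ?_⟩
  obtain ⟨h1, h2⟩ := hAB p hp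
  obtain ⟨h3, h4⟩ := hAB q hq
  refine ⟨fun e => h3.zero_left (e ▸ h1.zero_right), Finset.disjoint_left.2 fun i hi hi' => ?_⟩
  obtain ⟨i, hi0⟩ := i
  rcases i with - | i
  · exact h3.zero_left hi'
  · have hp2 := hpm.2
    have hq2 := hqn.2
    have e1 : 2 * k - 1 - p.2 = u.length + m.2 := by omega
    have e2 : 2 * k - 1 - q.2 = u.length + n.2 := by omega
    obtain ⟨hne, hf⟩ := (h2 i (by omega)).2.1 hi
    obtain ⟨hne', hf'⟩ := (h4 i (by omega)).1.1 hi'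
    rw [e1] at hne hf
    rw [e2] at hne' hf'
    rw [hpm.1] at hf
    rw [hqn.1] at hf'
    have hmn := hτ.2.1 m hm n hn
    rw [hprec.extend (hτ.1 m hm) (hτ.1 n hn) hmn.1 hmn.2 hne hne' hf'] at hf
    simp at hf

/-- The prefix enters only through the parity `i` of its height. Both cyclic orders are allowed
because the direction in which the edges can be joined may depend on this parity. -/
theorem Placed.exists_cycle_three (hk : 1 ≤ k) {g : MarkedTuple k} {a b c : MarkedWord}
    {u v : List DyckStep} (h : Placed g [a, b, c] u v) (hτ : IsTemplate [a, b, c])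
    (hnd : [a, b, c].Nodup) (hprec : ∀ i ∈ ([0, 1] : List ℤ),
      (Precedes i a b ∧ Precedes i b c ∧ Precedes i c a) ∨
      (Precedes i a c ∧ Precedes i c b ∧ Precedes i b a)) : ∃ E, IsFlippingCycle g E := by
  obtain ⟨p, hp, hpa⟩ := h.exists_mem a (by simp)
  obtain ⟨q, hq, hqb⟩ := h.exists_mem b (by simp)
  obtain ⟨r, hr, hrc⟩ := h.exists_mem c (by simp)
  have hg : g = {p, q, r} := by
    ext s
    simp only [Finset.mem_insert, Finset.mem_singleton]
    constructor
    · intro hs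
      obtain ⟨m, hm, hsm⟩ := h.of_mem s hs
      simp only [List.mem_cons, List.not_mem_nil, or_false] at hm
      rcases hm with rfl | rfl | rfl
      · exact Or.inl (hsm.eq hpa)
      · exact Or.inr (Or.inl (hsm.eq hqb))
      · exact Or.inr (Or.inr (hsm.eq hrc))
    · rintro (rfl | rfl | rfl) <;> assumption
  simp only [List.nodup_cons, List.mem_cons, List.not_mem_nil, or_false, not_or] at hnd
  have hne : ∀ {p q m n}, PlacedAt u v p m → PlacedAt u v q n → m ∈ [a, b, c] → n ∈ [a, b, c] →
      m ≠ n → (p : Dyck k × ℕ) ≠ q := fun h1 h2 hm hn hmn e =>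
    h1.fst_ne h2 (hτ.2.2 _ hm _ hn hmn).1 (by rw [e])
  have e1 : p ≠ q := hne hpa hqb (by simp) (by simp) hnd.1.1
  have e2 : p ≠ r := hne hpa hrc (by simp) (by simp) hnd.1.2
  have e3 : q ≠ r := hne hqb hrc (by simp) (by simp) hnd.2.1
  obtain ⟨A, B, hAB, hadj⟩ := exists_flipEdges h hτ
  have hpw := h.pairwise hτ
  have hi : height u u.length % 2 ∈ ([0, 1] : List ℤ) := by
    rcases Int.emod_two_eq_zero_or_one (height u u.length) with h | h <;> simp [h]
  rcases hprec _ hi with ⟨h1, h2, h3⟩ | ⟨h1, h2, h3⟩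
  · have hc : ({p, q, r} : MarkedTuple k).card = 3 := Finset.card_eq_three.2 ⟨p, q, r, e1, e2, e3, rfl⟩
    rw [hg] at hpw hAB ⊢
    exact isFlippingCycle_three (A := A) (B := B) hk hc hpw hAB
      (hadj p hp q hq a (by simp) b (by simp) hpa hqb h1)
      (hadj q hq r hr b (by simp) c (by simp) hqb hrc h2)
      (hadj r hr p hp c (by simp) a (by simp) hrc hpa h3)
  · have hc : ({p, r, q} : MarkedTuple k).card = 3 :=
      Finset.card_eq_three.2 ⟨p, r, q, e2, e1, e3.symm, rfl⟩
    have hg' : g = {p, r, q} := by rw [hg, Finset.pair_comm]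
    rw [hg'] at hpw hAB ⊢
    exact isFlippingCycle_three (A := A) (B := B) hk hc hpw hAB
      (hadj p hp r hr a (by simp) c (by simp) hpa hrc h1)
      (hadj r hr q hq c (by simp) b (by simp) hrc hqb h2)
      (hadj q hq p hp b (by simp) a (by simp) hqb hpa h3)

theorem Placed.exists_cycle_four (hk : 1 ≤ k) {g : MarkedTuple k} {a b c d : MarkedWord}
    {u v : List DyckStep} (h : Placed g [a, b, c, d] u v) (hτ : IsTemplate [a, b, c, d])
    (hnd : [a, b, c, d].Nodup) (hprec : ∀ i ∈ ([0, 1] : List ℤ),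
      (Precedes i a b ∧ Precedes i b c ∧ Precedes i c d ∧ Precedes i d a) ∨
      (Precedes i a d ∧ Precedes i d c ∧ Precedes i c b ∧ Precedes i b a)) :
    ∃ E, IsFlippingCycle g E := by
  obtain ⟨p, hp, hpa⟩ := h.exists_mem a (by simp)
  obtain ⟨q, hq, hqb⟩ := h.exists_mem b (by simp)
  obtain ⟨r, hr, hrc⟩ := h.exists_mem c (by simp)
  obtain ⟨s, hs, hsd⟩ := h.exists_mem d (by simp)
  have hg : g = {p, q, r, s} := by
    ext t
    simp only [Finset.mem_insert, Finset.mem_singleton]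
    constructor
    · intro ht
      obtain ⟨m, hm, htm⟩ := h.of_mem t ht
      simp only [List.mem_cons, List.not_mem_nil, or_false] at hm
      rcases hm with rfl | rfl | rfl | rfl
      · exact Or.inl (htm.eq hpa)
      · exact Or.inr (Or.inl (htm.eq hqb))
      · exact Or.inr (Or.inr (Or.inl (htm.eq hrc)))
      · exact Or.inr (Or.inr (Or.inr (htm.eq hsd)))
    · rintro (rfl | rfl | rfl | rfl) <;> assumption
  simp only [List.nodup_cons, List.mem_cons, List.not_mem_nil, or_false, not_or] at hnd
  have hne : ∀ {p q m n}, PlacedAt u v p m → PlacedAt u v q n → m ∈ [a, b, c, d] →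
      n ∈ [a, b, c, d] → m ≠ n → (p : Dyck k × ℕ) ≠ q := fun h1 h2 hm hn hmn e =>
    h1.fst_ne h2 (hτ.2.2 _ hm _ hn hmn).1 (by rw [e])
  have e1 : p ≠ q := hne hpa hqb (by simp) (by simp) hnd.1.1
  have e2 : p ≠ r := hne hpa hrc (by simp) (by simp) hnd.1.2.1
  have e3 : p ≠ s := hne hpa hsd (by simp) (by simp) hnd.1.2.2
  have e4 : q ≠ r := hne hqb hrc (by simp) (by simp) hnd.2.1.1
  have e5 : q ≠ s := hne hqb hsd (by simp) (by simp) hnd.2.1.2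
  have e6 : r ≠ s := hne hrc hsd (by simp) (by simp) hnd.2.2.1
  obtain ⟨A, B, hAB, hadj⟩ := exists_flipEdges h hτ
  have hpw := h.pairwise hτ
  have hi : height u u.length % 2 ∈ ([0, 1] : List ℤ) := by
    rcases Int.emod_two_eq_zero_or_one (height u u.length) with h | h <;> simp [h]
  rcases hprec _ hi with ⟨h1, h2, h3, h4⟩ | ⟨h1, h2, h3, h4⟩
  · have hc : ({p, q, r, s} : MarkedTuple k).card = 4 := by
      rw [Finset.card_insert_of_notMem (by simp [e1, e2, e3]), Finset.card_eq_three.2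
        ⟨q, r, s, e4, e5, e6, rfl⟩]
    rw [hg] at hpw hAB ⊢
    exact isFlippingCycle_four (A := A) (B := B) hk hc hpw hAB
      (hadj p hp q hq a (by simp) b (by simp) hpa hqb h1)
      (hadj q hq r hr b (by simp) c (by simp) hqb hrc h2)
      (hadj r hr s hs c (by simp) d (by simp) hrc hsd h3)
      (hadj s hs p hp d (by simp) a (by simp) hsd hpa h4)
  · have hc : ({p, s, r, q} : MarkedTuple k).card = 4 := by
      rw [Finset.card_insert_of_notMem (by simp [e1, e2, e3]), Finset.card_eq_three.2
        ⟨s, r, q, e6.symm, e5.symm, e4.symm, rfl⟩]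
    have hg' : g = {p, s, r, q} := by
      rw [hg]; ext t; simp only [Finset.mem_insert, Finset.mem_singleton]; tauto
    rw [hg'] at hpw hAB ⊢
    exact isFlippingCycle_four (A := A) (B := B) hk hc hpw hAB
      (hadj p hp s hs a (by simp) d (by simp) hpa hsd h1)
      (hadj s hs r hr d (by simp) c (by simp) hsd hrc h2)
      (hadj r hr q hq c (by simp) b (by simp) hrc hqb h3)
      (hadj q hq p hp b (by simp) a (by simp) hqb hpa h4)

theorem exists_isFlippingCycle (hk : 1 ≤ k) {g : MarkedTuple k} (h : IsHyperedge k g) :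
    ∃ E, IsFlippingCycle g E := by
  obtain ⟨τ, hτ, u, v, h⟩ := exists_placed h
  have ht := isTemplate_of_mem τ hτ
  simp only [templates, List.mem_cons, List.not_mem_nil, or_false] at hτ
  rcases hτ with rfl | rfl | rfl | rfl | rfl | rfl | rfl | rfl
  · exact h.exists_cycle_three hk ht (by decide) (by decide)
  · exact h.exists_cycle_three hk ht (by decide) (by decide)
  · exact h.exists_cycle_three hk ht (by decide) (by decide)
  · exact h.exists_cycle_three hk ht (by decide) (by decide)
  · exact h.exists_cycle_three hk ht (by decide) (by decide)
  · exact h.exists_cycle_three hk ht (by decide) (by decide)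
  · exact h.exists_cycle_four hk ht (by decide) (by decide)
  · exact h.exists_cycle_four hk ht (by decide) (by decide)

open Classical in
theorem exists_yields (hk : 1 ≤ k) {T : Finset (MarkedTuple k)} (hT : IsSpanningTree k T) :
    ∃ H, Yields T H := by
  have : ∀ g : MarkedTuple k, ∃ E, g ∈ T → IsFlippingCycle g E := fun g => by
    by_cases hg : g ∈ T
    · obtain ⟨E, hE⟩ := exists_isFlippingCycle hk (hT.hyperedge g hg)
      exact ⟨E, fun _ => hE⟩
    · exact ⟨∅, fun h => absurd h hg⟩
  choose C hC using this
  exact ⟨_, C, hC, rfl⟩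

end FlippingCycle

/-! ### Hyperedges with common lists -/

section Windows

/-- The positions at which two words of the same length differ. -/
def diffPos : List DyckStep → List DyckStep → List ℕ
  | a :: l, b :: l' => (if a = b then [] else [0]) ++ (diffPos l l').map (1 + ·)
  | _, _ => []

theorem diffPos_self (l : List DyckStep) : diffPos l l = [] := by
  induction l with
  | nil => rfl
  | cons a l ih => simp [diffPos, ih]

theorem diffPos_append_left (u l l' : List DyckStep) :
    diffPos (u ++ l) (u ++ l') = (diffPos l l').map (u.length + ·) := by
  induction u with
  | nil => simp
  | cons a u ih =>
    simp only [List.cons_append, diffPos, ih, if_true, List.nil_append, List.map_map,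
      List.length_cons]
    congr 1
    funext i
    simp only [Function.comp]
    omega

theorem diffPos_append_right (l l' v : List DyckStep) (h : l.length = l'.length) :
    diffPos (l ++ v) (l' ++ v) = diffPos l l' := by
  induction l generalizing l' with
  | nil =>
    obtain rfl : l' = [] := List.length_eq_zero_iff.1 (by simpa using h.symm)
    simp [diffPos_self, diffPos]
  | cons a l ih =>
    cases l' with
    | nil => simp at h
    | cons b l' => simp only [List.cons_append, diffPos, ih l' (by simpa using h)]

/-- With only two letters, the places of difference from `l` determine the other word. Comparing
neighbours of a word thus becomes comparing lists of positions, which translate well. -/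
theorem eq_of_diffPos_eq (l l' l'' : List DyckStep) (h1 : l.length = l'.length)
    (h2 : l.length = l''.length) (h : diffPos l l' = diffPos l l'') : l' = l'' := by
  induction l generalizing l' l'' with
  | nil =>
    rw [List.length_eq_zero_iff.1 (by simpa using h1.symm : l'.length = 0),
      List.length_eq_zero_iff.1 (by simpa using h2.symm : l''.length = 0)]
  | cons a l ih =>
    cases l' with
    | nil => simp at h1
    | cons b l' =>
      cases l'' with
      | nil => simp at h2
      | cons c l'' =>
        have hmem : ∀ L : List ℕ, 0 ∉ L.map (1 + ·) := fun L => by simp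
        have hinj : ∀ {L L' : List ℕ}, L.map (1 + ·) = L'.map (1 + ·) → L = L' := fun hL =>
          List.map_injective_iff.2 (add_right_injective 1) hL
        simp only [diffPos] at h
        have hbc : b = c ∧ diffPos l l' = diffPos l l'' := by
          by_cases hb : a = b <;> by_cases hc : a = c
          · subst hb; subst hc; simpa using hinj (by simpa using h)
          · rw [if_pos hb, if_neg hc] at h
            have : 0 ∈ (diffPos l l').map (1 + ·) := by
              rw [show (diffPos l l').map (1 + ·) = _ from h]; simp
            exact absurd this (hmem _)
          · rw [if_neg hb, if_pos hc] at h
            have : 0 ∈ (diffPos l l'').map (1 + ·) := by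
              rw [← show _ = (diffPos l l'').map (1 + ·) from h]; simp
            exact absurd this (hmem _)
          · rw [if_neg hb, if_neg hc] at h
            refine ⟨?_, hinj (by simpa using h)⟩
            cases a <;> cases b <;> cases c <;>
              first | rfl | exact absurd rfl hb | exact absurd rfl hc
        rw [hbc.1, ih l' l'' (by simpa using h1) (by simpa using h2) hbc.2]

theorem lt_of_mem_diffPos (l l' : List DyckStep) : ∀ i ∈ diffPos l l', i < l.length := by
  induction l generalizing l' with
  | nil => simp [diffPos]
  | cons a l ih =>
    cases l' with
    | nil => simp [diffPos]
    | cons b l' =>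
      intro i hi
      simp only [diffPos, List.mem_append, List.mem_map] at hi
      rcases hi with hi | ⟨j, hj, rfl⟩
      · split_ifs at hi
        · simp at hi
        · simp at hi; simp [hi]
      · have := ih l' j hj
        simp; omega

theorem map_add_eq {L L' : List ℕ} {a b c d : ℕ} (h : L.map (a + ·) = L'.map (b + ·))
    (hc : a + d = b + c) : L.map (c + ·) = L'.map (d + ·) := by
  apply List.map_injective_iff.2 (add_right_injective a)
  have h1 : (L.map (c + ·)).map (a + ·) = (L.map (a + ·)).map (c + ·) := by
    simp only [List.map_map]; congr 1; funext i; simp only [Function.comp]; omega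
  have h2 : (L'.map (d + ·)).map (a + ·) = (L'.map (b + ·)).map (c + ·) := by
    simp only [List.map_map]; congr 1; funext i; simp only [Function.comp]; omega
  exact h1.trans ((congrArg _ h).trans h2.symm)

/-- The words `l` and `l'` agree when they start at the positions `a` and `b`. -/
def agree (l l' : List DyckStep) (a b : ℕ) : Bool :=
  (List.range l.length).all fun i => (List.range l'.length).all fun j =>
    a + i != b + j || l[i]? == l'[j]?

/-- Two templates, started at `a` and `b`, such that replacing `m` in one, or `m'` in the other,
can lead to the same word. -/
def commonWord (τ : List MarkedWord) (m : MarkedWord) (σ : List MarkedWord) (m' : MarkedWord)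
    (a b : ℕ) : Bool :=
  τ.any fun n => σ.any fun n' => n != m &&
    (diffPos m.1 n.1).map (a + ·) == (diffPos m'.1 n'.1).map (b + ·)

/-- The pairs of different words `m`, `n` of a template `τ`, with the positions where they differ. -/
def wordPairs : List (List MarkedWord × MarkedWord × List ℕ) :=
  templates.flatMap fun τ => τ.flatMap fun m => τ.filterMap fun n =>
    if diffPos m.1 n.1 = [] then none else some (τ, m, diffPos m.1 n.1)

/-- The pairs of hyperedges, up to translation, that have two common words `x`, `y`, different
marks in `x`, and a common mark; their windows start at `20` and at the last component, which is
determined by the first position at which `x` and `y` differ. -/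
def sharingPairs : List (List MarkedWord × MarkedWord × List MarkedWord × MarkedWord × ℕ) :=
  wordPairs.flatMap fun p => wordPairs.filterMap fun q =>
    if p.2.2.map (q.2.2.headD 0 + ·) = q.2.2.map (p.2.2.headD 0 + ·) then
      if 20 + p.2.1.2 != 20 + p.2.2.headD 0 - q.2.2.headD 0 + q.2.1.2 &&
        (agree p.2.1.1 q.2.1.1 20 (20 + p.2.2.headD 0 - q.2.2.headD 0) &&
          p.1.any fun r => q.1.any fun r' => 20 + r.2 == 20 + p.2.2.headD 0 - q.2.2.headD 0 + r'.2)
      then some (p.1, p.2.1, q.1, q.2.1, 20 + p.2.2.headD 0 - q.2.2.headD 0) else none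
    else none

/-- The finite check behind `sharing_contradiction`. -/
def sharingCheck (L : List (List MarkedWord × MarkedWord × List MarkedWord × MarkedWord × ℕ)) :
    Bool :=
  L.all fun c => L.all fun d =>
    c.2.2.2.2 + c.2.2.2.1.2 != 20 + c.2.1.2 - d.2.1.2 + d.2.2.2.2 - 20 + d.2.2.2.1.2 ||
    (!agree c.2.1.1 d.2.1.1 20 (20 + c.2.1.2 - d.2.1.2) ||
    (commonWord c.1 c.2.1 d.2.2.1 d.2.2.2.1 20 (20 + c.2.1.2 - d.2.1.2 + d.2.2.2.2 - 20) ||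
    commonWord c.2.2.1 c.2.2.2.1 d.1 d.2.1 c.2.2.2.2 (20 + c.2.1.2 - d.2.1.2)))

/-- The check is finite because the relative position of two windows is fixed by a common mark or by
the first place where two common words differ. Starting at `20` keeps the subtractions exact, as the
template words have length at most `8`. -/
theorem sharingCheck_sharingPairs : sharingCheck sharingPairs = true := by decide +kernel

variable {k : ℕ}

theorem PlacedAt.diffPos {u v : List DyckStep} {p q : Dyck k × ℕ} {m n : MarkedWord}
    (h : PlacedAt u v p m) (h' : PlacedAt u v q n) (hlen : m.1.length = n.1.length) :
    diffPos p.1.1.toList q.1.1.toList = (diffPos m.1 n.1).map (u.length + ·) := by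
  rw [h.1, h'.1, List.append_assoc, List.append_assoc, diffPos_append_left,
    diffPos_append_right _ _ _ hlen]

theorem PlacedAt.getElem? {u v : List DyckStep} {p : Dyck k × ℕ} {m : MarkedWord}
    (h : PlacedAt u v p m) {i : ℕ} (hi : i < m.1.length) :
    p.1.1.toList[u.length + i]? = m.1[i]? := by
  rw [h.1, List.append_assoc, List.getElem?_append_right (by omega), Nat.add_sub_cancel_left,
    List.getElem?_append_left hi]

theorem PlacedAt.agree {u v u' v' : List DyckStep} {p p' : Dyck k × ℕ} {m m' : MarkedWord}
    (h : PlacedAt u v p m) (h' : PlacedAt u' v' p' m') (hx : p.1 = p'.1) {a b : ℕ}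
    (hab : u.length + b = u'.length + a) : agree m.1 m'.1 a b = true := by
  rw [OddHam.agree, List.all_eq_true]
  intro i hi
  rw [List.all_eq_true]
  intro j hj
  rw [List.mem_range] at hi hj
  by_cases hij : a + i = b + j
  · have h1 := h.getElem? hi
    have h2 := h'.getElem? hj
    rw [hx, show u.length + i = u'.length + j by omega, h2] at h1
    simp [h1]
  · simp [hij]

/-- Both hyperedges change the same word `p.1` at the same places, so they contain the same second
word. -/
theorem exists_common_of_commonWord {g h : MarkedTuple k} {τ σ : List MarkedWord}
    {u v u' v' : List DyckStep} (hg : Placed g τ u v) (hτ : IsTemplate τ) (hh : Placed h σ u' v')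
    (hσ : IsTemplate σ) {p p' : Dyck k × ℕ} {m m' : MarkedWord} (hm : m ∈ τ) (hm' : m' ∈ σ)
    (hp : PlacedAt u v p m) (hp' : PlacedAt u' v' p' m') (hx : p.1 = p'.1) {a b : ℕ}
    (hab : u.length + b = u'.length + a) (hc : commonWord τ m σ m' a b = true) :
    ∃ y, y ≠ p.1 ∧ y ∈ verts g ∧ y ∈ verts h := by
  rw [commonWord, List.any_eq_true] at hc
  obtain ⟨n, hn, hc⟩ := hc
  rw [List.any_eq_true] at hc
  obtain ⟨n', hn', hc⟩ := hc
  rw [Bool.and_eq_true, bne_iff_ne, beq_iff_eq] at hc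
  obtain ⟨q, hq, hqn⟩ := hg.exists_mem n hn
  obtain ⟨q', hq', hqn'⟩ := hh.exists_mem n' hn'
  have h1 := hp.diffPos hqn (hτ.2.1 m hm n hn).1
  have h2 := hp'.diffPos hqn' (hσ.2.1 m' hm' n' hn').1
  rw [map_add_eq hc.2 (c := u.length) (d := u'.length) (by omega)] at h1
  rw [← h2, hx] at h1
  have h3 := eq_of_diffPos_eq _ _ _ (by rw [length_word, length_word])
    (by rw [length_word, length_word]) h1
  have h4 : q.1 = q'.1 := Subtype.ext (DyckWord.ext h3)
  exact ⟨q.1, hqn.fst_ne hp (hτ.2.2 n hn m hm hc.1).1, Finset.mem_image_of_mem _ hq,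
    h4 ▸ Finset.mem_image_of_mem _ hq'⟩

theorem templates_length_le : ∀ τ ∈ templates, ∀ m ∈ τ, m.1.length ≤ 8 := by decide

/-- `g` and `h` have two common words, one of them `x`, and a common mark; their
marks in `x` are `i` and `j`. -/
structure Sharing (g h : MarkedTuple k) (x : Dyck k) (i j : ℕ) : Prop where
  mem_left : (x, i) ∈ g
  mem_right : (x, j) ∈ h
  common : ∃ y, y ≠ x ∧ y ∈ verts g ∧ y ∈ verts h
  mark : ∃ p ∈ g, ∃ q ∈ h, p.2 = q.2

theorem Sharing.exists_pair {g h : MarkedTuple k} {x : Dyck k} {i j : ℕ} (hs : Sharing g h x i j)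
    (hij : i ≠ j) {τ σ : List MarkedWord} (hτ : τ ∈ templates) (hσ : σ ∈ templates)
    {u v u' v' : List DyckStep} (hg : Placed g τ u v) (hh : Placed h σ u' v') {m m' : MarkedWord}
    (hm : m ∈ τ) (hm' : m' ∈ σ) (hp : PlacedAt u v (x, i) m) (hp' : PlacedAt u' v' (x, j) m') :
    ∃ b, (τ, m, σ, m', b) ∈ sharingPairs ∧ u.length + b = u'.length + 20 ∧ 12 ≤ b := by
  obtain ⟨y, hyx, hyg, hyh⟩ := hs.common
  obtain ⟨q, hq, rfl⟩ := Finset.mem_image.1 hyg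
  obtain ⟨q', hq', hqq⟩ := Finset.mem_image.1 hyh
  obtain ⟨n, hn, hqn⟩ := hg.of_mem q hq
  obtain ⟨n', hn', hqn'⟩ := hh.of_mem q' hq'
  have hT := isTemplate_of_mem τ hτ
  have hS := isTemplate_of_mem σ hσ
  have hl := (hT.2.1 m hm n hn).1
  have hl' := (hS.2.1 m' hm' n' hn').1
  have h1 := hp.diffPos hqn hl
  have h2 := hp'.diffPos hqn' hl'
  rw [hqq] at h2
  have h3 : (diffPos m.1 n.1).map (u.length + ·) = (diffPos m'.1 n'.1).map (u'.length + ·) :=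
    h1.symm.trans h2
  have hne : diffPos m.1 n.1 ≠ [] := by
    intro h0
    have : diffPos m.1 n.1 = diffPos m.1 m.1 := by rw [h0, diffPos_self]
    have := eq_of_diffPos_eq _ _ _ hl rfl this
    exact hyx (Subtype.ext (DyckWord.ext (hqn.1.trans (by rw [this]; exact hp.1.symm))))
  have hne' : diffPos m'.1 n'.1 ≠ [] := by
    intro h0
    rw [h0, List.map_nil, List.map_eq_nil_iff] at h3
    exact hne h3
  obtain ⟨d, D, hD⟩ := List.exists_cons_of_ne_nil hne
  obtain ⟨d', D', hD'⟩ := List.exists_cons_of_ne_nil hne'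
  have hd' := lt_of_mem_diffPos m'.1 n'.1 d' (by rw [hD']; simp)
  have hlen := templates_length_le σ hσ m' hm'
  have hdd : u.length + d = u'.length + d' := by
    rw [hD, hD'] at h3
    simpa using (List.cons.inj h3).1
  -- The first difference of the two common words lies at offset `d` in one window and `d'` in the
  -- other, which fixes the relative position; `d' < 8` prevents truncation.
  have hb : u.length + (20 + d - d') = u'.length + 20 := by omega
  refine ⟨20 + d - d', ?_, hb, by omega⟩
  have hw1 : (τ, m, diffPos m.1 n.1) ∈ wordPairs := by
    simp only [wordPairs, List.mem_flatMap, List.mem_filterMap]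
    exact ⟨τ, hτ, m, hm, n, hn, by rw [if_neg hne]⟩
  have hw2 : (σ, m', diffPos m'.1 n'.1) ∈ wordPairs := by
    simp only [wordPairs, List.mem_flatMap, List.mem_filterMap]
    exact ⟨σ, hσ, m', hm', n', hn', by rw [if_neg hne']⟩
  rw [sharingPairs, List.mem_flatMap]
  refine ⟨_, hw1, ?_⟩
  rw [List.mem_filterMap]
  refine ⟨_, hw2, ?_⟩
  have e1 : (diffPos m.1 n.1).headD 0 = d := by rw [hD]; rfl
  have e2 : (diffPos m'.1 n'.1).headD 0 = d' := by rw [hD']; rfl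
  simp only [e1, e2]
  rw [if_pos (map_add_eq h3 (by omega)), if_pos]
  rw [Bool.and_eq_true, Bool.and_eq_true, bne_iff_ne, List.any_eq_true]
  have hp2 := hp.2
  have hp2' := hp'.2
  refine ⟨by simp only at hp2 hp2'; omega, hp.agree hp' rfl hb, ?_⟩
  obtain ⟨r, hr, r', hr', hrr⟩ := hs.mark
  obtain ⟨s, hs, hrs⟩ := hg.of_mem r hr
  obtain ⟨s', hs', hrs'⟩ := hh.of_mem r' hr'
  refine ⟨s, hs, ?_⟩
  rw [List.any_eq_true]
  refine ⟨s', hs', ?_⟩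
  have h5 := hrs.2
  have h6 := hrs'.2
  rw [beq_iff_eq]
  omega

theorem Sharing.exists_common {g g' h h' : MarkedTuple k} {x : Dyck k} {i j : ℕ}
    (hg : IsHyperedge k g) (hg' : IsHyperedge k g') (hh : IsHyperedge k h) (hh' : IsHyperedge k h')
    (hij : i ≠ j) (h₁ : Sharing g h' x i j) (h₂ : Sharing g' h x i j) :
    ∃ y, y ≠ x ∧ ((y ∈ verts g ∧ y ∈ verts h) ∨ (y ∈ verts g' ∧ y ∈ verts h')) := by
  obtain ⟨τ, hτ, u, v, pg⟩ := exists_placed hg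
  obtain ⟨σ', hσ', w', z', ph'⟩ := exists_placed hh'
  obtain ⟨τ', hτ', u', v', pg'⟩ := exists_placed hg'
  obtain ⟨σ, hσ, w, z, ph⟩ := exists_placed hh
  obtain ⟨m, hm, am⟩ := pg.of_mem _ h₁.mem_left
  obtain ⟨n', hn', an'⟩ := ph'.of_mem _ h₁.mem_right
  obtain ⟨m', hm', am'⟩ := pg'.of_mem _ h₂.mem_left
  obtain ⟨n, hn, an⟩ := ph.of_mem _ h₂.mem_right
  obtain ⟨b, hb, hb1, hb2⟩ := h₁.exists_pair hij hτ hσ' pg ph' hm hn' am an'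
  obtain ⟨c, hc, hc1, hc2⟩ := h₂.exists_pair hij hτ' hσ pg' ph hm' hn am' an
  -- The windows of `g` and `g'` are aligned by their common mark `i`. The first two alternatives of
  -- the check contradict the common mark `j` of `h` and `h'`, and the presence of both windows in
  -- the same word `x`.
  have hcheck := sharingCheck_sharingPairs
  rw [sharingCheck, List.all_eq_true] at hcheck
  have hcheck := hcheck _ hb
  rw [List.all_eq_true] at hcheck
  have hcheck := hcheck _ hc
  have t1 := templates_mark_lt τ' hτ' m' hm'
  have t2 := templates_length_le τ' hτ' m' hm'
  have e1 := am.2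
  have e2 := an'.2
  have e3 := am'.2
  have e4 := an.2
  simp only at e1 e2 e3 e4
  simp only [Bool.or_eq_true, bne_iff_ne, Bool.not_eq_true'] at hcheck
  rcases hcheck with hcheck | hcheck | hcheck | hcheck
  · omega
  · rw [am.agree am' rfl (by omega)] at hcheck
    simp at hcheck
  · obtain ⟨y, hy, hy1, hy2⟩ := exists_common_of_commonWord pg (isTemplate_of_mem τ hτ) ph
      (isTemplate_of_mem σ hσ) hm hn am an rfl (by omega) hcheck
    exact ⟨y, hy, Or.inl ⟨hy1, hy2⟩⟩
  · obtain ⟨y, hy, hy1, hy2⟩ := exists_common_of_commonWord ph' (isTemplate_of_mem σ' hσ') pg'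
      (isTemplate_of_mem τ' hτ') hn' hm' an' am' rfl (by omega) hcheck
    exact ⟨y, hy, Or.inr ⟨hy2, hy1⟩⟩

end Windows

/-! ### Distinct trees yield distinct Hamilton cycles -/

section Distinct

variable {k : ℕ}

/-- In a perfect matching of `V` by edges of `O_k`, exactly the pairs with a vertex containing `c`
fail to have common zero `c`. The first count is thus determined by `V` and `c` and is the same for
all matchings. -/
theorem card_common_zero (V : Finset (OddVertex k)) (φ : OddVertex k → OddVertex k)
    (hmaps : ∀ v ∈ V, φ v ∈ V) (hinv : ∀ v ∈ V, φ (φ v) = v)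
    (hdisj : ∀ v ∈ V, Disjoint v.1 (φ v).1) (c : Fin (2 * k + 1)) :
    (V.filter fun v => c ∉ v.1 ∧ c ∉ (φ v).1).card + 2 * (V.filter fun v => c ∈ v.1).card
      = V.card := by
  have h1 : (V.filter fun v => c ∈ (φ v).1).card = (V.filter fun v => c ∈ v.1).card := by
    refine Finset.card_nbij' φ φ ?_ ?_ ?_ ?_
    · intro v hv
      simp only [Finset.coe_filter, Set.mem_ofPred_eq] at hv ⊢
      exact ⟨hmaps v hv.1, hv.2⟩
    · intro v hv
      simp only [Finset.coe_filter, Set.mem_ofPred_eq] at hv ⊢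
      exact ⟨hmaps v hv.1, by rw [hinv v hv.1]; exact hv.2⟩
    · intro v hv
      simp only [Finset.coe_filter, Set.mem_ofPred_eq] at hv
      exact hinv v hv.1
    · intro v hv
      simp only [Finset.coe_filter, Set.mem_ofPred_eq] at hv
      exact hinv v hv.1
  have h2 : ∀ v ∈ V, (if c ∉ v.1 ∧ c ∉ (φ v).1 then 1 else 0) + ((if c ∈ (φ v).1 then 1 else 0) +
      (if c ∈ v.1 then 1 else 0)) = 1 := by
    intro v hv
    have h : c ∈ v.1 → c ∉ (φ v).1 := fun h => Finset.disjoint_left.1 (hdisj v hv) h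
    by_cases h3 : c ∈ v.1 <;> by_cases h4 : c ∈ (φ v).1
    · exact absurd h4 (h h3)
    all_goals simp [h3, h4]
  have h3 := Finset.sum_congr rfl h2
  rw [Finset.sum_add_distrib, Finset.sum_add_distrib, ← Finset.card_filter, ← Finset.card_filter,
    ← Finset.card_filter, h1, Finset.sum_const, smul_eq_mul, mul_one] at h3
  omega

/-- An edge of a flipping cycle outside the 2-factor has its common zero at a marked position. -/
theorem FlipData.exists_mark {g : MarkedTuple k} {E : Set (Sym2 (OddVertex k))}
    {f : Dyck k × ℕ → Sym2 (OddVertex k)} (h : FlipData g E f) {a b : OddVertex k}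
    (he : s(a, b) ∈ E) (hF : s(a, b) ∉ twoFactor k) :
    ∃ c : Fin (2 * k + 1), c ∉ a.1 ∧ c ∉ b.1 ∧ ∃ p ∈ g, c.val + p.2 = 2 * k := by
  classical
  have key : ∀ v, ∃ x y, (∃ w, s(v, w) ∈ E) → s(v, x) ∈ E ∧ s(v, x) ∈ twoFactor k ∧
      s(v, y) ∈ E ∧ s(v, y) ∉ twoFactor k ∧ ∀ w, s(v, w) ∈ E → w = x ∨ w = y := by
    intro v
    by_cases hv : ∃ w, s(v, w) ∈ E
    · obtain ⟨w, hw⟩ := hv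
      obtain ⟨p, hp, q, hq, _, x, y, hx, _, _, hset, hy⟩ := h.local_structure hw (Sym2.mem_mk_left v w)
      have hmem : ∀ w, s(v, w) ∈ E ↔ w = x ∨ w = y := fun w => by
        have := congrArg (fun s => w ∈ s) hset
        simpa using this
      exact ⟨x, y, fun _ => ⟨(hmem x).2 (Or.inl rfl), hx ▸ flippable_mem_twoFactor (h.flip p hp),
        (hmem y).2 (Or.inr rfl), hy, fun w hw => (hmem w).1 hw⟩⟩
    · exact ⟨v, v, fun h => absurd h hv⟩
  choose φ ν hφν using key
  let V : Finset (OddVertex k) := Finset.univ.filter fun v => ∃ w, s(v, w) ∈ E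
  have hV : ∀ v, v ∈ V ↔ ∃ w, s(v, w) ∈ E := fun v => by simp [V]
  have hφE : ∀ v ∈ V, s(v, φ v) ∈ E := fun v hv => (hφν v ((hV v).1 hv)).1
  have hφF : ∀ v ∈ V, s(v, φ v) ∈ twoFactor k := fun v hv => (hφν v ((hV v).1 hv)).2.1
  have hνE : ∀ v ∈ V, s(v, ν v) ∈ E := fun v hv => (hφν v ((hV v).1 hv)).2.2.1
  have hνF : ∀ v ∈ V, s(v, ν v) ∉ twoFactor k := fun v hv => (hφν v ((hV v).1 hv)).2.2.2.1
  have huniq : ∀ v ∈ V, ∀ w, s(v, w) ∈ E → w = φ v ∨ w = ν v :=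
    fun v hv => (hφν v ((hV v).1 hv)).2.2.2.2
  have mφ : ∀ v ∈ V, φ v ∈ V := fun v hv => (hV _).2 ⟨v, by rw [Sym2.eq_swap]; exact hφE v hv⟩
  have mν : ∀ v ∈ V, ν v ∈ V := fun v hv => (hV _).2 ⟨v, by rw [Sym2.eq_swap]; exact hνE v hv⟩
  have iφ : ∀ v ∈ V, φ (φ v) = v := fun v hv => by
    rcases huniq _ (mφ v hv) v (by rw [Sym2.eq_swap]; exact hφE v hv) with h1 | h1
    · exact h1.symm
    · have := hνF _ (mφ v hv)
      rw [← h1, Sym2.eq_swap] at this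
      exact absurd (hφF v hv) this
  have iν : ∀ v ∈ V, ν (ν v) = v := fun v hv => by
    rcases huniq _ (mν v hv) v (by rw [Sym2.eq_swap]; exact hνE v hv) with h1 | h1
    · have := hφF _ (mν v hv)
      rw [← h1, Sym2.eq_swap] at this
      exact absurd this (hνF v hv)
    · exact h1.symm
  have ha : a ∈ V := (hV a).2 ⟨b, he⟩
  have hab : b = ν a := by
    rcases huniq a ha b he with h1 | h1
    · exact absurd (h1 ▸ hφF a ha) hF
    · exact h1
  obtain ⟨c, hc⟩ : ∃ c, c ∉ a.1 ∪ b.1 := by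
    by_contra! hall
    have h1 : (a.1 ∪ b.1).card = 2 * k := by
      rw [Finset.card_union_of_disjoint (h.adj _ _ he).2, a.2, b.2]; ring
    rw [Finset.eq_univ_iff_forall.2 hall, Finset.card_univ, Fintype.card_fin] at h1
    omega
  rw [Finset.mem_union, not_or] at hc
  -- The cycle splits into two perfect matchings of its vertices, by flippable edges (`φ`) and by
  -- the other edges (`ν`). Each coordinate is the common zero equally often in both, so a common
  -- zero of a `ν`-edge is one of a flippable edge.
  have h1 := card_common_zero V φ mφ iφ (fun v hv => (h.adj _ _ (hφE v hv)).2) c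
  have h2 := card_common_zero V ν mν iν (fun v hv => (h.adj _ _ (hνE v hv)).2) c
  have h3 : 0 < (V.filter fun v => c ∉ v.1 ∧ c ∉ (ν v).1).card :=
    Finset.card_pos.2 ⟨a, Finset.mem_filter.2 ⟨ha, hc.1, hab ▸ hc.2⟩⟩
  obtain ⟨v, hv⟩ := Finset.card_pos.1
    (show 0 < (V.filter fun v => c ∉ v.1 ∧ c ∉ (φ v).1).card by omega)
  rw [Finset.mem_filter] at hv
  obtain ⟨p, hp, hp'⟩ := (h.mem_twoFactor_iff (hφE v hv.1)).1 (hφF v hv.1)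
  refine ⟨c, hc.1, hc.2, p, hp, ?_⟩
  obtain ⟨t, ht, hst⟩ := (isFlippableEdge_iff _ _ _).1 (h.flip p hp)
  rw [← hp', lineEdge, Sym2.eq_iff] at ht
  have hcs : c = star p.1 t := by
    refine common_zero_unique (disjoint_vtx_succ p.1 t) ?_ ?_ (star_notMem _ _) (star_notMem_succ _ _)
    · rcases ht with ⟨h4, h5⟩ | ⟨h4, h5⟩
      · rw [← h4]; exact hv.2.1
      · rw [← h5]; exact hv.2.2
    · rcases ht with ⟨h4, h5⟩ | ⟨h4, h5⟩
      · rw [← h5]; exact hv.2.2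
      · rw [← h4]; exact hv.2.1
  rw [hcs]; exact hst

/-- Two flipping cycles with a common edge outside the 2-factor. -/
theorem FlipData.sharing {g h : MarkedTuple k} {E E' : Set (Sym2 (OddVertex k))}
    {f f' : Dyck k × ℕ → Sym2 (OddVertex k)} (hg : FlipData g E f) (hh : FlipData h E' f')
    {v b : OddVertex k} (he : s(v, b) ∈ E) (he' : s(v, b) ∈ E') (hF : s(v, b) ∉ twoFactor k)
    {i j : ℕ} (hi : (cls v, i) ∈ g) (hj : (cls v, j) ∈ h) : Sharing g h (cls v) i j := by
  obtain ⟨c, hc1, hc2, p, hp, hpc⟩ := hg.exists_mark he hF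
  obtain ⟨c', hc1', hc2', q, hq, hqc⟩ := hh.exists_mark he' hF
  obtain rfl := common_zero_unique (hg.adj _ _ he).2 hc1 hc2 hc1' hc2'
  exact ⟨hi, hj, ⟨cls b, (hg.cls_ne he hF).symm, hg.cls_mem he (Sym2.mem_mk_right v b),
    hh.cls_mem he' (Sym2.mem_mk_right v b)⟩, p, hp, q, hq, by omega⟩

/-! ### Two families yielding the same edge set -/

section TwoFamilies

variable {T T' : Finset (MarkedTuple k)} {C C' : MarkedTuple k → Set (Sym2 (OddVertex k))}
  {f f' : MarkedTuple k → Dyck k × ℕ → Sym2 (OddVertex k)}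

theorem glue_eq_iff (h : glue C T = glue C' T') (e : Sym2 (OddVertex k)) :
    (∃ g ∈ T, e ∈ C g) ↔ ∃ g ∈ T', e ∈ C' g := by
  have h1 : e ∈ glue C T ↔ e ∈ glue C' T' := by rw [h]
  simp only [glue, Set.mem_ofPred_eq] at h1
  by_cases hF : e ∈ twoFactor k
  · simp only [hF, true_and, not_true, false_and, or_false] at h1
    constructor
    · rintro ⟨g, hg, he⟩
      by_contra hc
      push Not at hc
      exact h1.2 hc g hg he
    · rintro ⟨g, hg, he⟩
      by_contra hc
      push Not at hc
      exact h1.1 hc g hg he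
  · simpa [hF] using h1

theorem FlipFamily.exists_factor_edge (h : FlipFamily T C f) {g : MarkedTuple k} (hg : g ∈ T)
    {v w : OddVertex k} (hw : s(v, w) ∈ C g) : ∃ j a b, (cls v, j) ∈ g ∧
      IsFlippableEdge (cls v) j s(v, a) ∧ s(v, b) ∉ twoFactor k ∧ ∀ w, s(v, w) ∈ C g ↔ w = a ∨ w = b := by
  obtain ⟨p, hp, q, hq, _, a, b, ha, _, _, hset, hb⟩ :=
    (h.data g hg).local_structure hw (Sym2.mem_mk_left v w)
  have hcls : cls v = p.1 :=
    cls_of_mem_flippable ((h.data g hg).flip p hp) (by rw [ha]; exact Sym2.mem_mk_left _ _)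
  refine ⟨p.2, a, b, by rw [hcls]; exact hp, ?_, hb, fun w => ?_⟩
  · rw [hcls, ← ha]; exact (h.data g hg).flip p hp
  · have := congrArg (fun s => w ∈ s) hset
    simpa using this

/-- If the cycles of `g` and `g'` share the factor edge `va` but leave `v` by different edges `vb`
and `vb₂`, then `vb` also lies on the cycle of some `l'` in `T'`, and `vb₂` on that of some `l` in
`T`. Both use the other factor edge at `v`. Thus `g`, `g'` mark `i` and `l`, `l'` mark `j` in the
list of `v`, and `Sharing.exists_common` gives two members of one family with two common lists. -/
theorem FlipFamily.mem_of_factor_edge (hk : 1 ≤ k) (h : FlipFamily T C f) (h' : FlipFamily T' C' f')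
    (hT : ∀ g ∈ T, IsHyperedge k g) (hT' : ∀ g ∈ T', IsHyperedge k g)
    (heq : glue C T = glue C' T') {g g' : MarkedTuple k} (hg : g ∈ T) (hg' : g' ∈ T')
    {v a b : OddVertex k} (ha : s(v, a) ∈ twoFactor k) (hb : s(v, b) ∉ twoFactor k)
    (hga : s(v, a) ∈ C g) (hga' : s(v, a) ∈ C' g') (hgb : s(v, b) ∈ C g) : s(v, b) ∈ C' g' := by
  by_contra hcon
  obtain ⟨i, a₁, b₁, hi, hi', hb₁, hgn⟩ := h.exists_factor_edge hg hga
  obtain ⟨i', a₂, b₂, hi₂, hi₂', hb₂, hgn'⟩ := h'.exists_factor_edge hg' hga'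
  have ha₁ : a = a₁ := ((hgn a).1 hga).resolve_right fun e => hb₁ (e ▸ ha)
  have ha₂ : a = a₂ := ((hgn' a).1 hga').resolve_right fun e => hb₂ (e ▸ ha)
  have hbb₁ : b = b₁ := ((hgn b).1 hgb).resolve_left fun e => hb (by rw [e, ← ha₁]; exact ha)
  subst ha₁ ha₂ hbb₁
  have hii : i = i' := (flippable_eq_iff hk hi' hi₂').2
  subst hii
  have hb₂g' : s(v, b₂) ∈ C' g' := (hgn' b₂).2 (Or.inr rfl)
  have hbb : b₂ ≠ b := fun e => hcon (e ▸ hb₂g')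
  obtain ⟨l, hl, hlb⟩ := (glue_eq_iff heq _).2 ⟨g', hg', hb₂g'⟩
  obtain ⟨l', hl', hlb'⟩ := (glue_eq_iff heq _).1 ⟨g, hg, hgb⟩
  obtain ⟨j, a₃, b₃, hj, hj', hb₃, hln⟩ := h.exists_factor_edge hl hlb
  obtain ⟨j', a₄, b₄, hj₄, hj₄', hb₄, hln'⟩ := h'.exists_factor_edge hl' hlb'
  have hlg : l ≠ g := by
    rintro rfl
    rcases (hgn b₂).1 hlb with e | e
    · exact hb₂ (e ▸ ha)
    · exact hbb e
  have hlg' : l' ≠ g' := by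
    rintro rfl
    exact hcon hlb'
  have ha₃ : a₃ ≠ a := by
    rintro rfl
    exact hlg (h.owner_unique hk hl hg ((hln _).2 (Or.inl rfl)) hga)
  have ha₄ : a₄ ≠ a := by
    rintro rfl
    exact hlg' (h'.owner_unique hk hl' hg' ((hln' _).2 (Or.inl rfl)) hga')
  -- Only two edges of the 2-factor meet at `v`, and one of them is `va`.
  have haa : a₃ = a₄ := by
    obtain ⟨y, z, hyz, hs⟩ := Set.ncard_eq_two.1 (twoFactor_ncard hk v)
    have hmem : ∀ w, s(v, w) ∈ twoFactor k → w = y ∨ w = z := fun w hw => by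
      have : w ∈ {w | s(v, w) ∈ twoFactor k} := hw
      rw [hs] at this
      simpa using this
    have m1 := hmem a ha
    have m2 := hmem a₃ (flippable_mem_twoFactor hj')
    have m3 := hmem a₄ (flippable_mem_twoFactor hj₄')
    grind
  subst haa
  have hjj : j = j' := (flippable_eq_iff hk hj' hj₄').2
  subst hjj
  have hij : i ≠ j := by
    rintro rfl
    have := isFlippableEdge_unique hi' hj'
    rw [Sym2.congr_right] at this
    exact ha₃ this.symm
  have s₁ := (h.data g hg).sharing (h'.data l' hl') hgb hlb' hb hi hj₄
  have s₂ := (h'.data g' hg').sharing (h.data l hl) hb₂g' hlb hb₂ hi₂ hj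
  obtain ⟨y, hy, ⟨hy1, hy2⟩ | ⟨hy1, hy2⟩⟩ := s₁.exists_common (hT g hg) (hT' g' hg') (hT l hl)
    (hT' l' hl') hij s₂
  · exact hlg (eq_of_two_common h.conflictFree.card_inter_le hl hg hy hy2
      (Finset.mem_image_of_mem Prod.fst hj) hy1 (Finset.mem_image_of_mem Prod.fst hi))
  · exact hlg' (eq_of_two_common h'.conflictFree.card_inter_le hl' hg' hy hy2
      (Finset.mem_image_of_mem Prod.fst hj₄) hy1 (Finset.mem_image_of_mem Prod.fst hi₂))

/-- At each vertex, one common edge forces the other edge of `C g` to be common too. The inclusion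
then propagates along the connected cycle. -/
theorem FlipFamily.subset_of_common_edge (hk : 1 ≤ k) (h : FlipFamily T C f)
    (h' : FlipFamily T' C' f') (hT : ∀ g ∈ T, IsHyperedge k g) (hT' : ∀ g ∈ T', IsHyperedge k g)
    (heq : glue C T = glue C' T') {g g' : MarkedTuple k} (hg : g ∈ T) (hg' : g' ∈ T')
    {e : Sym2 (OddVertex k)} (he : e ∈ C g) (he' : e ∈ C' g') : C g ⊆ C' g' := by
  have step : ∀ v w w', s(v, w) ∈ C g → s(v, w) ∈ C' g' → s(v, w') ∈ C g → s(v, w') ∈ C' g' := by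
    intro v w w' hw hw' hx
    obtain ⟨i, a, b, hi, hi', hb, hgn⟩ := h.exists_factor_edge hg hw
    have ha := flippable_mem_twoFactor hi'
    have hga := (hgn a).2 (Or.inl rfl)
    have hgb := (hgn b).2 (Or.inr rfl)
    have key : s(v, a) ∈ C' g' → s(v, b) ∈ C' g' := fun hga' =>
      h.mem_of_factor_edge hk h' hT hT' heq hg hg' ha hb hga hga' hgb
    -- The member of `T'` owning `va` also owns `vb` by the previous lemma, so it is `g'`.
    have key' : s(v, b) ∈ C' g' → s(v, a) ∈ C' g' := fun hgb' => by
      obtain ⟨l', hl', hla⟩ := (glue_eq_iff heq _).1 ⟨g, hg, hga⟩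
      have := h.mem_of_factor_edge hk h' hT hT' heq hg hl' ha hb hga hla hgb
      exact h'.owner_unique hk hl' hg' this hgb' ▸ hla
    rcases (hgn w).1 hw with rfl | rfl <;> rcases (hgn w').1 hx with rfl | rfl
    · exact hw'
    · exact key hw'
    · exact key' hw'
    · exact hw'
  have prop : ∀ {v w : OddVertex k}, (SimpleGraph.fromEdgeSet (C g)).Walk v w →
      (∀ u, s(v, u) ∈ C g → s(v, u) ∈ C' g') → ∀ u, s(w, u) ∈ C g → s(w, u) ∈ C' g' := by
    intro v w p
    induction p with
    | nil => exact fun h => h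
    | @cons x y z hxy p ih =>
      intro hx
      rw [SimpleGraph.fromEdgeSet_adj] at hxy
      have hy := hx y hxy.1
      refine ih fun u hu => step y x u ?_ ?_ hu
      · rw [Sym2.eq_swap]; exact hxy.1
      · rw [Sym2.eq_swap]; exact hy
  intro e₁ he₁
  induction e using Sym2.ind with
  | _ a b =>
  induction e₁ using Sym2.ind with
  | _ c d =>
  obtain ⟨p⟩ := (h.data g hg).conn _ he a (Sym2.mem_mk_left a b) _ he₁ c (Sym2.mem_mk_left c d)
  exact prop p (fun u hu => step a b u he he' hu) d he₁

/-- Applied in both directions, the inclusion shows that the two cycles are equal. Their edges in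
the 2-factor are flippable edges, from which the words and the marks are recovered. -/
theorem FlipFamily.mem_of_glue_eq (hk : 1 ≤ k) (h : FlipFamily T C f)
    (h' : FlipFamily T' C' f') (hT : ∀ g ∈ T, IsHyperedge k g) (hT' : ∀ g ∈ T', IsHyperedge k g)
    (heq : glue C T = glue C' T') {g : MarkedTuple k} (hg : g ∈ T) : g ∈ T' := by
  obtain ⟨p, hp⟩ := (h.data g hg).nonempty
  have he := (h.data g hg).mem p hp
  obtain ⟨g', hg', he'⟩ := (glue_eq_iff heq _).1 ⟨g, hg, he⟩
  have hs := h.subset_of_common_edge hk h' hT hT' heq hg hg' he he'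
  have hs' := h'.subset_of_common_edge hk h hT' hT heq.symm hg' hg he' he
  have sub : ∀ q ∈ g, q ∈ g' := fun q hq => by
    have h1 := (h.data g hg).flip q hq
    obtain ⟨r, hr, hqr⟩ := ((h'.data g' hg').mem_twoFactor_iff (hs ((h.data g hg).mem q hq))).1
      (flippable_mem_twoFactor h1)
    have h2 := flippable_eq_iff hk h1 (hqr ▸ (h'.data g' hg').flip r hr)
    have : q = r := Prod.ext h2.1 h2.2
    exact this ▸ hr
  have sub' : ∀ q ∈ g', q ∈ g := fun q hq => by
    have h1 := (h'.data g' hg').flip q hq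
    obtain ⟨r, hr, hqr⟩ := ((h.data g hg).mem_twoFactor_iff (hs' ((h'.data g' hg').mem q hq))).1
      (flippable_mem_twoFactor h1)
    have h2 := flippable_eq_iff hk h1 (hqr ▸ (h.data g hg).flip r hr)
    have : q = r := Prod.ext h2.1 h2.2
    exact this ▸ hr
  have : g = g' := Finset.ext fun q => ⟨sub q, sub' q⟩
  exact this ▸ hg'

end TwoFamilies

theorem eq_of_yields_eq (hk : 1 ≤ k) {T T' : Finset (MarkedTuple k)}
    (hT : ∀ g ∈ T, IsHyperedge k g) (hc : IsConflictFree T) (hT' : ∀ g ∈ T', IsHyperedge k g)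
    (hc' : IsConflictFree T') {H : Set (Sym2 (OddVertex k))} (hH : Yields T H)
    (hH' : Yields T' H) : T = T' := by
  obtain ⟨C, hC, rfl⟩ := hH
  obtain ⟨C', hC', heq⟩ := hH'
  obtain ⟨f, hf⟩ := exists_flipFamily hc hC
  obtain ⟨f', hf'⟩ := exists_flipFamily hc' hC'
  rw [hf.glue_eq hk, hf'.glue_eq hk] at heq
  exact Finset.ext fun g => ⟨hf.mem_of_glue_eq hk hf' hT hT' heq,
    hf'.mem_of_glue_eq hk hf hT' hT heq.symm⟩

end Distinct

/-! ### Conflict-free trees of hyperedges -/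

section Trees

/-- The Dyck word `0u1y`. -/
def node (u y : DyckWord) : DyckWord := u.nest + y

@[simp] theorem node_inj {u y u' y' : DyckWord} : node u y = node u' y' ↔ u = u' ∧ y = y' :=
  nest_add_inj

@[simp] theorem node_ne_zero (u y : DyckWord) : node u y ≠ 0 := nest_add_ne_zero u y

@[simp] theorem zero_ne_node (u y : DyckWord) : 0 ≠ node u y := (node_ne_zero u y).symm

theorem toList_node (u y : DyckWord) : (node u y).toList = U :: (u.toList ++ D :: y.toList) :=
  toList_nest_add u y

theorem semilength_node (u y : DyckWord) :
    (node u y).semilength = u.semilength + 1 + y.semilength := by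
  have h1 := length_toList (node u y)
  rw [toList_node] at h1
  simp only [List.length_cons, List.length_append, length_toList] at h1
  omega

theorem exists_node {x : DyckWord} (h : x ≠ 0) : ∃ u y, x = node u y :=
  ⟨x.insidePart, x.outsidePart, (DyckWord.nest_insidePart_add_outsidePart h).symm⟩

/-- The pairs of words and marks in the members of `T`. -/
def used (T : Set (Finset (DyckWord × ℕ))) : Set (DyckWord × ℕ) := {p | ∃ g ∈ T, p ∈ g}

/-- Hyperedges, with marks counted from the left. -/
def IsLeftHyperedge (g : Finset (DyckWord × ℕ)) : Prop :=
  ∃ (τ : List MarkedWord) (u v : List DyckStep),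
    ((∃ σ, IsBasicTuple σ ∧ (τ = σ ∨ τ = σ.map reverseCompl)) ∧
    g.image (fun p => (p.1.toList, p.2)) =
      (τ.map fun m => (u ++ m.1 ++ v, u.length + (m.1.length - 1 - m.2))).toFinset)

/-- `T` is the set of hyperedges of a conflict-free spanning tree on the words in `V`. -/
structure IsTreeOn (V : Set DyckWord) (T : Set (Finset (DyckWord × ℕ))) : Prop where
  hyperedge : ∀ g ∈ T, IsLeftHyperedge g
  sub : ∀ p ∈ used T, p.1 ∈ V
  conn : ∀ φ : DyckWord → ℕ, (∀ g ∈ T, ∀ p ∈ g, ∀ q ∈ g, φ p.1 = φ q.1) →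
    ∀ x ∈ V, ∀ y ∈ V, φ x = φ y
  forest : ∀ g ∈ T, ∃ φ : DyckWord → ℕ,
    (∀ g' ∈ T, g' ≠ g → ∀ p ∈ g', ∀ q ∈ g', φ p.1 = φ q.1) ∧
    ∀ p ∈ g, ∀ q ∈ g, φ p.1 = φ q.1 → p.1 = q.1
  disj : ∀ g ∈ T, ∀ g' ∈ T, g ≠ g' → ∀ p ∈ g, p ∉ g'

theorem IsTreeOn.congr {V V' : Set DyckWord} {T : Set (Finset (DyckWord × ℕ))} (h : IsTreeOn V T)
    (hV : ∀ x, x ∈ V' ↔ x ∈ V) : IsTreeOn V' T :=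
  (Set.ext hV : V' = V) ▸ h

theorem isTreeOn_empty (x : DyckWord) : IsTreeOn {x} ∅ where
  hyperedge := by simp
  sub := by simp [used]
  conn := by simp
  forest := by simp
  disj := by simp

theorem isTreeOn_singleton {g : Finset (DyckWord × ℕ)} (hg : IsLeftHyperedge g) :
    IsTreeOn {x | ∃ m, (x, m) ∈ g} {g} where
  hyperedge := by simpa using hg
  sub := by
    rintro p ⟨g', rfl, hp⟩
    exact ⟨p.2, hp⟩
  conn := by
    rintro φ h x ⟨m, hm⟩ y ⟨n, hn⟩
    exact h g rfl _ hm _ hn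
  forest := by
    rintro g' rfl
    -- With no other member to respect, any function injective on the words of the hyperedge
    -- separates them.
    obtain ⟨φ, hφ⟩ := Set.countable_iff_exists_injOn.1
      (g'.image Prod.fst).countable_toSet
    refine ⟨φ, by simp, fun p hp q hq h => hφ ?_ ?_ h⟩
    · exact Finset.mem_coe.2 (Finset.mem_image_of_mem _ hp)
    · exact Finset.mem_coe.2 (Finset.mem_image_of_mem _ hq)
  disj := by
    rintro g' rfl g'' rfl h
    exact absurd rfl h

/-- Trees may be glued to a tree at one vertex each. -/
theorem IsTreeOn.glue {ι : Type*} {A : Set DyckWord} {T : Set (Finset (DyckWord × ℕ))}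
    (hA : IsTreeOn A T) {V : ι → Set DyckWord} {S : ι → Set (Finset (DyckWord × ℕ))}
    (hS : ∀ i, IsTreeOn (V i) (S i)) (h : ι → DyckWord) (hh : ∀ i x, x ∈ A ∧ x ∈ V i ↔ x = h i)
    (hd : ∀ i j, i ≠ j → ∀ x ∈ V i, x ∉ V j)
    (hm : ∀ i m, (h i, m) ∈ used (S i) → (h i, m) ∉ used T) :
    IsTreeOn (A ∪ ⋃ i, V i) (T ∪ ⋃ i, S i) where
  hyperedge := by
    rintro g (hg | hg)
    · exact hA.hyperedge g hg
    · obtain ⟨i, hg⟩ := Set.mem_iUnion.1 hg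
      exact (hS i).hyperedge g hg
  sub := by
    rintro p ⟨g, hg | hg, hp⟩
    · exact Or.inl (hA.sub p ⟨g, hg, hp⟩)
    · obtain ⟨i, hg⟩ := Set.mem_iUnion.1 hg
      exact Or.inr (Set.mem_iUnion.2 ⟨i, (hS i).sub p ⟨g, hg, hp⟩⟩)
  conn := by
    intro φ hφ
    have h1 := hA.conn φ fun g hg => hφ g (Or.inl hg)
    have h2 := fun i => (hS i).conn φ fun g hg => hφ g (Or.inr (Set.mem_iUnion.2 ⟨i, hg⟩))
    have key : ∀ x ∈ A ∪ ⋃ i, V i, ∃ a ∈ A, φ x = φ a := by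
      rintro x (hx | hx)
      · exact ⟨x, hx, rfl⟩
      · obtain ⟨i, hx⟩ := Set.mem_iUnion.1 hx
        have := (hh i _).2 rfl
        exact ⟨h i, this.1, h2 i x hx _ this.2⟩
    intro x hx y hy
    obtain ⟨a, ha, e⟩ := key x hx
    obtain ⟨b, hb, e'⟩ := key y hy
    rw [e, e', h1 a ha b hb]
  forest := by
    classical
    have hsub := fun i g (hg : g ∈ S i) (p : DyckWord × ℕ) (hp : p ∈ g) =>
      (hS i).sub p ⟨g, hg, hp⟩
    rintro g (hg | hg)
    · obtain ⟨φ, h1, h2⟩ := hA.forest g hg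
      -- The separating function on `A` is extended to each attached tree by its value at the
      -- attaching vertex.
      let ψ : DyckWord → ℕ := fun x =>
        if x ∈ A then φ x else if hx : ∃ i, x ∈ V i then φ (h hx.choose) else 0
      have hψA : ∀ x ∈ A, ψ x = φ x := fun x hx => if_pos hx
      have hψV : ∀ i, ∀ x ∈ V i, ψ x = φ (h i) := by
        intro i x hx
        by_cases hxA : x ∈ A
        · rw [hψA x hxA, (hh i x).1 ⟨hxA, hx⟩]
        · have hex : ∃ i, x ∈ V i := ⟨i, hx⟩
          have : hex.choose = i := by
            by_contra hne
            exact hd _ _ hne x hex.choose_spec hx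
          simp only [ψ, if_neg hxA, dif_pos hex, this]
      have hTA := fun g (hg : g ∈ T) (p : DyckWord × ℕ) (hp : p ∈ g) => hA.sub p ⟨g, hg, hp⟩
      refine ⟨ψ, ?_, ?_⟩
      · rintro g' (hg' | hg') hne p hp q hq
        · rw [hψA _ (hTA g' hg' p hp), hψA _ (hTA g' hg' q hq)]
          exact h1 g' hg' hne p hp q hq
        · obtain ⟨i, hg'⟩ := Set.mem_iUnion.1 hg'
          rw [hψV i _ (hsub i g' hg' p hp), hψV i _ (hsub i g' hg' q hq)]
      · intro p hp q hq
        rw [hψA _ (hTA g hg p hp), hψA _ (hTA g hg q hq)]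
        exact h2 p hp q hq
    · obtain ⟨i, hg⟩ := Set.mem_iUnion.1 hg
      obtain ⟨φ, h1, h2⟩ := (hS i).forest g hg
      -- Seen from the `i`-th tree, all the rest hangs on `h i` and receives its value.
      let ψ : DyckWord → ℕ := fun x => if x ∈ V i then φ x else φ (h i)
      have hψV : ∀ x ∈ V i, ψ x = φ x := fun x hx => if_pos hx
      have hψA : ∀ x ∈ A, ψ x = φ (h i) := by
        intro x hx
        by_cases hxV : x ∈ V i
        · rw [hψV x hxV, (hh i x).1 ⟨hx, hxV⟩]
        · exact if_neg hxV
      refine ⟨ψ, ?_, ?_⟩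
      · rintro g' (hg' | hg') hne p hp q hq
        · rw [hψA _ (hA.sub p ⟨g', hg', hp⟩), hψA _ (hA.sub q ⟨g', hg', hq⟩)]
        · obtain ⟨j, hg'⟩ := Set.mem_iUnion.1 hg'
          by_cases hji : j = i
          · subst hji
            rw [hψV _ (hsub j g' hg' p hp), hψV _ (hsub j g' hg' q hq)]
            exact h1 g' hg' hne p hp q hq
          · rw [show ψ p.1 = φ (h i) from if_neg (hd j i hji _ (hsub j g' hg' p hp)),
              show ψ q.1 = φ (h i) from if_neg (hd j i hji _ (hsub j g' hg' q hq))]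
      · intro p hp q hq
        rw [hψV _ (hsub i g hg p hp), hψV _ (hsub i g hg q hq)]
        exact h2 p hp q hq
  disj := by
    have cross : ∀ g ∈ T, ∀ i, ∀ g' ∈ S i, ∀ p ∈ g, p ∉ g' := by
      intro g hg i g' hg' p hp hp'
      have := (hh i p.1).1 ⟨hA.sub p ⟨g, hg, hp⟩, (hS i).sub p ⟨g', hg', hp'⟩⟩
      exact hm i p.2 ⟨g', hg', this ▸ hp'⟩ ⟨g, hg, this ▸ hp⟩
    rintro g (hg | hg) g' (hg' | hg') hne p hp hp'
    · exact hA.disj g hg g' hg' hne p hp hp'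
    · obtain ⟨i, hg'⟩ := Set.mem_iUnion.1 hg'
      exact cross g hg i g' hg' p hp hp'
    · obtain ⟨i, hg⟩ := Set.mem_iUnion.1 hg
      exact cross g' hg' i g hg p hp' hp
    · obtain ⟨i, hg⟩ := Set.mem_iUnion.1 hg
      obtain ⟨j, hg'⟩ := Set.mem_iUnion.1 hg'
      by_cases hij : i = j
      · subst hij
        exact (hS i).disj g hg g' hg' hne p hp hp'
      · exact hd i j hij p.1 ((hS i).sub p ⟨g, hg, hp⟩) ((hS j).sub p ⟨g', hg', hp'⟩)

theorem IsTreeOn.glue_one {A V : Set DyckWord} {T S : Set (Finset (DyckWord × ℕ))}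
    (hA : IsTreeOn A T) (hS : IsTreeOn V S) (h : DyckWord) (hh : ∀ x, x ∈ A ∧ x ∈ V ↔ x = h)
    (hm : ∀ m, (h, m) ∈ used S → (h, m) ∉ used T) : IsTreeOn (A ∪ V) (T ∪ S) := by
  have := hA.glue (ι := Unit) (V := fun _ => V) (S := fun _ => S) (fun _ => hS) (fun _ => h)
    (fun _ => hh) (fun i j hij => absurd rfl hij) (fun _ => hm)
  rwa [Set.iUnion_const, Set.iUnion_const] at this

theorem mem_used_union {T S : Set (Finset (DyckWord × ℕ))} {p : DyckWord × ℕ} :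
    p ∈ used (T ∪ S) ↔ p ∈ used T ∨ p ∈ used S := by
  simp only [used, Set.mem_ofPred_eq, Set.mem_union]
  constructor
  · rintro ⟨g, hg | hg, hp⟩
    · exact Or.inl ⟨g, hg, hp⟩
    · exact Or.inr ⟨g, hg, hp⟩
  · rintro (⟨g, hg, hp⟩ | ⟨g, hg, hp⟩)
    · exact ⟨g, Or.inl hg, hp⟩
    · exact ⟨g, Or.inr hg, hp⟩

theorem mem_used_iUnion {ι : Type*} {S : ι → Set (Finset (DyckWord × ℕ))} {p : DyckWord × ℕ} :
    p ∈ used (⋃ i, S i) ↔ ∃ i, p ∈ used (S i) := by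
  simp only [used, Set.mem_ofPred_eq, Set.mem_iUnion]
  constructor
  · rintro ⟨g, ⟨i, hg⟩, hp⟩
    exact ⟨i, g, hg, hp⟩
  · rintro ⟨i, g, hg, hp⟩
    exact ⟨g, ⟨i, hg⟩, hp⟩

theorem mem_used_singleton {g : Finset (DyckWord × ℕ)} {p : DyckWord × ℕ} :
    p ∈ used {g} ↔ p ∈ g := by simp [used]

theorem mem_used_empty {p : DyckWord × ℕ} : ¬ p ∈ used ∅ := by simp [used]

/-- The words of a family in a context that places `n` entries before them. -/
def mapFamily (f : DyckWord → DyckWord) (n : ℕ) (T : Set (Finset (DyckWord × ℕ))) :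
    Set (Finset (DyckWord × ℕ)) := (Finset.image fun p => (f p.1, n + p.2)) '' T

theorem mem_used_map {f : DyckWord → DyckWord} {n : ℕ} {T : Set (Finset (DyckWord × ℕ))}
    {x : DyckWord} {m : ℕ} :
    (x, m) ∈ used (mapFamily f n T) ↔ ∃ y i, (y, i) ∈ used T ∧ x = f y ∧ m = n + i := by
  constructor
  · rintro ⟨g, ⟨g', hg', rfl⟩, hx⟩
    obtain ⟨p, hp, he⟩ := Finset.mem_image.1 hx
    rw [Prod.mk.injEq] at he
    exact ⟨p.1, p.2, ⟨g', hg', hp⟩, he.1.symm, he.2.symm⟩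
  · rintro ⟨y, i, ⟨g, hg, hy⟩, rfl, rfl⟩
    exact ⟨_, ⟨g, hg, rfl⟩, Finset.mem_image.2 ⟨(y, i), hy, rfl⟩⟩

theorem image_toFinset_list {α β : Type*} [DecidableEq α] [DecidableEq β] (l : List α) (f : α → β) :
    l.toFinset.image f = (l.map f).toFinset := by
  ext; simp

theorem IsTreeOn.map {V : Set DyckWord} {T : Set (Finset (DyckWord × ℕ))} (h : IsTreeOn V T)
    {f : DyckWord → DyckWord} {u v : List DyckStep}
    (hf : ∀ x, (f x).toList = u ++ x.toList ++ v) :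
    IsTreeOn (f '' V) (mapFamily f u.length T) := by
  have hinj : Function.Injective f := fun x y hxy => by
    have := hf x
    rw [hxy, hf y, List.append_cancel_right_eq, List.append_cancel_left_eq] at this
    exact (DyckWord.ext this).symm
  let F : DyckWord × ℕ → DyckWord × ℕ := fun p => (f p.1, u.length + p.2)
  have hF : Function.Injective F := fun p q hpq => by
    simp only [F, Prod.mk.injEq] at hpq
    exact Prod.ext (hinj hpq.1) (by omega)
  refine ⟨?_, ?_, ?_, ?_, ?_⟩
  · rintro _ ⟨g, hg, rfl⟩
    obtain ⟨τ, u', v', hτ, he⟩ := h.hyperedge g hg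
    refine ⟨τ, u ++ u', v' ++ v, hτ, ?_⟩
    have := congrArg (Finset.image fun p : List DyckStep × ℕ => (u ++ p.1 ++ v, u.length + p.2)) he
    rw [Finset.image_image, image_toFinset_list, List.map_map] at this
    rw [Finset.image_image]
    convert this using 2
    · funext p
      simp [hf]
    · congr 1
      funext m
      simp [add_assoc]
  · rintro ⟨x, m⟩ hp
    obtain ⟨y, i, hy, rfl, rfl⟩ := mem_used_map.1 hp
    exact ⟨y, h.sub _ hy, rfl⟩
  · rintro φ hφ _ ⟨x, hx, rfl⟩ _ ⟨y, hy, rfl⟩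
    refine h.conn (fun x => φ (f x)) (fun g hg p hp q hq => ?_) x hx y hy
    exact hφ _ ⟨g, hg, rfl⟩ _ (Finset.mem_image_of_mem _ hp) _ (Finset.mem_image_of_mem _ hq)
  · rintro _ ⟨g, hg, rfl⟩
    obtain ⟨φ, h1, h2⟩ := h.forest g hg
    have he : ∀ x, Function.extend f φ 0 (f x) = φ x := fun x => hinj.extend_apply φ 0 x
    refine ⟨Function.extend f φ 0, ?_, ?_⟩
    · rintro _ ⟨g', hg', rfl⟩ hne p hp q hq
      obtain ⟨p, hp', rfl⟩ := Finset.mem_image.1 hp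
      obtain ⟨q, hq', rfl⟩ := Finset.mem_image.1 hq
      simp only [he]
      exact h1 g' hg' (fun e => hne (by rw [e])) p hp' q hq'
    · intro p hp q hq
      obtain ⟨p, hp', rfl⟩ := Finset.mem_image.1 hp
      obtain ⟨q, hq', rfl⟩ := Finset.mem_image.1 hq
      simp only [he]
      exact fun hpq => congrArg f (h2 p hp' q hq' hpq)
  · rintro _ ⟨g, hg, rfl⟩ _ ⟨g', hg', rfl⟩ hne p hp hp'
    obtain ⟨p, hpg, rfl⟩ := Finset.mem_image.1 hp
    obtain ⟨q, hqg, hpq⟩ := Finset.mem_image.1 hp'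
    obtain rfl := hF hpq
    exact h.disj g hg g' hg' (fun e => hne (by rw [e])) _ hpg hqg

end Trees

/-! ### Construction of conflict-free spanning trees -/

section Construction

/-- The alternating word `0101⋯01`. -/
def alt : ℕ → DyckWord
  | 0 => 0
  | n + 1 => node 0 (alt n)

theorem semilength_alt (n : ℕ) : (alt n).semilength = n := by
  induction n with
  | zero => rfl
  | succ n ih => rw [alt, semilength_node, ih, DyckWord.semilength_zero]; omega

theorem semilength_eq_zero {x : DyckWord} : x.semilength = 0 ↔ x = 0 := by
  constructor
  · intro h
    by_contra hx
    obtain ⟨u, y, rfl⟩ := exists_node hx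
    rw [semilength_node] at h
    omega
  · rintro rfl; rfl

theorem semilength_eq_succ {x : DyckWord} {n : ℕ} :
    x.semilength = n + 1 ↔ ∃ u y, x = node u y ∧ u.semilength + y.semilength = n := by
  constructor
  · intro h
    have hx : x ≠ 0 := by rintro rfl; simp at h
    obtain ⟨u, y, rfl⟩ := exists_node hx
    rw [semilength_node] at h
    exact ⟨u, y, rfl, by omega⟩
  · rintro ⟨u, y, rfl, h⟩
    rw [semilength_node]; omega

theorem semilength_eq_one {x : DyckWord} : x.semilength = 1 ↔ x = node 0 0 := by
  rw [semilength_eq_succ]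
  constructor
  · rintro ⟨u, y, rfl, h⟩
    rw [semilength_eq_zero.1 (by omega : u.semilength = 0),
      semilength_eq_zero.1 (by omega : y.semilength = 0)]
  · rintro rfl
    exact ⟨0, 0, rfl, rfl⟩

theorem semilength_eq_two {x : DyckWord} :
    x.semilength = 2 ↔ x = node 0 (node 0 0) ∨ x = node (node 0 0) 0 := by
  rw [semilength_eq_succ]
  constructor
  · rintro ⟨u, y, rfl, h⟩
    rcases Nat.eq_zero_or_pos u.semilength with h0 | h0
    · left
      rw [semilength_eq_zero.1 h0, semilength_eq_one.1 (by omega : y.semilength = 1)]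
    · right
      rw [semilength_eq_one.1 (by omega : u.semilength = 1),
        semilength_eq_zero.1 (by omega : y.semilength = 0)]
  · rintro (rfl | rfl)
    · exact ⟨0, _, rfl, by simp [semilength_node]⟩
    · exact ⟨_, 0, rfl, by simp [semilength_node]⟩

theorem semilength_eq_three {x : DyckWord} : x.semilength = 3 ↔
    x = node 0 (node 0 (node 0 0)) ∨ x = node 0 (node (node 0 0) 0) ∨
    x = node (node 0 0) (node 0 0) ∨ x = node (node 0 (node 0 0)) 0 ∨
    x = node (node (node 0 0) 0) 0 := by
  rw [semilength_eq_succ]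
  constructor
  · rintro ⟨u, y, rfl, h⟩
    obtain h0 | h0 | h0 : u.semilength = 0 ∨ u.semilength = 1 ∨ u.semilength = 2 := by omega
    · rw [semilength_eq_zero.1 h0]
      rcases semilength_eq_two.1 (by omega : y.semilength = 2) with rfl | rfl <;> simp
    · rw [semilength_eq_one.1 h0, semilength_eq_one.1 (by omega : y.semilength = 1)]
      simp
    · rw [semilength_eq_zero.1 (by omega : y.semilength = 0)]
      rcases semilength_eq_two.1 h0 with rfl | rfl <;> simp
  · rintro (rfl | rfl | rfl | rfl | rfl) <;> exact ⟨_, _, rfl, by simp [semilength_node]⟩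

theorem toList_node_zero (y : DyckWord) : (node 0 y).toList = [U, D] ++ y.toList ++ [] := by
  simp [toList_node, toList_zero]

theorem toList_node_one (y : DyckWord) :
    (node (node 0 0) y).toList = [U, U, D, D] ++ y.toList ++ [] := by
  simp [toList_node, toList_zero]

theorem toList_node_left (y u : DyckWord) :
    (node u y).toList = [U] ++ u.toList ++ (D :: y.toList) := by
  simp [toList_node]

/-- The hyperedge `00[0]11w1y, [0]0101w1y, 0100[1]w1y`; the marked entry is the one with the
given number, counted from the left. -/
def linkEdge (w y : DyckWord) : Finset (DyckWord × ℕ) :=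
  {(node (node (node 0 0) w) y, 1), (node (node 0 (node 0 w)) y, 0),
    (node 0 (node (node 0 w) y), 4)}

/-- The mirror image of the first tuple, taken for the mirror image `z` of `w`, with empty prefix
and suffix `y`. -/
theorem isLeftHyperedge_linkEdge (w y : DyckWord) : IsLeftHyperedge (linkEdge w y) := by
  obtain ⟨z, hz⟩ := exists_reverseCompl w
  have hw : (z.toList.map compl).reverse = w.toList := by
    rw [hz, List.map_reverse, List.reverse_reverse, List.map_map]
    have : compl ∘ compl = id := funext compl_compl
    rw [this, List.map_id]
  refine ⟨(S₁ z).map reverseCompl, [], y.toList, ⟨S₁ z, Or.inl ⟨z, rfl⟩, Or.inr rfl⟩, ?_⟩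
  rw [← List.map_reverse] at hw
  have hlen : z.toList.length = w.toList.length := by rw [hz]; simp
  simp [linkEdge, S₁, reverseCompl, toList_node, toList_zero, compl, hw]
  rw [hlen, Finset.pair_comm]
  simp

theorem isLeftHyperedge_S₁ (y : DyckWord) : IsLeftHyperedge
    {(node (node (node 0 0) 0) y, 4), (node (node 0 0) (node 0 y), 1),
      (node (node 0 (node 0 0)) y, 5)} := by
  refine ⟨S₁ 0, [], y.toList, ⟨S₁ 0, Or.inl ⟨0, rfl⟩, Or.inl rfl⟩, ?_⟩
  simp [S₁, toList_node, toList_zero]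

theorem isLeftHyperedge_S₂ : IsLeftHyperedge
    {(node (node 0 0) (node (node 0 0) 0), 1), (node (node 0 (node (node 0 0) 0)) 0, 7),
      (node (node (node 0 (node 0 0)) 0) 0, 5)} := by
  refine ⟨S₂, [], [], ⟨S₂, Or.inr (Or.inl rfl), Or.inl rfl⟩, ?_⟩
  simp [S₂, toList_node, toList_zero]

theorem isLeftHyperedge_S₃ : IsLeftHyperedge
    {(node (node (node 0 0) 0) 0, 5), (node 0 (node (node 0 0) 0), 4),
      (node 0 (node 0 (node 0 0)), 0)} := by
  refine ⟨S₃, [], [], ⟨S₃, Or.inr (Or.inr (Or.inl rfl)), Or.inl rfl⟩, ?_⟩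
  simp [S₃, toList_node, toList_zero]

theorem isLeftHyperedge_S₄ : IsLeftHyperedge
    {(node (node (node 0 0) 0) 0, 5), (node (node 0 (node 0 0)) 0, 4),
      (node 0 (node (node 0 0) 0), 2), (node 0 (node 0 (node 0 0)), 0)} := by
  refine ⟨S₄, [], [], ⟨S₄, Or.inr (Or.inr (Or.inr rfl)), Or.inl rfl⟩, ?_⟩
  simp [S₄, toList_node, toList_zero]

/-- The hyperedge `[0]00111y, 0[0]1011y, 001[1]01y, 01010[1]y`. -/
def crossEdge (y : DyckWord) : Finset (DyckWord × ℕ) :=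
  {(node (node (node 0 0) 0) y, 0), (node (node 0 (node 0 0)) y, 1),
    (node (node 0 0) (node 0 y), 3), (node 0 (node 0 (node 0 y)), 5)}

theorem isLeftHyperedge_crossEdge (y : DyckWord) : IsLeftHyperedge (crossEdge y) := by
  refine ⟨S₄.map reverseCompl, [], y.toList, ⟨S₄, Or.inr (Or.inr (Or.inr rfl)), Or.inr rfl⟩, ?_⟩
  simp [crossEdge, S₄, reverseCompl, compl, toList_node, toList_zero]

/-- A tree on the words of length `2n`, with some unused marks. -/
structure GoodTree (n : ℕ) (T : Set (Finset (DyckWord × ℕ))) : Prop where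
  tree : IsTreeOn {x | x.semilength = n} T
  notMem_two : ∀ i y, (node (alt (i + 1)) y, 2) ∉ used T
  notMem_three : (alt n, 3) ∉ used T
  notMem_one : (alt n, 1) ∉ used T

/-- Two trees that together cover the words of length `2(n + 2)`; the words `0011(01)ⁿ` and
`(01)ⁿ⁺²` are in different trees. -/
structure GoodForest (n : ℕ) (V₁ V₂ : Set DyckWord) (F₁ F₂ : Set (Finset (DyckWord × ℕ))) :
    Prop where
  tree₁ : IsTreeOn V₁ F₁
  tree₂ : IsTreeOn V₂ F₂
  disj : ∀ x ∈ V₁, x ∉ V₂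
  cover : ∀ x, x ∈ V₁ ∨ x ∈ V₂ ↔ x.semilength = n + 2
  mem₁ : node (node 0 0) (alt n) ∈ V₁
  mem₂ : alt (n + 2) ∈ V₂
  notMem₁ : (node (node 0 0) (alt n), 0) ∉ used F₁
  notMem₂ : (alt (n + 2), 1) ∉ used F₂

theorem alt_succ (n : ℕ) : alt (n + 1) = node 0 (alt n) := rfl

/-- The words `0u1y` for fixed `y`, and one further word, are covered by a tree. -/
theorem GoodForest.exists_column {i : ℕ} {V₁ V₂ : Set DyckWord}
    {F₁ F₂ : Set (Finset (DyckWord × ℕ))} (h : GoodForest i V₁ V₂ F₁ F₂) (y : DyckWord) :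
    ∃ V S, IsTreeOn V S ∧
      (∀ x, x ∈ V ↔ (∃ u, u.semilength = i + 2 ∧ x = node u y) ∨ x = node 0 (node (alt (i + 1)) y)) ∧
      (∀ m, (node 0 (node (alt (i + 1)) y), m) ∈ used S → m = 4) ∧
      (node (alt (i + 2)) y, 2) ∉ used S := by
  have e : alt (i + 2) = node 0 (node 0 (alt i)) := rfl
  have e' : alt (i + 1) = node 0 (alt i) := rfl
  have h0 : ∀ u, (node u y).toList = [U] ++ u.toList ++ (D :: y.toList) := toList_node_left y
  have t₁ := h.tree₁.map (f := fun u => node u y) h0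
  have t₂ := h.tree₂.map (f := fun u => node u y) h0
  rw [show [U].length = 1 from rfl] at t₁ t₂
  have hub := isTreeOn_singleton (isLeftHyperedge_linkEdge (alt i) y)
  have hV0 : ∀ x ∈ V₁, x ≠ 0 := fun x hx h0 => by
    have := (h.cover x).1 (Or.inl hx)
    rw [h0] at this; simp at this
  have hV0' : ∀ x ∈ V₂, x ≠ 0 := fun x hx h0 => by
    have := (h.cover x).1 (Or.inr hx)
    rw [h0] at this; simp at this
  have m₁ := h.mem₁
  have m₂ := h.mem₂
  have n₁ := h.notMem₁
  have n₂ := h.notMem₂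
  rw [e] at m₂ n₂
  -- The linking hyperedge marks place `1` here. In the nested family this is the inner mark `0`,
  -- which `notMem₁` keeps free.
  have g₁ := hub.glue_one t₁ (node (node (node 0 0) (alt i)) y) (by
    intro x
    simp only [linkEdge, Finset.mem_insert, Finset.mem_singleton, Prod.mk.injEq,
      Set.mem_ofPred_eq, Set.mem_image]
    constructor
    · rintro ⟨⟨m, hx | hx | hx⟩, u, hu, hux⟩
      · exact hx.1
      · obtain rfl : u = _ := (node_inj.1 (hux.trans hx.1)).1
        exact absurd m₂ (h.disj _ hu)
      · exact absurd (node_inj.1 (hux.trans hx.1)).1 (hV0 _ hu)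
    · rintro rfl
      exact ⟨⟨1, Or.inl ⟨rfl, rfl⟩⟩, _, m₁, rfl⟩) (by
    intro m hm hm'
    obtain ⟨u, j, hu, hux, rfl⟩ := mem_used_map.1 hm
    obtain rfl := (node_inj.1 hux).1
    simp [mem_used_singleton, linkEdge] at hm'
    subst hm'
    exact n₁ hu)
  -- The linking hyperedge marks place `0` here, and marks of a nested family are at least `1`.
  have g₂ := g₁.glue_one t₂ (node (node 0 (node 0 (alt i))) y) (by
    intro x
    simp only [linkEdge, Finset.mem_insert, Finset.mem_singleton, Prod.mk.injEq,
      Set.mem_ofPred_eq, Set.mem_image, Set.mem_union]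
    constructor
    · rintro ⟨⟨m, hx | hx | hx⟩ | ⟨u', hu', hux'⟩, u, hu, hux⟩
      · obtain rfl : u = _ := (node_inj.1 (hux.trans hx.1)).1
        exact absurd hu (h.disj _ m₁)
      · exact hx.1
      · exact absurd (node_inj.1 (hux.trans hx.1)).1 (hV0' _ hu)
      · obtain rfl := (node_inj.1 (hux.trans hux'.symm)).1
        exact absurd hu (h.disj _ hu')
    · rintro rfl
      exact ⟨Or.inl ⟨0, Or.inr (Or.inl ⟨rfl, rfl⟩)⟩, _, m₂, rfl⟩) (by
    intro m hm hm'
    obtain ⟨u, j, hu, hux, rfl⟩ := mem_used_map.1 hm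
    rcases mem_used_union.1 hm' with hm' | hm'
    · simp [mem_used_singleton, linkEdge] at hm'
    · obtain ⟨u', j', hu', hux', _⟩ := mem_used_map.1 hm'
      obtain rfl := (node_inj.1 hux').1
      exact h.disj _ (h.tree₁.sub _ hu') m₂)
  refine ⟨_, _, g₂, ?_, ?_, ?_⟩
  · intro x
    simp only [linkEdge, Finset.mem_insert, Finset.mem_singleton, Prod.mk.injEq,
      Set.mem_ofPred_eq, Set.mem_image, Set.mem_union, e']
    constructor
    · rintro ((⟨m, hx | hx | hx⟩ | ⟨u, hu, hux⟩) | ⟨u, hu, hux⟩)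
      · exact Or.inl ⟨_, (h.cover _).1 (Or.inl m₁), hx.1⟩
      · exact Or.inl ⟨_, (h.cover _).1 (Or.inr m₂), hx.1⟩
      · exact Or.inr hx.1
      · exact Or.inl ⟨_, (h.cover _).1 (Or.inl hu), hux.symm⟩
      · exact Or.inl ⟨_, (h.cover _).1 (Or.inr hu), hux.symm⟩
    · rintro (⟨u, hu, rfl⟩ | rfl)
      · rcases (h.cover u).2 hu with hu | hu
        · exact Or.inl (Or.inr ⟨u, hu, rfl⟩)
        · exact Or.inr ⟨u, hu, rfl⟩
      · exact Or.inl (Or.inl ⟨4, Or.inr (Or.inr ⟨rfl, rfl⟩)⟩)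
  · intro m hm
    rcases mem_used_union.1 hm with hm | hm
    · rcases mem_used_union.1 hm with hm | hm
      · simpa [mem_used_singleton, linkEdge, e'] using hm
      · obtain ⟨u, j, hu, hux, _⟩ := mem_used_map.1 hm
        exact absurd (node_inj.1 hux).1.symm (hV0 _ (h.tree₁.sub _ hu))
    · obtain ⟨u, j, hu, hux, _⟩ := mem_used_map.1 hm
      exact absurd (node_inj.1 hux).1.symm (hV0' _ (h.tree₂.sub _ hu))
  · intro hm
    rw [e] at hm
    rcases mem_used_union.1 hm with hm | hm
    · rcases mem_used_union.1 hm with hm | hm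
      · simp [mem_used_singleton, linkEdge] at hm
      · obtain ⟨u, j, hu, hux, _⟩ := mem_used_map.1 hm
        obtain rfl := (node_inj.1 hux).1
        exact h.disj _ (h.tree₁.sub _ hu) m₂
    · obtain ⟨u, j, hu, hux, hj⟩ := mem_used_map.1 hm
      obtain rfl := (node_inj.1 hux).1
      obtain rfl : j = 1 := by omega
      exact n₂ hu

/-- A tree on the words `01z` together with the words `0u1y` for `(|u|/2 - 2, y)` in `P`. -/
structure IsHub (N : ℕ) (T : Set (Finset (DyckWord × ℕ))) (P : Set (ℕ × DyckWord))
    (V : Set DyckWord) (S : Set (Finset (DyckWord × ℕ))) : Prop where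
  tree : IsTreeOn V S
  mem : ∀ x, x ∈ V ↔ (∃ z, z.semilength = N ∧ x = node 0 z) ∨
    ∃ c ∈ P, ∃ u, u.semilength = c.1 + 2 ∧ x = node u c.2
  used_node_zero : ∀ z m, (node 0 z, m) ∈ used S → (∃ j, m = 2 + j ∧ (z, j) ∈ used T) ∨ m = 4
  notMem : ∀ c ∈ P, (node (alt (c.1 + 2)) c.2, 2) ∉ used S

/-- Each column meets the words `01z` only in `01·0(01)ⁱ⁺¹1y`, where it uses only the mark `4 = 2 +
2`. The mark `2` of the word after the initial `01` is free by `notMem_two`. Different columns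
attach at different words. -/
theorem GoodTree.exists_isHub {N : ℕ} {T : Set (Finset (DyckWord × ℕ))} (hT : GoodTree N T)
    {P : Set (ℕ × DyckWord)} (hP : ∀ c ∈ P, c.1 + 2 + c.2.semilength = N ∧
      ∃ V₁ V₂ F₁ F₂, GoodForest c.1 V₁ V₂ F₁ F₂) : ∃ V S, IsHub N T P V S := by
  have hcol : ∀ c : P, ∃ V S, IsTreeOn V S ∧
      (∀ x, x ∈ V ↔ (∃ u, u.semilength = c.1.1 + 2 ∧ x = node u c.1.2) ∨
        x = node 0 (node (alt (c.1.1 + 1)) c.1.2)) ∧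
      (∀ m, (node 0 (node (alt (c.1.1 + 1)) c.1.2), m) ∈ used S → m = 4) ∧
      (node (alt (c.1.1 + 2)) c.1.2, 2) ∉ used S := fun c => by
    obtain ⟨V₁, V₂, F₁, F₂, h⟩ := (hP c.1 c.2).2
    exact h.exists_column c.1.2
  choose V S ht hV hm hn using hcol
  have t₀ := hT.tree.map toList_node_zero
  rw [show [U, D].length = 2 from rfl] at t₀
  have hsem : ∀ c : P, (node (alt (c.1.1 + 1)) c.1.2).semilength = N := fun c => by
    have := (hP c.1 c.2).1
    rw [semilength_node, semilength_alt]; omega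
  have g := t₀.glue ht (fun c => node 0 (node (alt (c.1.1 + 1)) c.1.2)) (by
    intro c x
    rw [hV]
    simp only [Set.mem_image, Set.mem_ofPred_eq]
    constructor
    · rintro ⟨⟨z, hz, rfl⟩, ⟨u, hu, hux⟩ | hx⟩
      · obtain rfl := (node_inj.1 hux).1
        simp at hu
      · exact hx
    · rintro rfl
      exact ⟨⟨_, hsem c, rfl⟩, Or.inr rfl⟩) (by
    rintro c d hcd x hx hx'
    rw [hV] at hx hx'
    rcases hx with ⟨u, hu, rfl⟩ | rfl <;> rcases hx' with ⟨u', hu', hx'⟩ | hx'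
    · obtain ⟨rfl, h2⟩ := node_inj.1 hx'
      exact hcd (Subtype.ext (Prod.ext (by omega) h2))
    · obtain rfl := (node_inj.1 hx').1
      simp at hu
    · obtain rfl := (node_inj.1 hx').1
      simp at hu'
    · obtain ⟨h1, h2⟩ := node_inj.1 (node_inj.1 hx').2
      have := congrArg DyckWord.semilength h1
      rw [semilength_alt, semilength_alt] at this
      exact hcd (Subtype.ext (Prod.ext (by omega) h2))) (by
    intro c m hm1 hm2
    obtain rfl := hm c m hm1
    obtain ⟨z, j, hz, hzx, hj⟩ := mem_used_map.1 hm2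
    obtain rfl := (node_inj.1 hzx).2
    obtain rfl : j = 2 := by omega
    exact hT.notMem_two _ _ hz)
  refine ⟨_, _, g, ?_, ?_, ?_⟩
  · intro x
    simp only [Set.mem_union, Set.mem_image, Set.mem_ofPred_eq, Set.mem_iUnion, hV]
    constructor
    · rintro (⟨z, hz, rfl⟩ | ⟨c, ⟨u, hu, rfl⟩ | rfl⟩)
      · exact Or.inl ⟨z, hz, rfl⟩
      · exact Or.inr ⟨c.1, c.2, u, hu, rfl⟩
      · exact Or.inl ⟨_, hsem c, rfl⟩
    · rintro (⟨z, hz, rfl⟩ | ⟨c, hc, u, hu, rfl⟩)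
      · exact Or.inl ⟨z, hz, rfl⟩
      · exact Or.inr ⟨⟨c, hc⟩, Or.inl ⟨u, hu, rfl⟩⟩
  · intro z m hm1
    rcases mem_used_union.1 hm1 with hm1 | hm1
    · obtain ⟨z', j, hz, hzx, rfl⟩ := mem_used_map.1 hm1
      obtain rfl := (node_inj.1 hzx).2
      exact Or.inl ⟨j, rfl, hz⟩
    · obtain ⟨c, hc⟩ := mem_used_iUnion.1 hm1
      rcases (hV c _).1 ((ht c).sub _ hc) with ⟨u, hu, hux⟩ | hx
      · simp only at hux
        obtain rfl := (node_inj.1 hux).1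
        simp at hu
      · simp only at hx
        rw [hx] at hc
        exact Or.inr (hm c m hc)
  · intro c hc hm1
    rcases mem_used_union.1 hm1 with hm1 | hm1
    · obtain ⟨z, j, hz, hzx, _⟩ := mem_used_map.1 hm1
      simp [alt_succ] at hzx
    · obtain ⟨d, hd⟩ := mem_used_iUnion.1 hm1
      rcases (hV d _).1 ((ht d).sub _ hd) with ⟨u, hu, hux⟩ | hx
      · simp only at hux
        obtain ⟨rfl, h2⟩ := node_inj.1 hux
        rw [semilength_alt] at hu
        have : d.1.1 = c.1 := by omega
        have h3 := hn d
        rw [this, ← h2] at h3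
        exact h3 hd
      · simp [alt_succ] at hx

theorem isTreeOn_node_one {N : ℕ} {T : Set (Finset (DyckWord × ℕ))}
    (h : IsTreeOn {x | x.semilength = N} T) :
    IsTreeOn (node (node 0 0) '' {x | x.semilength = N}) (mapFamily (node (node 0 0)) 4 T) := by
  have := h.map toList_node_one
  rwa [show [U, U, D, D].length = 4 from rfl] at this

/-- One tree consists of the words `0011z`, the other of the words `01z` with all columns. The
required marks are free because the marks are shifted by `4` in the first and by `2` along the words
`01z`, where the columns add only the mark `4`. -/
theorem GoodTree.forest_step {m : ℕ} {T T' : Set (Finset (DyckWord × ℕ))} (hT : GoodTree (m + 2) T)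
    (hT' : IsTreeOn {x | x.semilength = m + 1} T')
    (hF : ∀ i ≤ m, ∃ V₁ V₂ F₁ F₂, GoodForest i V₁ V₂ F₁ F₂) :
    ∃ V₁ V₂ F₁ F₂, GoodForest (m + 1) V₁ V₂ F₁ F₂ := by
  obtain ⟨V, S, h⟩ := hT.exists_isHub (P := {c | c.1 + 2 + c.2.semilength = m + 2})
    (fun c hc => ⟨hc, hF c.1 (by simp at hc; omega)⟩)
  refine ⟨_, V, _, S, isTreeOn_node_one hT', h.tree, ?_, ?_, ?_, ?_, ?_, ?_⟩
  · rintro _ ⟨z, hz, rfl⟩ hx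
    rcases (h.mem _).1 hx with ⟨z', hz', he⟩ | ⟨c, hc, u, hu, he⟩
    · simp at he
    · obtain rfl := (node_inj.1 he).1
      simp [semilength_node] at hu
  · intro x
    rw [h.mem]
    constructor
    · rintro (⟨z, hz, rfl⟩ | ⟨z, hz, rfl⟩ | ⟨c, hc, u, hu, rfl⟩)
      · simp only [Set.mem_ofPred_eq] at hz
        simp [semilength_node]; omega
      · simp [semilength_node]; omega
      · simp only [Set.mem_ofPred_eq] at hc
        rw [semilength_node]; omega
    · intro hx
      obtain ⟨u, y, rfl, hs⟩ := semilength_eq_succ.1 hx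
      obtain h0 | h0 | h0 : u.semilength = 0 ∨ u.semilength = 1 ∨ 2 ≤ u.semilength := by omega
      · rw [semilength_eq_zero.1 h0]
        exact Or.inr (Or.inl ⟨y, by omega, rfl⟩)
      · rw [semilength_eq_one.1 h0]
        exact Or.inl ⟨y, by simp only [Set.mem_ofPred_eq]; omega, rfl⟩
      · exact Or.inr (Or.inr ⟨(u.semilength - 2, y), by simp only [Set.mem_ofPred_eq]; omega, u,
          by simp only; omega, rfl⟩)
  · exact ⟨_, semilength_alt _, rfl⟩
  · exact (h.mem _).2 (Or.inl ⟨alt (m + 2), semilength_alt _, rfl⟩)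
  · intro hm
    obtain ⟨_, j, _, _, hj⟩ := mem_used_map.1 hm
    omega
  · intro hm
    rcases h.used_node_zero _ _ hm with ⟨j, hj, _⟩ | hj <;> omega

/-- The column `0u1(01)ᵐ` with `|u| = 4` is left out. Its two words are covered by `crossEdge (alt
m)`, which also contains `0011(01)ᵐ⁺¹` and `(01)ᵐ⁺³` and so joins the words `0011z` to the hub. -/
theorem GoodTree.step {m : ℕ} {T T' : Set (Finset (DyckWord × ℕ))} (hT : GoodTree (m + 2) T)
    (hT' : IsTreeOn {x | x.semilength = m + 1} T')
    (hF : ∀ i ≤ m, ∃ V₁ V₂ F₁ F₂, GoodForest i V₁ V₂ F₁ F₂) : ∃ S, GoodTree (m + 3) S := by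
  obtain ⟨V, S, h⟩ := hT.exists_isHub
    (P := {c | c.1 + 2 + c.2.semilength = m + 2 ∧ c ≠ (0, alt m)})
    (fun c hc => ⟨hc.1, hF c.1 (by have := hc.1; omega)⟩)
  have hcross := isTreeOn_singleton (isLeftHyperedge_crossEdge (alt m))
  have hside := hcross.glue_one (isTreeOn_node_one hT') (node (node 0 0) (alt (m + 1))) (by
    intro x
    simp only [crossEdge, Finset.mem_insert, Finset.mem_singleton, Prod.mk.injEq,
      Set.mem_ofPred_eq, Set.mem_image]
    constructor
    · rintro ⟨⟨i, hx | hx | hx | hx⟩, z, hz, hzx⟩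
      · simp [hx.1] at hzx
      · simp [hx.1] at hzx
      · exact hx.1
      · simp [hx.1] at hzx
    · rintro rfl
      exact ⟨⟨3, Or.inr (Or.inr (Or.inl ⟨rfl, rfl⟩))⟩, _, semilength_alt _, rfl⟩) (by
    intro i hi hi'
    obtain ⟨_, j, _, _, rfl⟩ := mem_used_map.1 hi
    simp [mem_used_singleton, crossEdge, alt_succ] at hi'
    omega)
  have hx0 : ∀ u y, node u y ∈ V → u ≠ 0 → 2 ≤ u.semilength ∧ (u.semilength = 2 → y ≠ alt m) := by
    intro u y hx hu
    rcases (h.mem _).1 hx with ⟨z, _, he⟩ | ⟨c, hc, u', hu', he⟩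
    · exact absurd (node_inj.1 he).1 hu
    · obtain ⟨rfl, rfl⟩ := node_inj.1 he
      refine ⟨by omega, fun h2 hy => hc.2 (Prod.ext ?_ hy)⟩
      simp only; omega
  have g := h.tree.glue_one hside (alt (m + 3)) (by
    intro x
    simp only [crossEdge, Finset.mem_insert, Finset.mem_singleton, Prod.mk.injEq,
      Set.mem_ofPred_eq, Set.mem_image, Set.mem_union]
    constructor
    · rintro ⟨hx, ⟨i, hi | hi | hi | hi⟩ | ⟨z, hz, rfl⟩⟩
      · rw [hi.1] at hx
        exact absurd rfl ((hx0 _ _ hx (by simp)).2 (by simp [semilength_node]))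
      · rw [hi.1] at hx
        exact absurd rfl ((hx0 _ _ hx (by simp)).2 (by simp [semilength_node]))
      · rw [hi.1] at hx
        have := (hx0 _ _ hx (by simp)).1
        simp [semilength_node] at this
      · exact hi.1
      · have := (hx0 _ _ hx (by simp)).1
        simp [semilength_node] at this
    · rintro rfl
      exact ⟨(h.mem _).2 (Or.inl ⟨alt (m + 2), semilength_alt _, rfl⟩),
        Or.inl ⟨5, Or.inr (Or.inr (Or.inr ⟨rfl, rfl⟩))⟩⟩) (by
    intro i hi hi'
    -- The crossing hyperedge marks place `5 = 2 + 3` of `(01)ᵐ⁺³`, which is free by `notMem_three`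
    -- of the smaller tree.
    have h5 : i = 5 := by
      rcases mem_used_union.1 hi with hi | hi
      · simpa [mem_used_singleton, crossEdge, alt_succ] using hi
      · obtain ⟨_, j, _, he, _⟩ := mem_used_map.1 hi
        simp [alt_succ] at he
    subst h5
    rcases h.used_node_zero _ _ hi' with ⟨j, hj, hju⟩ | hj
    · obtain rfl : j = 3 := by omega
      exact hT.notMem_three hju
    · omega)
  refine ⟨S ∪ ({crossEdge (alt m)} ∪ mapFamily (node (node 0 0)) 4 T'), ?_, ?_, ?_, ?_⟩
  · convert g using 1
    ext x
    simp only [crossEdge, Finset.mem_insert, Finset.mem_singleton, Prod.mk.injEq,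
      Set.mem_ofPred_eq, Set.mem_image, Set.mem_union]
    rw [h.mem]
    constructor
    · intro hx
      obtain ⟨u, y, rfl, hs⟩ := semilength_eq_succ.1 hx
      obtain h0 | h0 | h0 : u.semilength = 0 ∨ u.semilength = 1 ∨ 2 ≤ u.semilength := by omega
      · rw [semilength_eq_zero.1 h0]
        exact Or.inl (Or.inl ⟨y, by omega, rfl⟩)
      · rw [semilength_eq_one.1 h0]
        exact Or.inr (Or.inr ⟨y, by omega, rfl⟩)
      · by_cases hc : u.semilength = 2 ∧ y = alt m
        · obtain ⟨h2, rfl⟩ := hc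
          rcases semilength_eq_two.1 h2 with rfl | rfl
          · exact Or.inr (Or.inl ⟨1, Or.inr (Or.inl ⟨rfl, rfl⟩)⟩)
          · exact Or.inr (Or.inl ⟨0, Or.inl ⟨rfl, rfl⟩⟩)
        · refine Or.inl (Or.inr ⟨(u.semilength - 2, y), ⟨by simp only; omega, fun he => hc ?_⟩, u,
            by simp only; omega, rfl⟩)
          rw [Prod.mk.injEq] at he
          exact ⟨by omega, he.2⟩
    · rintro ((⟨z, hz, rfl⟩ | ⟨c, hc, u, hu, rfl⟩) | ⟨i, hi | hi | hi | hi⟩ | ⟨z, hz, rfl⟩)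
      · simp [semilength_node]; omega
      · have := hc.1
        rw [semilength_node]; omega
      all_goals first
        | (rw [hi.1]; simp [semilength_node, semilength_alt]; try omega)
        | (simp [semilength_node]; omega)
  · intro i y hm
    rcases mem_used_union.1 hm with hm | hm
    · rcases (h.mem _).1 (h.tree.sub _ hm) with ⟨z, _, he⟩ | ⟨c, hc, u, hu, he⟩
      · simp [alt_succ] at he
      · simp only at he
        obtain ⟨rfl, rfl⟩ := node_inj.1 he
        rw [semilength_alt] at hu
        obtain rfl : i = c.1 + 1 := by omega
        exact h.notMem c hc hm
    · rcases mem_used_union.1 hm with hm | hm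
      · simp [mem_used_singleton, crossEdge, alt_succ] at hm
      · obtain ⟨_, j, _, _, hj⟩ := mem_used_map.1 hm
        omega
  -- Mark `3 = 2 + 1` is free because `1` was free in the smaller tree. Mark `1` is free because the
  -- words `01z` of the hub only have marks at least `2`.
  · intro hm
    rcases mem_used_union.1 hm with hm | hm
    · rcases h.used_node_zero _ _ hm with ⟨j, hj, hju⟩ | hj
      · obtain rfl : j = 1 := by omega
        exact hT.notMem_one hju
      · omega
    · rcases mem_used_union.1 hm with hm | hm
      · simp [mem_used_singleton, crossEdge, alt_succ] at hm
      · obtain ⟨_, j, _, _, hj⟩ := mem_used_map.1 hm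
        omega
  · intro hm
    rcases mem_used_union.1 hm with hm | hm
    · rcases h.used_node_zero _ _ hm with ⟨j, hj, hju⟩ | hj <;> omega
    · rcases mem_used_union.1 hm with hm | hm
      · simp [mem_used_singleton, crossEdge, alt_succ] at hm
      · obtain ⟨_, j, _, _, hj⟩ := mem_used_map.1 hm
        omega

end Construction

/-! ### Trees on short words and the induction -/

section SmallTrees

/-- The first tuple with empty `w` and the third tuple cover the five words and meet only in
`000111`, with marks `4` and `5`. -/
theorem exists_goodTree_three : ∃ T, GoodTree 3 T := by
  have t₁ := isTreeOn_singleton (isLeftHyperedge_S₁ 0)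
  have t₂ := isTreeOn_singleton isLeftHyperedge_S₃
  have t := t₁.glue_one t₂ (node (node (node 0 0) 0) 0) (by
    intro x
    simp only [Finset.mem_insert, Finset.mem_singleton, Prod.mk.injEq, Set.mem_ofPred_eq]
    constructor
    · rintro ⟨⟨i, h | h | h⟩, j, h' | h' | h'⟩ <;> obtain ⟨rfl, -⟩ := h <;> simp_all
    · rintro rfl
      exact ⟨⟨4, Or.inl ⟨rfl, rfl⟩⟩, 5, Or.inl ⟨rfl, rfl⟩⟩) (by
    intro m hm hm'
    simp [mem_used_singleton] at hm hm'
    omega)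
  refine ⟨_, IsTreeOn.congr t ?_, ?_, ?_, ?_⟩
  · intro x
    simp [exists_or, semilength_eq_three]
    tauto
  all_goals simp [used, alt]

theorem isLeftHyperedge_nest_S₃ : IsLeftHyperedge
    {(node (node (node (node 0 0) 0) 0) 0, 6), (node (node 0 (node (node 0 0) 0)) 0, 5),
      (node (node 0 (node 0 (node 0 0))) 0, 1)} := by
  refine ⟨S₃, [U], [D], ⟨S₃, Or.inr (Or.inr (Or.inl rfl)), Or.inl rfl⟩, ?_⟩
  simp [S₃, toList_node, toList_zero]

/-- The words `0u1` of length `8`, the word `00110011`, and one further word are covered by a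
tree. -/
theorem exists_column_four : ∃ V S, IsTreeOn V S ∧
    (∀ x, x ∈ V ↔ (∃ u, u.semilength = 3 ∧ x = node u 0) ∨
      x = node (node 0 0) (node (node 0 0) 0) ∨ x = node 0 (node (alt 2) 0)) ∧
    (∀ m, (node 0 (node (alt 2) 0), m) ∈ used S → m = 4) ∧
    (∀ x, (x, 2) ∉ used S) ∧ ∀ y, (node 0 y, 1) ∉ used S := by
  have t₁ := isTreeOn_singleton isLeftHyperedge_nest_S₃
  have t₂ := isTreeOn_singleton isLeftHyperedge_S₂
  have t₃ := isTreeOn_singleton (isLeftHyperedge_linkEdge (alt 1) 0)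
  have t := t₁.glue_one t₂ (node (node 0 (node (node 0 0) 0)) 0) (by
    intro x
    simp only [Finset.mem_insert, Finset.mem_singleton, Prod.mk.injEq, Set.mem_ofPred_eq]
    constructor
    · rintro ⟨⟨i, h | h | h⟩, j, h' | h' | h'⟩ <;> obtain ⟨rfl, -⟩ := h <;> simp_all
    · rintro rfl
      exact ⟨⟨5, Or.inr (Or.inl ⟨rfl, rfl⟩)⟩, 7, Or.inr (Or.inl ⟨rfl, rfl⟩)⟩) (by
    intro m hm hm'
    simp [mem_used_singleton] at hm hm'
    omega)
  have t' := t.glue_one t₃ (node (alt 3) 0) (by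
    intro x
    simp only [Finset.mem_insert, Finset.mem_singleton, Prod.mk.injEq, Set.mem_ofPred_eq,
      Set.mem_union, linkEdge, alt]
    constructor
    · rintro ⟨⟨i, h | h | h⟩ | ⟨i, h | h | h⟩, j, h' | h' | h'⟩ <;> obtain ⟨rfl, -⟩ := h <;>
        simp_all
    · rintro rfl
      exact ⟨Or.inl ⟨1, Or.inr (Or.inr ⟨rfl, rfl⟩)⟩, 0, Or.inr (Or.inl ⟨rfl, rfl⟩)⟩) (by
    intro m hm hm'
    simp [used, linkEdge, alt] at hm hm'
    omega)
  refine ⟨_, _, t', ?_, ?_, ?_, ?_⟩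
  · intro x
    simp [exists_or, semilength_eq_three, linkEdge, alt]
    tauto
  all_goals simp [used, linkEdge, alt]

/-- For length `8` a tree on the words `0011z` is not available, as no hyperedge fits on the two
words `z` of length `4`. Here `00110011` is attached through the second tuple instead. Only
`00110101`, `00101101` and `00011101` remain uncovered. -/
theorem exists_hub_four {T : Set (Finset (DyckWord × ℕ))} (hT : GoodTree 3 T) :
    ∃ V S, IsTreeOn V S ∧
    (∀ x, x ∈ V ↔ (∃ z, z.semilength = 3 ∧ x = node 0 z) ∨ (∃ u, u.semilength = 3 ∧ x = node u 0) ∨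
      x = node (node 0 0) (node (node 0 0) 0)) ∧
    (∀ z m, (node 0 z, m) ∈ used S → (∃ j, m = 2 + j ∧ (z, j) ∈ used T) ∨ m = 4) ∧
    ∀ i y, (node (alt (i + 1)) y, 2) ∉ used S := by
  obtain ⟨V, S, hS, hV, h4, h2, h1⟩ := exists_column_four
  have t := hT.tree.map toList_node_zero
  rw [show [U, D].length = 2 from rfl] at t
  have g := t.glue_one hS (node 0 (node (alt 2) 0)) (by
    intro x
    rw [hV]
    constructor
    · rintro ⟨⟨z, hz, rfl⟩, ⟨u, hu, hux⟩ | hx | hx⟩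
      · obtain rfl := (node_inj.1 hux).1
        simp at hu
      · simp at hx
      · exact hx
    · rintro rfl
      exact ⟨⟨_, by simp [semilength_node, semilength_alt], rfl⟩, Or.inr (Or.inr rfl)⟩) (by
    intro m hm hm'
    obtain rfl := h4 m hm
    obtain ⟨z, j, hz, hzx, hj⟩ := mem_used_map.1 hm'
    obtain rfl := (node_inj.1 hzx).2
    obtain rfl : j = 2 := by omega
    exact hT.notMem_two _ _ hz)
  refine ⟨_, _, g, ?_, ?_, ?_⟩
  · intro x
    simp only [Set.mem_union, Set.mem_image, Set.mem_ofPred_eq, hV]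
    constructor
    · rintro (⟨z, hz, rfl⟩ | h | rfl | rfl)
      · exact Or.inl ⟨z, hz, rfl⟩
      · exact Or.inr (Or.inl h)
      · exact Or.inr (Or.inr rfl)
      · exact Or.inl ⟨_, by simp [semilength_node, semilength_alt], rfl⟩
    · rintro (⟨z, hz, rfl⟩ | h | rfl)
      · exact Or.inl ⟨z, hz, rfl⟩
      · exact Or.inr (Or.inl h)
      · exact Or.inr (Or.inr (Or.inl rfl))
  · intro z m hm
    rcases mem_used_union.1 hm with hm | hm
    · obtain ⟨z', j, hz, hzx, rfl⟩ := mem_used_map.1 hm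
      obtain rfl := (node_inj.1 hzx).2
      exact Or.inl ⟨j, rfl, hz⟩
    · rcases (hV _).1 (hS.sub _ hm) with ⟨u, hu, hux⟩ | hx | hx
      · obtain rfl := (node_inj.1 hux).1
        simp at hu
      · simp at hx
      · simp only at hx
        rw [hx] at hm
        exact Or.inr (h4 m hm)
  · intro i y hm
    rcases mem_used_union.1 hm with hm | hm
    · obtain ⟨z, j, hz, hzx, _⟩ := mem_used_map.1 hm
      simp [alt_succ] at hzx
    · exact h2 _ hm

theorem semilength_eq_four {x : DyckWord} : x.semilength = 4 ↔
    (∃ z, z.semilength = 3 ∧ x = node 0 z) ∨ (∃ u, u.semilength = 3 ∧ x = node u 0) ∨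
    x = node (node 0 0) (node (node 0 0) 0) ∨ x = node (node 0 0) (node 0 (node 0 0)) ∨
    x = node (node 0 (node 0 0)) (node 0 0) ∨ x = node (node (node 0 0) 0) (node 0 0) := by
  rw [semilength_eq_succ]
  constructor
  · rintro ⟨u, y, rfl, h⟩
    obtain h0 | h0 | h0 | h0 : u.semilength = 0 ∨ u.semilength = 1 ∨ u.semilength = 2 ∨
      u.semilength = 3 := by omega
    · rw [semilength_eq_zero.1 h0]
      exact Or.inl ⟨y, by omega, rfl⟩
    · rw [semilength_eq_one.1 h0]
      rcases semilength_eq_two.1 (by omega : y.semilength = 2) with rfl | rfl <;> simp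
    · rw [semilength_eq_one.1 (by omega : y.semilength = 1)]
      rcases semilength_eq_two.1 h0 with rfl | rfl <;> simp
    · rw [semilength_eq_zero.1 (by omega : y.semilength = 0)]
      exact Or.inr (Or.inl ⟨u, h0, rfl⟩)
  · rintro (⟨z, hz, rfl⟩ | ⟨u, hu, rfl⟩ | rfl | rfl | rfl | rfl)
    · exact ⟨_, _, rfl, by simp [hz]⟩
    · exact ⟨_, _, rfl, by simp [hu]⟩
    all_goals exact ⟨_, _, rfl, by simp [semilength_node]⟩

/-- The three remaining words form a hyperedge with `(01)⁴`, which attaches them at the mark `5 = 2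
+ 3`. -/
theorem GoodTree.exists_four {T : Set (Finset (DyckWord × ℕ))} (hT : GoodTree 3 T) :
    ∃ S, GoodTree 4 S := by
  obtain ⟨V, S, hS, hV, h0, h2⟩ := exists_hub_four hT
  have t := isTreeOn_singleton (isLeftHyperedge_crossEdge (node 0 0))
  have g := hS.glue_one t (alt 4) (by
    intro x
    simp only [crossEdge, Finset.mem_insert, Finset.mem_singleton, Prod.mk.injEq,
      Set.mem_ofPred_eq, hV]
    constructor
    · rintro ⟨hx, i, h | h | h | h⟩ <;> obtain ⟨rfl, -⟩ := h
      · simp at hx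
      · simp at hx
      · simp at hx
      · rfl
    · rintro rfl
      exact ⟨Or.inl ⟨alt 3, semilength_alt _, rfl⟩, 5, Or.inr (Or.inr (Or.inr ⟨rfl, rfl⟩))⟩) (by
    intro m hm hm'
    obtain rfl : m = 5 := by simpa [mem_used_singleton, crossEdge, alt] using hm
    rcases h0 _ _ hm' with ⟨j, hj, hju⟩ | hj
    · obtain rfl : j = 3 := by omega
      exact hT.notMem_three hju
    · omega)
  refine ⟨_, g.congr ?_, ?_, ?_, ?_⟩
  · intro x
    simp only [crossEdge, Finset.mem_insert, Finset.mem_singleton, Prod.mk.injEq,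
      Set.mem_ofPred_eq, Set.mem_union, hV, semilength_eq_four]
    constructor
    · rintro (h | h | h | h | h | h)
      · exact Or.inl (Or.inl h)
      · exact Or.inl (Or.inr (Or.inl h))
      · exact Or.inl (Or.inr (Or.inr h))
      · exact Or.inr ⟨3, by simp [h]⟩
      · exact Or.inr ⟨1, by simp [h]⟩
      · exact Or.inr ⟨0, by simp [h]⟩
    · rintro ((h | h | h) | ⟨i, h | h | h | h⟩)
      · exact Or.inl h
      · exact Or.inr (Or.inl h)
      · exact Or.inr (Or.inr (Or.inl h))
      · simp [h.1]
      · simp [h.1]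
      · simp [h.1]
      · exact Or.inl ⟨alt 3, semilength_alt _, h.1⟩
  · intro i y hm
    rcases mem_used_union.1 hm with hm | hm
    · exact h2 _ _ hm
    · simp [mem_used_singleton, crossEdge] at hm
  · intro hm
    rcases mem_used_union.1 hm with hm | hm
    · rcases h0 _ _ hm with ⟨j, hj, hju⟩ | hj
      · obtain rfl : j = 1 := by omega
        exact hT.notMem_one hju
      · omega
    · simp [mem_used_singleton, crossEdge, alt] at hm
  · intro hm
    rcases mem_used_union.1 hm with hm | hm
    · rcases h0 _ _ hm with ⟨j, hj, hju⟩ | hj <;> omega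
    · simp [mem_used_singleton, crossEdge, alt] at hm

/-- The three remaining words are exactly a hyperedge of the first kind with suffix `01`, and form
the other tree of the forest. -/
theorem GoodTree.exists_forest_two {T : Set (Finset (DyckWord × ℕ))} (hT : GoodTree 3 T) :
    ∃ V₁ V₂ F₁ F₂, GoodForest 2 V₁ V₂ F₁ F₂ := by
  obtain ⟨V, S, hS, hV, h0, h2⟩ := exists_hub_four hT
  have t := isTreeOn_singleton (isLeftHyperedge_S₁ (node 0 0))
  refine ⟨_, V, _, S, t, hS, ?_, ?_, ?_, ?_, ?_, ?_⟩
  · simp only [Finset.mem_insert, Finset.mem_singleton, Prod.mk.injEq, Set.mem_ofPred_eq, hV]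
    rintro x ⟨i, h | h | h⟩ <;> obtain ⟨rfl, -⟩ := h <;> simp
  · intro x
    change _ ↔ x.semilength = 4
    simp only [Finset.mem_insert, Finset.mem_singleton, Prod.mk.injEq, Set.mem_ofPred_eq, hV,
      semilength_eq_four]
    constructor
    · rintro (⟨i, h | h | h⟩ | h | h | h) <;> simp [h]
    · rintro (h | h | h | h | h | h)
      · exact Or.inr (Or.inl h)
      · exact Or.inr (Or.inr (Or.inl h))
      · exact Or.inr (Or.inr (Or.inr h))
      · exact Or.inl ⟨1, by simp [h]⟩
      · exact Or.inl ⟨5, by simp [h]⟩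
      · exact Or.inl ⟨4, by simp [h]⟩
  · exact ⟨1, by simp [alt]⟩
  · exact (hV _).2 (Or.inl ⟨alt 3, semilength_alt _, rfl⟩)
  · simp [mem_used_singleton]
  · intro hm
    rcases h0 _ _ hm with ⟨j, hj, hju⟩ | hj <;> omega

theorem exists_goodForest_zero : ∃ V₁ V₂ F₁ F₂, GoodForest 0 V₁ V₂ F₁ F₂ := by
  refine ⟨_, _, _, _, isTreeOn_empty (node (node 0 0) 0), isTreeOn_empty (alt 2), ?_, ?_, rfl, rfl,
    mem_used_empty, mem_used_empty⟩
  · simp [alt]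
  · simp [alt, semilength_eq_two, or_comm]

theorem exists_goodForest_one : ∃ V₁ V₂ F₁ F₂, GoodForest 1 V₁ V₂ F₁ F₂ := by
  refine ⟨_, _, _, _, isTreeOn_empty (node (node 0 0) (alt 1)),
    isTreeOn_singleton isLeftHyperedge_S₄, ?_, ?_, rfl, ⟨0, by simp [alt]⟩,
    mem_used_empty, by simp [mem_used_singleton, alt]⟩
  · simp [alt]
  · intro x
    simp [alt, semilength_eq_three, exists_or]
    tauto

/-- Trees and forests feed each other in one induction. The forest for `n` has words of length `2(n
+ 2)`, one size below the tree for `n`, so in the last case it is built before that tree and used in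
it. -/
theorem exists_goodTree_and_goodForest (n : ℕ) :
    (∃ T, GoodTree (n + 3) T) ∧ ∃ V₁ V₂ F₁ F₂, GoodForest n V₁ V₂ F₁ F₂ := by
  induction n using Nat.strong_induction_on with
  | _ n ih =>
    obtain ⟨T₃, h₃⟩ := exists_goodTree_three
    match n, ih with
    | 0, _ => exact ⟨⟨T₃, h₃⟩, exists_goodForest_zero⟩
    | 1, _ => exact ⟨h₃.exists_four, exists_goodForest_one⟩
    | 2, ih =>
      have hF : ∀ i ≤ 2, ∃ V₁ V₂ F₁ F₂, GoodForest i V₁ V₂ F₁ F₂ := by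
        intro i hi
        rcases Nat.lt_or_ge i 2 with h | h
        · exact (ih i h).2
        · obtain rfl : i = 2 := by omega
          exact h₃.exists_forest_two
      obtain ⟨T₄, h₄⟩ := h₃.exists_four
      exact ⟨h₄.step h₃.tree hF, h₃.exists_forest_two⟩
    | m + 3, ih =>
      have hF : ∀ i ≤ m + 2, ∃ V₁ V₂ F₁ F₂, GoodForest i V₁ V₂ F₁ F₂ :=
        fun i hi => (ih i (by omega)).2
      obtain ⟨T, hT⟩ := (ih (m + 1) (by omega)).1
      obtain ⟨T', hT'⟩ := (ih m (by omega)).1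
      have hF' := hT.forest_step hT'.tree hF
      obtain ⟨T'', hT''⟩ := (ih (m + 2) (by omega)).1
      refine ⟨hT''.step (m := m + 3) hT.tree fun i hi => ?_, hF'⟩
      rcases Nat.lt_or_ge i (m + 3) with h | h
      · exact (ih i h).2
      · obtain rfl : i = m + 3 := by omega
        exact hF'

end SmallTrees

/-! ### Spanning trees of the hypergraph -/

section Conversion

variable {k : ℕ}

/-- The words of a marked tuple, with marks counted from the left. -/
def toLeft (g : MarkedTuple k) : Finset (DyckWord × ℕ) :=
  g.image fun p => (p.1.1, 2 * k - 1 - p.2)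

theorem IsLeftHyperedge.mem_lt {g : Finset (DyckWord × ℕ)} (h : IsLeftHyperedge g)
    {p : DyckWord × ℕ} (hp : p ∈ g) : p.2 < p.1.toList.length := by
  obtain ⟨τ, u, v, hτ, he⟩ := h
  have hmem := Finset.mem_image_of_mem (fun p : DyckWord × ℕ => (p.1.toList, p.2)) hp
  rw [he, List.mem_toFinset, List.mem_map] at hmem
  obtain ⟨m, hm, hmp⟩ := hmem
  rw [Prod.mk.injEq] at hmp
  have hpos : m.1.length ≠ 0 := by
    obtain ⟨σ, hσ, hτ⟩ := hτ
    have key : ∀ m ∈ σ, m.1.length ≠ 0 := by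
      rcases hσ with ⟨w, rfl⟩ | rfl | rfl | rfl <;> simp [S₁, S₂, S₃, S₄]
    rcases hτ with rfl | rfl
    · exact key m hm
    · obtain ⟨m', hm', rfl⟩ := List.mem_map.1 hm
      simpa [reverseCompl] using key m' hm'
  rw [← hmp.1, ← hmp.2]
  simp only [List.length_append]
  omega

theorem isHyperedge_of_toLeft {g : MarkedTuple k} (hg : ∀ p ∈ g, p.2 < 2 * k)
    (h : IsLeftHyperedge (toLeft g)) : IsHyperedge k g := by
  obtain ⟨τ, u, v, ⟨σ, hσ, hτ⟩, he⟩ := h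
  have key : g.image (fun p => (p.1.1.toList, p.2)) =
      (τ.map (insertBetween u v)).toFinset := by
    have h2 := congrArg
      (Finset.image fun p : List DyckStep × ℕ => (p.1, 2 * k - 1 - p.2)) he
    rw [toLeft, Finset.image_image, Finset.image_image, image_toFinset_list, List.map_map] at h2
    have hlt : ∀ m ∈ σ, m.2 < m.1.length := by
      rcases hσ with ⟨w, rfl⟩ | rfl | rfl | rfl <;> simp [S₁, S₂, S₃, S₄]
    have hlt' : ∀ m ∈ τ, m.2 < m.1.length := by
      rcases hτ with rfl | rfl
      · exact hlt
      · intro m hm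
        obtain ⟨m', hm', rfl⟩ := List.mem_map.1 hm
        have := hlt m' hm'
        simp only [reverseCompl, List.length_map, List.length_reverse]
        omega
    have hlen : ∀ m ∈ τ, (u ++ m.1 ++ v).length = 2 * k := by
      intro m hm
      have hmem : (u ++ m.1 ++ v, u.length + (m.1.length - 1 - m.2)) ∈
          (toLeft g).image fun p => (p.1.toList, p.2) := by
        rw [he, List.mem_toFinset, List.mem_map]
        exact ⟨m, hm, rfl⟩
      obtain ⟨p, hp, hpe⟩ := Finset.mem_image.1 hmem
      obtain ⟨q, hq, rfl⟩ := Finset.mem_image.1 hp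
      rw [Prod.mk.injEq] at hpe
      rw [← hpe.1]
      simp only [length_toList, q.1.2]
    calc g.image (fun p => (p.1.1.toList, p.2)) = _ := Finset.image_congr fun p hp => by
          have := hg p hp
          simp only [Function.comp_apply, Prod.mk.injEq, true_and]
          omega
      _ = _ := h2
      _ = _ := by
          congr 1
          refine List.map_congr_left fun m hm => ?_
          have h1 := hlt' m hm
          have h2 := hlen m hm
          simp only [List.length_append] at h2
          simp only [Function.comp_apply, insertBetween, Prod.mk.injEq, true_and]
          omega
  rcases hτ with rfl | rfl
  · exact ⟨τ, u, v, hσ, Or.inl key⟩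
  · exact ⟨σ, u, v, hσ, Or.inr key⟩

theorem mem_toLeft {g : MarkedTuple k} {p : Dyck k × ℕ} (hp : p ∈ g) :
    (p.1.1, 2 * k - 1 - p.2) ∈ toLeft g :=
  Finset.mem_image_of_mem (fun p : Dyck k × ℕ => (p.1.1, 2 * k - 1 - p.2)) hp

theorem mem_verts {g : MarkedTuple k} {x : Dyck k} : x ∈ verts g ↔ ∃ j, (x, j) ∈ g := by
  simp [verts]

theorem eq_of_reachable {T : Finset (MarkedTuple k)} {φ : Dyck k → ℕ}
    (h : ∀ g ∈ T, ∀ x ∈ verts g, ∀ y ∈ verts g, φ x = φ y) {x y : Dyck k}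
    (hxy : (cliqueGraph T).Reachable x y) : φ x = φ y := by
  obtain ⟨w⟩ := hxy
  induction w with
  | nil => rfl
  | cons hadj _ ih =>
    obtain ⟨-, g, hg, hx, hy⟩ := hadj
    exact (h g hg _ hx _ hy).trans ih

theorem exists_isSpanningTree {S : Set (Finset (DyckWord × ℕ))}
    (hS : IsTreeOn {x | x.semilength = k} S) :
    ∃ T : Finset (MarkedTuple k), IsSpanningTree k T ∧ IsConflictFree T := by
  classical
  -- Bounding the marks by `2k` makes the subtraction in `toLeft` exact, so that `toLeft` is
  -- injective on `T`.
  let T : Finset (MarkedTuple k) :=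
    ((Finset.univ ×ˢ Finset.range (2 * k)).powerset).filter fun g => toLeft g ∈ S
  have hlt : ∀ g ∈ T, ∀ p ∈ g, p.2 < 2 * k := fun g hg p hp => by
    have := (Finset.mem_powerset.1 (Finset.mem_filter.1 hg).1) hp
    simpa using this
  have hmem : ∀ g ∈ T, toLeft g ∈ S := fun g hg => (Finset.mem_filter.1 hg).2
  have hinj : ∀ g ∈ T, ∀ g' ∈ T, g ≠ g' → toLeft g ≠ toLeft g' := by
    have sub : ∀ g ∈ T, ∀ g' ∈ T, toLeft g = toLeft g' → g ⊆ g' := by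
      intro g hg g' hg' he p hp
      have := mem_toLeft hp
      rw [he] at this
      obtain ⟨q, hq, hqp⟩ := Finset.mem_image.1 this
      rw [Prod.mk.injEq] at hqp
      have h1 := hlt g hg p hp
      have h2 := hlt g' hg' q hq
      have : p = q := Prod.ext (Subtype.ext hqp.1.symm) (by omega)
      rwa [this]
    exact fun g hg g' hg' hne he => hne
      ((sub g hg g' hg' he).antisymm (sub g' hg' g hg he.symm))
  have hsurj : ∀ s ∈ S, ∃ g ∈ T, ∀ p ∈ s, ∃ x : Dyck k, x.1 = p.1 ∧ x ∈ verts g := by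
    intro s hs
    have hsem : ∀ p ∈ s, p.1.semilength = k := fun p hp => hS.sub p ⟨s, hs, hp⟩
    have hslt : ∀ p ∈ s, p.2 < 2 * k := fun p hp => by
      have := (hS.hyperedge s hs).mem_lt hp
      rwa [length_toList, hsem p hp] at this
    let g : MarkedTuple k := s.attach.image fun p =>
      (⟨p.1.1, hsem p.1 p.2⟩, 2 * k - 1 - p.1.2)
    have hg : toLeft g = s := by
      ext p
      simp only [toLeft, g, Finset.mem_image, Finset.mem_attach, true_and]
      constructor
      · rintro ⟨_, ⟨q, rfl⟩, rfl⟩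
        have h1 := hslt q.1 q.2
        rw [show 2 * k - 1 - (2 * k - 1 - q.1.2) = q.1.2 by omega]
        exact q.2
      · intro hp
        have h1 := hslt p hp
        exact ⟨_, ⟨⟨p, hp⟩, rfl⟩, Prod.ext rfl (by simp only; omega)⟩
    refine ⟨g, Finset.mem_filter.2 ⟨Finset.mem_powerset.2 ?_, hg.symm ▸ hs⟩, ?_⟩
    · intro p hp
      obtain ⟨q, -, rfl⟩ := Finset.mem_image.1 hp
      have h1 := hslt q.1 q.2
      simp; omega
    · intro p hp
      exact ⟨⟨p.1, hsem p hp⟩, rfl, mem_verts.2 ⟨2 * k - 1 - p.2,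
        Finset.mem_image.2 ⟨⟨p, hp⟩, Finset.mem_attach _ _, rfl⟩⟩⟩
  have hforest : IsForest T := by
    intro g hg x hx y hy hne hr
    obtain ⟨φ, h1, h2⟩ := hS.forest _ (hmem g hg)
    obtain ⟨i, hi⟩ := mem_verts.1 hx
    obtain ⟨j, hj⟩ := mem_verts.1 hy
    refine hne (Subtype.ext (h2 _ (mem_toLeft hi) _ (mem_toLeft hj) ?_))
    refine eq_of_reachable (φ := fun x => φ x.1) (fun g' hg' a ha b hb => ?_) hr
    obtain ⟨hne', hg'⟩ := Finset.mem_erase.1 hg'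
    obtain ⟨i', hi'⟩ := mem_verts.1 ha
    obtain ⟨j', hj'⟩ := mem_verts.1 hb
    exact h1 _ (hmem g' hg') (hinj g' hg' g hg hne') _ (mem_toLeft hi') _ (mem_toLeft hj')
  have hconn : (cliqueGraph T).Connected := by
    let x₀ : Dyck k := ⟨alt k, semilength_alt k⟩
    have hreach : ∀ x : Dyck k, (cliqueGraph T).Reachable x₀ x := by
      intro x
      -- The indicator of the component of `x₀` is constant on hyperedges, hence constant on all
      -- words.
      let φ : DyckWord → ℕ := fun w => if ∃ z : Dyck k, z.1 = w ∧ (cliqueGraph T).Reachable x₀ z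
        then 1 else 0
      have h1 : φ x₀.1 = 1 := if_pos ⟨x₀, rfl, SimpleGraph.Reachable.refl _⟩
      have h2 : φ x₀.1 = φ x.1 := by
        refine hS.conn φ (fun s hs p hp q hq => ?_) _ x₀.2 _ x.2
        obtain ⟨g, hg, hsg⟩ := hsurj s hs
        obtain ⟨a, ha, hag⟩ := hsg p hp
        obtain ⟨b, hb, hbg⟩ := hsg q hq
        have hab := cliqueGraph_reachable hg hag hbg
        refine if_congr ?_ rfl rfl
        rw [← ha, ← hb]
        constructor
        · rintro ⟨z, hz, hr⟩
          exact ⟨b, rfl, (Subtype.ext hz ▸ hr).trans hab⟩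
        · rintro ⟨z, hz, hr⟩
          exact ⟨a, rfl, (Subtype.ext hz ▸ hr).trans hab.symm⟩
      by_contra hx
      have h3 : φ x.1 = 0 := if_neg (by
        rintro ⟨z, hz, hr⟩
        exact hx (Subtype.ext hz ▸ hr))
      omega
    have : Nonempty (Dyck k) := ⟨x₀⟩
    exact ⟨fun x y => (hreach x).symm.trans (hreach y)⟩
  refine ⟨T, hforest.isSpanningTree
    (fun g hg => isHyperedge_of_toLeft (hlt g hg) (hS.hyperedge _ (hmem g hg))) hconn,
    fun g hg g' hg' hne => hforest.card_inter_le hg hg' hne, ?_⟩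
  rintro g hg g' hg' hne x j _ hj hj' rfl
  exact hS.disj _ (hmem g hg) _ (hmem g' hg') (hinj g hg g' hg' hne) _ (mem_toLeft hj)
    (mem_toLeft hj')

end Conversion

end OddHam

theorem theoremL6 (k : ℕ) (hk : 3 ≤ k) :
    (∃ T : Finset (OddHam.MarkedTuple k),
      OddHam.IsSpanningTree k T ∧ OddHam.IsConflictFree T) ∧
    (∀ T : Finset (OddHam.MarkedTuple k),
      OddHam.IsSpanningTree k T → OddHam.IsConflictFree T →
        (∃ H, OddHam.Yields T H) ∧
        ∀ H, OddHam.Yields T H → OddHam.IsHamiltonEdgeSet k H) ∧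
    (6 ≤ k → ∀ T T' : Finset (OddHam.MarkedTuple k),
      OddHam.IsSpanningTree k T → OddHam.IsConflictFree T →
      OddHam.IsSpanningTree k T' → OddHam.IsConflictFree T' → T ≠ T' →
        ∀ H H', OddHam.Yields T H → OddHam.Yields T' H' → H ≠ H') := by
  refine ⟨?_, fun T hT hc => ⟨OddHam.exists_yields (by omega) hT,
    fun H hH => OddHam.yields_isHamilton (by omega) hT hc hH⟩,
    fun _ T T' hT hc hT' hc' hne H H' hH hH' hHH => hne (OddHam.eq_of_yields_eq (by omega)
      hT.hyperedge hc hT'.hyperedge hc' hH (hHH ▸ hH'))⟩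
  obtain ⟨n, rfl⟩ : ∃ n, k = n + 3 := ⟨k - 3, by omega⟩
  obtain ⟨T, hT⟩ := (OddHam.exists_goodTree_and_goodForest n).1
  exact OddHam.exists_isSpanningTree hT.tree
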